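/- Let $\mathrm{Sh}$ be the Shrikhande graph, i.e. the graph on $\mathbb{Z}_4^2$ in which two vertices are adjacent if and only if their difference is one of $\pm(1,0),\pm(0,1),\pm(1,1)$, let $K_4$ be the complete graph on $4$ vertices, and for integers $m,n\ge 0$ let $D(m,n)=\mathrm{Sh}^m\times K_4^n$ be the Cartesian product of $m$ copies of $\mathrm{Sh}$ and $n$ copies of $K_4$ (a Doob graph if $m>0$, and the Hamming graph $H(n,4)$ if $m=0$). An MDS code in $D(m,n)$ is a maximum independent set of $D(m,n)$, i.e. an independent set of the largest possible cardinality. Then the number of MDS codes in $D(m,n)$ does not exceed $$2^{2^{2m+n-1}(1+o(1))}\qquad\text{as } 2m+n\to\infty;$$ that is, there is a function $\varepsilon:\mathbb{N}\to\mathbb{R}$ with $\varepsilon(N)\to 0$ as $N\to\infty$ such that for all $m,n\ge 0$ the number of MDS codes in $D(m,n)$ is at most $2^{2^{2m+n-1}(1+\varepsilon(2m+n))}$. -/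

import Mathlib

open Filter Topology

/-- The Shrikhande graph: vertex set `ℤ₄ × ℤ₄`, two vertices being adjacent iff their difference
is one of `±(1,0)`, `±(0,1)`, `±(1,1)`. -/
def shrikhande : SimpleGraph (ZMod 4 × ZMod 4) :=
  SimpleGraph.circulantGraph {(1, 0), (0, 1), (1, 1)}

/-- The Cartesian power `G^k`: two tuples are adjacent iff they are adjacent (in `G`) in exactly
one coordinate and coincide in all the other coordinates. -/
def cartesianPower {V : Type*} (G : SimpleGraph V) (k : ℕ) : SimpleGraph (Fin k → V) where
  Adj x y := ∃ i, G.Adj (x i) (y i) ∧ ∀ j, j ≠ i → x j = y j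
  symm := ⟨fun _ _ ⟨i, h, h'⟩ => ⟨i, h.symm, fun j hj => (h' j hj).symm⟩⟩
  loopless := ⟨fun _ ⟨_, h, _⟩ => h.ne rfl⟩

/-- The vertices of `D(m,n)`. -/
abbrev DoobVertex (m n : ℕ) : Type :=
  (Fin m → ZMod 4 × ZMod 4) × (Fin n → Fin 4)

/-- The graph `D(m,n) = Sh^m × K₄^n` (Cartesian product of graphs). It is a Doob graph if
`0 < m`, and the Hamming graph `H(n,4)` if `m = 0`. -/
def doobGraph (m n : ℕ) : SimpleGraph (DoobVertex m n) :=
  (cartesianPower shrikhande m).boxProd (cartesianPower (⊤ : SimpleGraph (Fin 4)) n)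

/-- The set of (distance-2) MDS codes in `D(m,n)`, i.e. of its maximum independent sets. -/
def MDS (m n : ℕ) : Set (Finset (DoobVertex m n)) :=
  {M | (doobGraph m n).IsMaximumIndepSet M}

/-! The count is reduced to Latin functions, that is, functions of d variables over a four-letter
alphabet that change whenever exactly one argument changes.

Reduction. A proper colouring by Z_2^2 yields an independent set of density at least 1/4, while an
independent set has at most 4 of the 16 points of a Shrikhande fibre and at most 1 of the 4 points
of a complete line. Double counting makes every fibre of a maximum independent set tight. The
sixteen independent 4-sets of the Shrikhande graph form three overlapping types, permuted by an
automorphism, and in each coordinate one type serves all fibres (`IsDoobCode.exists_type`). At the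
cost of a factor 3^m all fibres are of row type, and such a code is determined by 2^m codes of
H(m+n,4), each the graph of a Latin function of m+n-1 variables (`ncard_MDS_le`). It remains to
bound the number of Latin functions by 2^((1+o(1))2^d) (`doubleExpBound_latin`).

Main count. Choose a pair of letters in every coordinate. On the resulting binary box f is a proper
4-colouring of the cube, and Finner's inequality bounds the number of these by 2^(2^d(1+O(1/d)))
(`cubeColoringCount_le`). Then the coordinates are released one at a time, from the last to the
first. Once two values on a line are known, the other two are known up to order, and lines whose
value pairs meet force each other's order. So a stage costs one bit for each component of a link
graph. For random pairs the stage t costs at most 2^(d-1)(5/6)^t on average (`sum_stageLoss_le`), so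
only the stages t < T can be too expensive.

Expensive stages. If the first link graph of f, or of one of its iterated slices, has many
components, one of them is small. A small component with the value pairs on it determines the value
pairs everywhere (`propagates_balancedLists`), and there are only exponentially many such data
(`exists_ncard_listPairs_le`), so few functions are `IsNice`. Functions with no nice slice in the
top T levels are handled by the main count (`ncard_bad_le`). The others are counted by recursion on
slices: two slices of a function that is not nice almost determine it. This recursion halves the
distance between exponents rather than closing it, but it lowers any admissible exponent C > 1. Near
the infimum of the admissible exponents the gain is bounded below, so the infimum is 1.

The same propagation principle, transferred to Doob graphs, shows that the type of a fibre is
constant. -/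

/-! ### Counting connected components of induced subgraphs -/

section Components

variable {V : Type*} (G : SimpleGraph V)

/-- The number of connected components of the subgraph of `G` induced by `s`. -/
noncomputable def compCount {V : Type*} (G : SimpleGraph V) (s : Set V) : ℕ :=
  Nat.card (G.induce s).ConnectedComponent

/-- The number of components of `G.induce s` without edges to `t`. -/
noncomputable def isolatedCount {V : Type*} (G : SimpleGraph V) (s t : Set V) : ℕ :=
  Nat.card {c : (G.induce s).ConnectedComponent //
    ∀ x : s, (G.induce s).connectedComponentMk x = c → ∀ y ∈ t, ¬ G.Adj x y}

/-- The map between components induced by an inclusion of vertex sets. -/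
def compInclusion {V : Type*} (G : SimpleGraph V) {s t : Set V} (h : s ⊆ t) :
    (G.induce s).ConnectedComponent → (G.induce t).ConnectedComponent :=
  SimpleGraph.ConnectedComponent.map (SimpleGraph.induceHomOfLE G h).toHom

/-- Components of the two parts mapped to components of the union. -/
def compUnionMap {V : Type*} (G : SimpleGraph V) (s t : Set V) :
    (G.induce s).ConnectedComponent ⊕ (G.induce t).ConnectedComponent →
      (G.induce (s ∪ t)).ConnectedComponent :=
  Sum.elim (compInclusion G Set.subset_union_left) (compInclusion G Set.subset_union_right)

lemma compUnionMap_surjective (s t : Set V) : Function.Surjective (compUnionMap G s t) := by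
  intro c
  induction c using SimpleGraph.ConnectedComponent.ind with
  | _ x =>
    obtain ⟨x, hx | hx⟩ := x
    · exact ⟨Sum.inl ((G.induce s).connectedComponentMk ⟨x, hx⟩), rfl⟩
    · exact ⟨Sum.inr ((G.induce t).connectedComponentMk ⟨x, hx⟩), rfl⟩

lemma compCount_union_le [Finite V] (s t : Set V) :
    compCount G (s ∪ t) ≤ compCount G s + compCount G t := by
  classical
  unfold compCount
  rw [← Nat.card_sum]
  exact Nat.card_le_card_of_surjective _ (compUnionMap_surjective G s t)

/-- A component of the union either contains at least two components of the parts, or contains a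
component of one part without edges to the other; the latter is counted a second time by
`isolatedCount`. -/
lemma two_mul_compCount_union_le [Finite V] (s t : Set V) :
    2 * compCount G (s ∪ t) ≤
      compCount G s + compCount G t + (isolatedCount G s t + isolatedCount G t s) := by
  classical
  have := Fintype.ofFinite V
  let D := (G.induce s).ConnectedComponent ⊕ (G.induce t).ConnectedComponent
  let I := {c : (G.induce s).ConnectedComponent //
    ∀ x : s, (G.induce s).connectedComponentMk x = c → ∀ y ∈ t, ¬ G.Adj x y} ⊕
    {c : (G.induce t).ConnectedComponent //
    ∀ x : t, (G.induce t).connectedComponentMk x = c → ∀ y ∈ s, ¬ G.Adj x y}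
  let E := (G.induce (s ∪ t)).ConnectedComponent
  have : Fintype D := Fintype.ofFinite _
  have : Fintype I := Fintype.ofFinite _
  have : Fintype E := Fintype.ofFinite _
  let p : D → E := compUnionMap G s t
  let r : I → E := fun z => p (Sum.map Subtype.val Subtype.val z)
  have key : ∀ e : E, 2 ≤ (Finset.univ.filter (fun z : D => p z = e)).card +
      (Finset.univ.filter (fun z : I => r z = e)).card := by
    intro e
    obtain ⟨z, hz⟩ := compUnionMap_surjective G s t e
    rcases z with c | c
    · by_cases hc : ∀ x : s, (G.induce s).connectedComponentMk x = c → ∀ y ∈ t, ¬ G.Adj x y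
      · have h1 : 0 < (Finset.univ.filter (fun z : D => p z = e)).card :=
          Finset.card_pos.2 ⟨Sum.inl c, by simp [p, hz]⟩
        have h2 : 0 < (Finset.univ.filter (fun z : I => r z = e)).card :=
          Finset.card_pos.2 ⟨Sum.inl ⟨c, hc⟩, by simp [r, p, hz]⟩
        omega
      · push Not at hc
        obtain ⟨x, hx, y, hy, hxy⟩ := hc
        have h1 : 1 < (Finset.univ.filter (fun z : D => p z = e)).card := by
          refine Finset.one_lt_card.2 ⟨Sum.inl c, by simp [p, hz],
            Sum.inr ((G.induce t).connectedComponentMk ⟨y, hy⟩), ?_, by simp⟩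
          simp only [Finset.mem_filter, Finset.mem_univ, true_and]
          rw [← hz, ← hx]
          refine SimpleGraph.ConnectedComponent.sound (SimpleGraph.Adj.reachable ?_)
          exact hxy.symm
        omega
    · by_cases hc : ∀ x : t, (G.induce t).connectedComponentMk x = c → ∀ y ∈ s, ¬ G.Adj x y
      · have h1 : 0 < (Finset.univ.filter (fun z : D => p z = e)).card :=
          Finset.card_pos.2 ⟨Sum.inr c, by simp [p, hz]⟩
        have h2 : 0 < (Finset.univ.filter (fun z : I => r z = e)).card :=
          Finset.card_pos.2 ⟨Sum.inr ⟨c, hc⟩, by simp [r, p, hz]⟩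
        omega
      · push Not at hc
        obtain ⟨x, hx, y, hy, hxy⟩ := hc
        have h1 : 1 < (Finset.univ.filter (fun z : D => p z = e)).card := by
          refine Finset.one_lt_card.2 ⟨Sum.inr c, by simp [p, hz],
            Sum.inl ((G.induce s).connectedComponentMk ⟨y, hy⟩), ?_, by simp⟩
          simp only [Finset.mem_filter, Finset.mem_univ, true_and]
          rw [← hz, ← hx]
          refine SimpleGraph.ConnectedComponent.sound (SimpleGraph.Adj.reachable ?_)
          exact hxy.symm
        omega
  have hsum : ∑ e : E, 2 ≤ ∑ e : E, ((Finset.univ.filter (fun z : D => p z = e)).card +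
      (Finset.univ.filter (fun z : I => r z = e)).card) := Finset.sum_le_sum fun e _ => key e
  have hD := Finset.card_eq_sum_card_fiberwise (s := (Finset.univ : Finset D)) (f := p)
    (t := Finset.univ) (by simp [Set.MapsTo])
  have hI := Finset.card_eq_sum_card_fiberwise (s := (Finset.univ : Finset I)) (f := r)
    (t := Finset.univ) (by simp [Set.MapsTo])
  rw [Finset.sum_add_distrib, ← hD, ← hI] at hsum
  simp only [Finset.sum_const, Finset.card_univ, smul_eq_mul] at hsum
  unfold compCount isolatedCount
  rw [← Nat.card_sum, ← Nat.card_sum]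
  change 2 * Nat.card E ≤ Nat.card D + Nat.card I
  simp only [Nat.card_eq_fintype_card]
  linarith

/-- The vertex set in `V` of a component of `G.induce s`. -/
def compSet {V : Type*} (G : SimpleGraph V) {s : Set V} (c : (G.induce s).ConnectedComponent) :
    Set V := {x | ∃ h : x ∈ s, (G.induce s).connectedComponentMk ⟨x, h⟩ = c}

lemma compSet_nonempty {s : Set V} (c : (G.induce s).ConnectedComponent) :
    (compSet G c).Nonempty := by
  induction c using SimpleGraph.ConnectedComponent.ind with
  | _ x => exact ⟨x, x.2, rfl⟩

lemma compSet_subset {s : Set V} (c : (G.induce s).ConnectedComponent) : compSet G c ⊆ s :=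
  fun _ h => h.1

lemma compSet_closed {s : Set V} (c : (G.induce s).ConnectedComponent) {x y : V}
    (hx : x ∈ compSet G c) (hy : y ∈ s) (h : G.Adj x y) : y ∈ compSet G c := by
  obtain ⟨hxs, rfl⟩ := hx
  exact ⟨hy, SimpleGraph.ConnectedComponent.sound (SimpleGraph.Adj.reachable h.symm)⟩

lemma sum_ncard_compSet [Fintype V] (s : Set V) [Fintype (G.induce s).ConnectedComponent] :
    ∑ c : (G.induce s).ConnectedComponent, (compSet G c).ncard = s.ncard := by
  classical
  have h := Finset.card_eq_sum_card_fiberwise (s := (Finset.univ : Finset s))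
    (f := (G.induce s).connectedComponentMk) (t := Finset.univ) (by simp [Set.MapsTo])
  rw [Finset.card_univ, ← Nat.card_eq_fintype_card, Nat.card_coe_set_eq] at h
  rw [h]
  refine Finset.sum_congr rfl fun c _ => ?_
  rw [← Set.ncard_coe_finset, ← Set.ncard_image_of_injective _ Subtype.val_injective]
  congr 1
  ext x
  simp [compSet]

/-- If every component has at least `k` elements, there are at most `|s| / k` of them. -/
lemma compCount_mul_le [Finite V] (s : Set V) (k : ℕ)
    (h : ∀ c : (G.induce s).ConnectedComponent, k ≤ (compSet G c).ncard) :
    compCount G s * k ≤ s.ncard := by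
  classical
  have := Fintype.ofFinite V
  have : Fintype (G.induce s).ConnectedComponent := Fintype.ofFinite _
  rw [← sum_ncard_compSet G s, compCount, Nat.card_eq_fintype_card]
  calc _ = ∑ c : (G.induce s).ConnectedComponent, k := by simp
    _ ≤ _ := Finset.sum_le_sum fun c _ => h c

/-- A surjective homomorphism does not increase the number of components. -/
lemma compCount_le_of_surjOn {W : Type*} [Finite W] (H : SimpleGraph W) (s : Set V) (t : Set W)
    (φ : W → V) (hφ : Set.MapsTo φ t s) (hs : Set.SurjOn φ t s)
    (hadj : ∀ x ∈ t, ∀ y ∈ t, H.Adj x y → G.Adj (φ x) (φ y)) :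
    compCount G s ≤ compCount H t := by
  let F : H.induce t →g G.induce s :=
    ⟨fun x => ⟨φ x, hφ x.2⟩, fun {x y} h => hadj x x.2 y y.2 h⟩
  refine Nat.card_le_card_of_surjective (SimpleGraph.ConnectedComponent.map F) ?_
  intro c
  induction c using SimpleGraph.ConnectedComponent.ind with
  | _ x =>
    obtain ⟨y, hy, hyx⟩ := hs x.2
    exact ⟨(H.induce t).connectedComponentMk ⟨y, hy⟩, by
      rw [SimpleGraph.ConnectedComponent.map_mk]; congr 1; exact Subtype.ext hyx⟩

end Components

/-! ### Merging two of four parts at random. -/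

section ComponentsOfFourParts

variable {V : Type*} [Finite V] (G : SimpleGraph V)

/-- A component has an edge to at least one of the three other parts, hence is isolated from at most
two of them. -/
lemma sum_isolatedCount_le (R : Fin 4 → Set V)
    (hR : ∀ a, ∀ x ∈ R a, ∃ b, b ≠ a ∧ ∃ y ∈ R b, G.Adj x y) (a : Fin 4) :
    ∑ b : Fin 4, (if a ≠ b then isolatedCount G (R a) (R b) else 0) ≤
      2 * compCount G (R a) := by
  classical
  have := Fintype.ofFinite V
  let C := (G.induce (R a)).ConnectedComponent
  have : Fintype C := Fintype.ofFinite _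
  let P : C → Fin 4 → Prop := fun c b =>
    ∀ x : R a, (G.induce (R a)).connectedComponentMk x = c → ∀ y ∈ R b, ¬ G.Adj x y
  have h1 : ∀ b, isolatedCount G (R a) (R b) = ∑ c : C, if P c b then 1 else 0 := by
    intro b
    unfold isolatedCount
    rw [Nat.card_eq_fintype_card, Fintype.card_subtype, Finset.card_filter]
  have h2 : ∀ c : C, ∑ b : Fin 4, (if a ≠ b then (if P c b then 1 else 0) else 0) ≤ 2 := by
    intro c
    obtain ⟨x, hx, hc⟩ := compSet_nonempty G c
    obtain ⟨b, hb, y, hy, hxy⟩ := hR a x hx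
    have hPb : ¬ P c b := fun h => h ⟨x, hx⟩ hc y hy hxy
    calc ∑ b : Fin 4, (if a ≠ b then (if P c b then 1 else 0) else 0)
        ≤ ∑ b' : Fin 4, (if b' ∈ ((Finset.univ.erase a).erase b) then 1 else 0) := by
          refine Finset.sum_le_sum fun b' _ => ?_
          by_cases h : a = b'
          · simp [h]
          · by_cases h' : b' = b
            · subst h'; simp [hPb]
            · simp only [ne_eq, h, not_false_eq_true, ↓reduceIte, Finset.mem_erase, h',
                Finset.mem_univ, and_true, true_and]
              rw [if_pos (Ne.symm h)]
              split_ifs <;> simp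
      _ = ((Finset.univ.erase a).erase b).card := by
          rw [Finset.sum_ite_mem, Finset.univ_inter]; simp
      _ = 2 := by
          rw [Finset.card_erase_of_mem (by simp [hb]), Finset.card_erase_of_mem (by simp)]
          simp
  calc ∑ b : Fin 4, (if a ≠ b then isolatedCount G (R a) (R b) else 0)
      = ∑ b : Fin 4, ∑ c : C, (if a ≠ b then (if P c b then 1 else 0) else 0) := by
        refine Finset.sum_congr rfl fun b _ => ?_
        rw [h1 b]
        split_ifs <;> simp
    _ = ∑ c : C, ∑ b : Fin 4, (if a ≠ b then (if P c b then 1 else 0) else 0) :=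
        Finset.sum_comm
    _ ≤ ∑ c : C, 2 := Finset.sum_le_sum fun c _ => h2 c
    _ = 2 * compCount G (R a) := by
        rw [compCount, Nat.card_eq_fintype_card]; simp [mul_comm]; rfl

/-- If every vertex of each of four parts has a neighbour in another part, then the unions of two
parts have on average at most `5/6` of the components of the separate parts. -/
lemma sum_compCount_union_le (R : Fin 4 → Set V)
    (hR : ∀ a, ∀ x ∈ R a, ∃ b, b ≠ a ∧ ∃ y ∈ R b, G.Adj x y) :
    ∑ a : Fin 4, ∑ b : Fin 4, (if a ≠ b then compCount G (R a ∪ R b) else 0) ≤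
      5 * ∑ a : Fin 4, compCount G (R a) := by
  have h1 : ∑ a : Fin 4, ∑ b : Fin 4, (if a ≠ b then 2 * compCount G (R a ∪ R b) else 0) ≤
      ∑ a : Fin 4, ∑ b : Fin 4, ((if a ≠ b then compCount G (R a) + compCount G (R b) else 0) +
        ((if a ≠ b then isolatedCount G (R a) (R b) else 0) +
          (if a ≠ b then isolatedCount G (R b) (R a) else 0))) := by
    refine Finset.sum_le_sum fun a _ => Finset.sum_le_sum fun b _ => ?_
    split_ifs
    · exact two_mul_compCount_union_le G _ _
    · simp
  have h2 : ∑ a : Fin 4, ∑ b : Fin 4, (if a ≠ b then isolatedCount G (R a) (R b) else 0) ≤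
      2 * ∑ a : Fin 4, compCount G (R a) := by
    rw [Finset.mul_sum]
    exact Finset.sum_le_sum fun a _ => sum_isolatedCount_le G R hR a
  have h3 : ∑ a : Fin 4, ∑ b : Fin 4, (if a ≠ b then isolatedCount G (R b) (R a) else 0) ≤
      2 * ∑ a : Fin 4, compCount G (R a) := by
    rw [Finset.sum_comm]
    simp only [ne_comm]
    simpa only [ne_comm] using h2
  have h4 : ∑ a : Fin 4, ∑ b : Fin 4,
      (if a ≠ b then compCount G (R a) + compCount G (R b) else 0) =
      6 * ∑ a : Fin 4, compCount G (R a) := by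
    simp [Fin.sum_univ_four]
    ring
  have h5 : ∑ a : Fin 4, ∑ b : Fin 4, (if a ≠ b then 2 * compCount G (R a ∪ R b) else 0) =
      2 * ∑ a : Fin 4, ∑ b : Fin 4, (if a ≠ b then compCount G (R a ∪ R b) else 0) := by
    simp [Finset.mul_sum]
  -- Twice the left side is at most 6 + 2 + 2 = 10 times the total number of components.
  simp only [Finset.sum_add_distrib] at h1 h4
  rw [h5] at h1
  omega

end ComponentsOfFourParts

/-! ### Latin functions and their link graphs -/

section Latin

open Function

variable {ι : Type*} [DecidableEq ι]

/-- A function is Latin if its value changes whenever exactly one argument changes. -/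
def IsLatin (f : (ι → Fin 4) → Fin 4) : Prop :=
  ∀ x i c, c ≠ x i → f (update x i c) ≠ f x

lemma IsLatin.injective {f : (ι → Fin 4) → Fin 4} (hf : IsLatin f) (x : ι → Fin 4) (i : ι) :
    Injective fun c => f (update x i c) := by
  intro c c' h
  by_contra hne
  refine hf (update x i c') i c (by simpa using hne) ?_
  simpa using h

lemma IsLatin.surjective {f : (ι → Fin 4) → Fin 4} (hf : IsLatin f) (x : ι → Fin 4) (i : ι) :
    Surjective fun c => f (update x i c) :=
  Finite.surjective_of_injective (hf.injective x i)

/-- Positions `y`, `y'` differing in one coordinate other than `j` are linked if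
the pairs of values of `f` obtained by setting the coordinate `j` to `a` or `b` intersect. -/
def linkGraph (f : (ι → Fin 4) → Fin 4) (j : ι) (a b : Fin 4) : SimpleGraph (ι → Fin 4) where
  Adj y y' := y ≠ y' ∧ (∃ i, i ≠ j ∧ ∃ c, y' = update y i c) ∧
    ∃ u, (u = a ∨ u = b) ∧ ∃ v, (v = a ∨ v = b) ∧ f (update y j u) = f (update y' j v)
  symm := ⟨by
    rintro y y' ⟨hne, ⟨i, hi, c, rfl⟩, u, hu, v, hv, h⟩
    exact ⟨hne.symm, ⟨i, hi, y i, by simp⟩, v, hv, u, hu, h.symm⟩⟩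
  loopless := ⟨fun y h => h.1 rfl⟩

/-- Choose `c` so that with coordinate `j` at `b` the function repeats the value it had at `a`.
Since `a ≠ b`, coordinate `i` really moves. Thus links exist in every direction. -/
lemma exists_linkGraph_adj {f : (ι → Fin 4) → Fin 4} (hf : IsLatin f) {i j : ι} (hij : i ≠ j)
    {a b : Fin 4} (hab : a ≠ b) (y : ι → Fin 4) :
    ∃ c, c ≠ y i ∧ (linkGraph f j a b).Adj y (update y i c) := by
  obtain ⟨c, hc⟩ := hf.surjective (update y j b) i (f (update y j a))
  simp only at hc
  have hcy : c ≠ y i := by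
    rintro rfl
    have h1 : update (update y j b) i (y i) = update y j b := by
      rw [update_comm hij.symm, update_eq_self]
    rw [h1] at hc
    exact hab.symm (hf.injective y j hc)
  refine ⟨c, hcy, ?_, ⟨i, hij, c, rfl⟩, a, Or.inl rfl, b, Or.inr rfl, ?_⟩
  · intro h
    apply hcy
    have := congrFun h i
    simpa using this.symm
  · rw [← hc, update_comm hij]

/-- Induction on the free coordinates `U`: the link in direction `i` does not leave the set, so at
least two slices in that direction are nonempty. `B` records the constraints on the coordinates
already frozen. -/
lemma two_pow_le_ncard_of_closed [Finite ι] {f : (ι → Fin 4) → Fin 4} (hf : IsLatin f) {j : ι}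
    {a b : Fin 4} (hab : a ≠ b) (U : Finset ι) (hj : j ∉ U) (B : ι → Set (Fin 4))
    (K : Set (ι → Fin 4)) (hK : K ⊆ {y | ∀ i ∉ U, y i ∈ B i}) (hne : K.Nonempty)
    (hcl : ∀ x ∈ K, ∀ y, (∀ i ∉ U, y i ∈ B i) → (linkGraph f j a b).Adj x y → y ∈ K) :
    2 ^ U.card ≤ K.ncard := by
  classical
  induction U using Finset.induction_on generalizing B K with
  | empty =>
    have := (Set.ncard_pos (Set.toFinite K)).2 hne
    rw [Finset.card_empty, pow_zero]
    omega
  | insert i U hi ih =>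
    have hij : i ≠ j := by rintro rfl; simp at hj
    have hjU : j ∉ U := fun h => hj (Finset.mem_insert_of_mem h)
    have key : ∀ c, (K ∩ {y | y i = c}).Nonempty → 2 ^ U.card ≤ (K ∩ {y | y i = c}).ncard := by
      intro c hc
      refine ih hjU (update B i {c}) _ ?_ hc ?_
      · rintro y ⟨hy, hyc⟩ k hk
        by_cases hki : k = i
        · subst hki; simpa using hyc
        · simpa [hki] using hK hy k (by simp [hki, hk])
      · rintro x ⟨hx, hxc⟩ y hy hxy
        refine ⟨hcl x hx y (fun k hk => ?_) hxy, ?_⟩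
        · have h1 := hy k (fun h => hk (Finset.mem_insert_of_mem h))
          have hki : k ≠ i := by rintro rfl; simp at hk
          simpa [hki] using h1
        · simpa using hy i hi
    obtain ⟨y, hy⟩ := hne
    obtain ⟨c, hc, hadj⟩ := exists_linkGraph_adj hf hij hab y
    have hy' : update y i c ∈ K := hcl y hy _ (fun k hk => by
      have hki : k ≠ i := by rintro rfl; simp at hk
      simpa [hki] using hK hy k hk) hadj
    have h1 := key (y i) ⟨y, hy, rfl⟩
    have h2 := key c ⟨_, hy', by simp⟩
    have hdis : Disjoint (K ∩ {z | z i = y i}) (K ∩ {z | z i = c}) := by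
      rw [Set.disjoint_left]
      rintro z ⟨-, h⟩ ⟨-, h'⟩
      exact hc (h'.symm.trans h)
    have h3 : (K ∩ {z | z i = y i} ∪ K ∩ {z | z i = c}).ncard ≤ K.ncard :=
      Set.ncard_le_ncard (by intro z hz; rcases hz with h | h <;> exact h.1) (Set.toFinite _)
    rw [Set.ncard_union_eq hdis (Set.toFinite _) (Set.toFinite _)] at h3
    rw [Finset.card_insert_of_notMem hi, pow_succ]
    omega

end Latin

/-! ### Average number of components at each stage. -/

section StageLoss

open Function

/-- Ordered pairs of distinct elements of `Fin 4`. -/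
abbrev DistinctPair : Type := {p : Fin 4 × Fin 4 // p.1 ≠ p.2}

/-- The positions whose coordinates before `t` lie in the pairs given by `Q`; the coordinate `t`
itself is irrelevant and normalised. -/
def stageRegion {d : ℕ} (Q : Fin d → DistinctPair) (t : Fin d) : Set (Fin d → Fin 4) :=
  {y | (∀ i < t, y i = (Q i).1.1 ∨ y i = (Q i).1.2) ∧ y t = 0}

/-- The number of binary choices when a Latin function, known where the coordinates up to `t` lie
in the pairs of `Q`, is extended to all values of the coordinate `t`. -/
noncomputable def stageLoss {d : ℕ} (f : (Fin d → Fin 4) → Fin 4) (Q : Fin d → DistinctPair)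
    (t : Fin d) : ℕ :=
  compCount (linkGraph f t (Q t).1.1 (Q t).1.2) (stageRegion Q t)

lemma IsLatin.cons {d : ℕ} {f : (Fin (d + 1) → Fin 4) → Fin 4} (hf : IsLatin f) (c : Fin 4) :
    IsLatin fun y : Fin d → Fin 4 => f (Fin.cons c y) := by
  intro x i e he
  simp only [Fin.cons_update]
  exact hf _ _ _ (by simpa using he)

/-- The part of a stage region with a prescribed first coordinate. -/
def stageSlice {d : ℕ} (Q : Fin d → DistinctPair) (t : Fin d) (c : Fin 4) :
    Set (Fin (d + 1) → Fin 4) := {y | y 0 = c ∧ Fin.tail y ∈ stageRegion Q t}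

lemma stageRegion_succ {d : ℕ} (Q : Fin (d + 1) → DistinctPair) (t : Fin d) :
    stageRegion Q t.succ = stageSlice (Fin.tail Q) t (Q 0).1.1 ∪
      stageSlice (Fin.tail Q) t (Q 0).1.2 := by
  ext y
  simp only [stageRegion, stageSlice, Set.mem_ofPred_eq, Set.mem_union, Fin.forall_fin_succ,
    Fin.succ_lt_succ_iff, Fin.tail, Fin.succ_pos, forall_true_left]
  tauto

lemma compCount_stageSlice_le {d : ℕ} (f : (Fin (d + 1) → Fin 4) → Fin 4) (a b : Fin 4)
    (Q : Fin d → DistinctPair) (t : Fin d) (c : Fin 4) :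
    compCount (linkGraph f t.succ a b) (stageSlice Q t c) ≤
      compCount (linkGraph (fun y => f (Fin.cons c y)) t a b) (stageRegion Q t) := by
  refine compCount_le_of_surjOn _ _ _ _ (fun y => (Fin.cons c y : Fin (d + 1) → Fin 4)) ?_ ?_ ?_
  · intro y hy
    exact ⟨rfl, by simpa using hy⟩
  · rintro y ⟨hy0, hy⟩
    refine ⟨Fin.tail y, hy, ?_⟩
    subst hy0
    exact Fin.cons_self_tail y
  · rintro y - y' - ⟨hne, ⟨i, hi, e, rfl⟩, u, hu, v, hv, h⟩
    refine ⟨fun h => hne (Fin.cons_right_injective _ h), ⟨i.succ, by simpa using hi, e, ?_⟩,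
      u, hu, v, hv, ?_⟩
    · rw [Fin.cons_update]
    · rw [← Fin.cons_update, ← Fin.cons_update]
      exact h

/-- The 4^d positions fall into components of at least 2^d positions each. -/
lemma stageLoss_zero_le {d : ℕ} {f : (Fin (d + 1) → Fin 4) → Fin 4} (hf : IsLatin f)
    (Q : Fin (d + 1) → DistinctPair) : stageLoss f Q 0 ≤ 2 ^ d := by
  have h := compCount_mul_le (linkGraph f 0 (Q 0).1.1 (Q 0).1.2) (stageRegion Q 0) (2 ^ d) ?_
  · have h2 : (stageRegion Q 0).ncard = 4 ^ d := by
      have : stageRegion Q 0 = (fun y : Fin d → Fin 4 => (Fin.cons 0 y : Fin (d + 1) → Fin 4)) ''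
          Set.univ := by
        ext y
        simp only [stageRegion, Fin.not_lt_zero, IsEmpty.forall_iff, implies_true, true_and,
          Set.mem_ofPred_eq, Set.image_univ, Set.mem_range]
        constructor
        · intro h
          exact ⟨Fin.tail y, by rw [← h]; exact Fin.cons_self_tail y⟩
        · rintro ⟨z, rfl⟩
          rfl
      have hinj : Injective fun y : Fin d → Fin 4 => (Fin.cons 0 y : Fin (d + 1) → Fin 4) :=
        Fin.cons_right_injective (α := fun _ => Fin 4) 0
      rw [this, Set.ncard_image_of_injective _ hinj, Set.ncard_univ]
      simp
    rw [h2] at h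
    have h3 : (4 : ℕ) ^ d = 2 ^ d * 2 ^ d := by rw [← mul_pow]; norm_num
    rw [h3] at h
    exact Nat.le_of_mul_le_mul_right h (by positivity)
  · intro c
    have := two_pow_le_ncard_of_closed (j := 0) hf (Q 0).2 (Finset.univ.erase 0) (by simp)
      (fun _ => {0}) (compSet _ c) ?_ (compSet_nonempty _ c) ?_
    · simpa using this
    · intro y hy i hi
      have := compSet_subset _ c hy
      simp only [Finset.mem_erase, Finset.mem_univ, and_true, not_not] at hi
      subst hi
      simpa [stageRegion] using this
    · intro x hx y hy hxy
      refine compSet_closed _ c hx ?_ hxy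
      have := hy 0 (by simp)
      simpa [stageRegion] using this

/-- In probabilistic form, the mean of `stageLoss f Q t` over the 12^d choices of `Q` is at most
2^(d-1)(5/6)^t. Removing the first coordinate leaves four slices. Its random pair merges two of
them, which on average saves a sixth of their components, because each position is linked to a
position of another slice. -/
lemma sum_stageLoss_le {d : ℕ} {f : (Fin d → Fin 4) → Fin 4} (hf : IsLatin f) (t : Fin d) :
    2 * ∑ Q : Fin d → DistinctPair, stageLoss f Q t * 6 ^ (t : ℕ) ≤
      12 ^ d * 2 ^ d * 5 ^ (t : ℕ) := by
  induction d with
  | zero => exact t.elim0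
  | succ d ih =>
    refine Fin.cases ?_ (fun t => ?_) t
    · have hP : Fintype.card DistinctPair = 12 := by decide
      have := Finset.sum_le_sum fun (Q : Fin (d + 1) → DistinctPair) (_ : Q ∈ Finset.univ) =>
        stageLoss_zero_le hf Q
      simp only [Finset.sum_const, Finset.card_univ, Fintype.card_fun, hP, Fintype.card_fin,
        smul_eq_mul] at this
      simp only [Fin.val_zero, pow_zero, mul_one]
      calc _ ≤ 2 * (12 ^ (d + 1) * 2 ^ d) := Nat.mul_le_mul_left _ this
        _ = _ := by ring
    · have hsum : ∑ Q : Fin (d + 1) → DistinctPair, stageLoss f Q t.succ ≤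
          5 * ∑ c : Fin 4, ∑ Q : Fin d → DistinctPair, stageLoss (fun y => f (Fin.cons c y)) Q t := by
        rw [← (Fin.consEquiv (fun _ : Fin (d + 1) => DistinctPair)).sum_comp,
          Fintype.sum_prod_type, Finset.sum_comm, Finset.sum_comm (γ := Fin 4), Finset.mul_sum]
        refine Finset.sum_le_sum fun Q _ => ?_
        let G := linkGraph f t.succ (Q t).1.1 (Q t).1.2
        have h1 : ∀ p : DistinctPair,
            stageLoss f (Fin.consEquiv (fun _ : Fin (d + 1) => DistinctPair) (p, Q)) t.succ =
            (fun q : Fin 4 × Fin 4 => compCount G (stageSlice Q t q.1 ∪ stageSlice Q t q.2)) p := by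
          intro p
          simp only [stageLoss, stageRegion_succ]
          rfl
        simp only [h1]
        have h2 := Finset.sum_subtype_eq_sum_filter (s := (Finset.univ : Finset (Fin 4 × Fin 4)))
          (p := fun q => q.1 ≠ q.2)
          (fun q : Fin 4 × Fin 4 => compCount G (stageSlice Q t q.1 ∪ stageSlice Q t q.2))
        have h3 : ∑ p : DistinctPair, (fun q : Fin 4 × Fin 4 =>
            compCount G (stageSlice Q t q.1 ∪ stageSlice Q t q.2)) p =
            ∑ a : Fin 4, ∑ b : Fin 4,
              (if a ≠ b then compCount G (stageSlice Q t a ∪ stageSlice Q t b) else 0) := by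
          rw [← Fintype.sum_prod_type' (f := fun a b => (if a ≠ b then
            compCount G (stageSlice Q t a ∪ stageSlice Q t b) else 0)), ← Finset.sum_filter]
          rw [← h2]
          refine Finset.sum_congr ?_ fun _ _ => rfl
          ext; simp
        rw [h3]
        refine (sum_compCount_union_le G (stageSlice Q t) ?_).trans ?_
        · rintro a x ⟨hx0, hx⟩
          obtain ⟨c, hc, hadj⟩ := exists_linkGraph_adj hf (Fin.succ_ne_zero t).symm (Q t).2 x
          refine ⟨c, by rwa [← hx0], _, ⟨by simp, ?_⟩, hadj⟩
          rwa [Fin.tail_update_zero]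
        · refine Nat.mul_le_mul_left _ (Finset.sum_le_sum fun c _ => ?_)
          exact compCount_stageSlice_le f _ _ Q t c
      have h4 : ∀ c : Fin 4, 2 * ∑ Q : Fin d → DistinctPair,
          stageLoss (fun y => f (Fin.cons c y)) Q t * 6 ^ (t : ℕ) ≤
          12 ^ d * 2 ^ d * 5 ^ (t : ℕ) := fun c => ih (hf.cons c) t
      have h5 := Finset.sum_le_sum fun c (_ : c ∈ (Finset.univ : Finset (Fin 4))) => h4 c
      simp only [Finset.sum_const, Finset.card_univ, Fintype.card_fin, smul_eq_mul,
        ← Finset.mul_sum, ← Finset.sum_mul] at h5 ⊢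
      calc 2 * ((∑ Q, stageLoss f Q t.succ) * 6 ^ (t.succ : ℕ))
          ≤ 2 * ((5 * ∑ c : Fin 4, ∑ Q : Fin d → DistinctPair,
            stageLoss (fun y => f (Fin.cons c y)) Q t) * 6 ^ (t.succ : ℕ)) := by gcongr
        -- The factor 5 comes from merging and 6 from the cleared denominator; with four slices, 30
        -- * 4 = 12 * 2 * 5.
        _ = 30 * (2 * ((∑ c : Fin 4, ∑ Q : Fin d → DistinctPair,
            stageLoss (fun y => f (Fin.cons c y)) Q t) * 6 ^ (t : ℕ))) := by
          rw [Fin.val_succ, pow_succ]; ring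
        _ ≤ 30 * (4 * (12 ^ d * 2 ^ d * 5 ^ (t : ℕ))) := Nat.mul_le_mul_left _ h5
        _ = _ := by rw [Fin.val_succ]; ring

end StageLoss

/-! ### Extending a Latin function from two values of a coordinate to all four. -/

section Extension

open Function

variable {ι : Type*} [DecidableEq ι]

/-- `g` and `f` take the same pair of values at the values `a`, `b` of coordinate `j`. -/
def SamePair (f g : (ι → Fin 4) → Fin 4) (j : ι) (a b : Fin 4) (y : ι → Fin 4) : Prop :=
  (g (update y j a) = f (update y j a) ∧ g (update y j b) = f (update y j b)) ∨
    (g (update y j a) = f (update y j b) ∧ g (update y j b) = f (update y j a))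

lemma IsLatin.ne_of_adj {f : (ι → Fin 4) → Fin 4} (hf : IsLatin f) {i j : ι} (hij : i ≠ j)
    {y : ι → Fin 4} {c : Fin 4} (hc : y ≠ update y i c) (u : Fin 4) :
    f (update y j u) ≠ f (update (update y i c) j u) := by
  rw [update_comm hij]
  refine (hf _ i c ?_).symm
  rw [update_of_ne hij]
  rintro rfl
  simp at hc

/-- By the Latin property the common value of linked positions occurs at different letters of
coordinate `j`. If `g` agreed with `f` at `y` and were swapped at `y'`, it would repeat a value at
`y` and `y'` with the same letter. -/
lemma agree_of_linked {f g : (ι → Fin 4) → Fin 4} (hf : IsLatin f) (hg : IsLatin g) {j : ι}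
    {a b : Fin 4} {y y' : ι → Fin 4} (h : (linkGraph f j a b).Adj y y')
    (hy : SamePair f g j a b y) (hy' : SamePair f g j a b y')
    (hagree : g (update y j a) = f (update y j a)) : g (update y' j a) = f (update y' j a) := by
  obtain ⟨hne, ⟨i, hij, c, rfl⟩, u, hu, v, hv, huv⟩ := h
  have nef := hf.ne_of_adj (j := j) hij hne
  have neg := hg.ne_of_adj (j := j) hij hne
  by_contra hcon
  rcases hy' with hy' | ⟨h1, h2⟩
  · exact hcon hy'.1
  have hb : g (update y j b) = f (update y j b) := by
    rcases hy with hy | hy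
    · exact hy.2
    · rw [hy.2, ← hagree, hy.1]
  rcases hu with rfl | rfl <;> rcases hv with rfl | rfl
  · exact nef _ huv
  · exact neg _ (by rw [hagree, huv, h1])
  · exact neg _ (by rw [hb, huv, h2])
  · exact nef _ huv

/-- If the values at `c`, `e` over `y'` avoid those over `y`, they are exactly the values at `a`,
`b` over `y`. The values at `a`, `b` over `y'` then avoid these, so there was no link. -/
lemma linkGraph_swap_compl {f : (ι → Fin 4) → Fin 4} (hf : IsLatin f) (j : ι) {a b c e : Fin 4}
    (hcov : ∀ w, w = a ∨ w = b ∨ w = c ∨ w = e) (hce : c ≠ e)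
    (hac : a ≠ c) (hae : a ≠ e) (hbc : b ≠ c) (hbe : b ≠ e) :
    linkGraph f j a b ≤ linkGraph f j c e := by
  rintro y y' ⟨hne, ⟨i, hij, k, rfl⟩, u, hu, v, hv, huv⟩
  refine ⟨hne, ⟨i, hij, k, rfl⟩, ?_⟩
  have nef := hf.ne_of_adj (j := j) hij hne
  set y' := update y i k
  have inj := hf.injective y j
  have inj' := hf.injective y' j
  have surj := hf.surjective y j
  by_contra hcon
  push Not at hcon
  have hc : f (update y' j c) = f (update y j a) ∨ f (update y' j c) = f (update y j b) := by
    obtain ⟨w, hw⟩ := surj (f (update y' j c))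
    simp only at hw
    rcases hcov w with rfl | rfl | rfl | rfl
    · exact Or.inl hw.symm
    · exact Or.inr hw.symm
    · exact (hcon _ (Or.inl rfl) _ (Or.inl rfl) hw).elim
    · exact (hcon _ (Or.inr rfl) _ (Or.inl rfl) hw).elim
  have he : f (update y' j e) = f (update y j a) ∨ f (update y' j e) = f (update y j b) := by
    obtain ⟨w, hw⟩ := surj (f (update y' j e))
    simp only at hw
    rcases hcov w with rfl | rfl | rfl | rfl
    · exact Or.inl hw.symm
    · exact Or.inr hw.symm
    · exact (hcon _ (Or.inl rfl) _ (Or.inr rfl) hw).elim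
    · exact (hcon _ (Or.inr rfl) _ (Or.inr rfl) hw).elim
  have hvc : v ≠ c := by rcases hv with rfl | rfl <;> assumption
  have hve : v ≠ e := by rcases hv with rfl | rfl <;> assumption
  have key : f (update y' j c) = f (update y j u) ∨ f (update y' j e) = f (update y j u) := by
    rcases hc with hc | hc <;> rcases he with he | he
    · exact (hce (inj' (hc.trans he.symm))).elim
    · rcases hu with rfl | rfl
      · exact Or.inl hc
      · exact Or.inr he
    · rcases hu with rfl | rfl
      · exact Or.inr he
      · exact Or.inl hc
    · exact (hce (inj' (hc.trans he.symm))).elim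
  rcases key with h | h
  · exact hvc.symm (inj' (h.trans huv))
  · exact hve.symm (inj' (h.trans huv))

lemma linkGraph_compl {f : (ι → Fin 4) → Fin 4} (hf : IsLatin f) (j : ι) {a b c e : Fin 4}
    (hcov : ∀ w, w = a ∨ w = b ∨ w = c ∨ w = e) (hab : a ≠ b) (hce : c ≠ e)
    (hac : a ≠ c) (hae : a ≠ e) (hbc : b ≠ c) (hbe : b ≠ e) :
    linkGraph f j a b = linkGraph f j c e := by
  refine le_antisymm (linkGraph_swap_compl hf j hcov hce hac hae hbc hbe)
    (linkGraph_swap_compl hf j (fun w => ?_) hab hac.symm hbc.symm hae.symm hbe.symm)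
  have := hcov w
  tauto

/-- All four values occur on a line, so equal pairs leave equal complementary pairs. -/
lemma SamePair.compl {f g : (ι → Fin 4) → Fin 4} (hf : IsLatin f) (hg : IsLatin g) {j : ι}
    {a b c e : Fin 4} (hcov : ∀ w, w = a ∨ w = b ∨ w = c ∨ w = e) (hce : c ≠ e)
    (hac : a ≠ c) (hae : a ≠ e) (hbc : b ≠ c) (hbe : b ≠ e) {y : ι → Fin 4}
    (h : SamePair f g j a b y) : SamePair f g j c e y := by
  have inj := hg.injective y j
  have surj := hf.surjective y j
  have aux : ∀ k, k ≠ a → k ≠ b →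
      g (update y j k) = f (update y j c) ∨ g (update y j k) = f (update y j e) := by
    intro k hka hkb
    obtain ⟨w, hw⟩ := surj (g (update y j k))
    simp only at hw
    rcases hcov w with rfl | rfl | rfl | rfl
    · rcases h with h | h
      · exact (hka (inj (hw.symm.trans h.1.symm))).elim
      · exact (hkb (inj (hw.symm.trans h.2.symm))).elim
    · rcases h with h | h
      · exact (hkb (inj (hw.symm.trans h.2.symm))).elim
      · exact (hka (inj (hw.symm.trans h.1.symm))).elim
    · exact Or.inl hw.symm
    · exact Or.inr hw.symm
  rcases aux c hac.symm hbc.symm with h1 | h1 <;> rcases aux e hae.symm hbe.symm with h2 | h2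
  · exact (hce (inj (h1.trans h2.symm))).elim
  · exact Or.inl ⟨h1, h2⟩
  · exact Or.inr ⟨h1, h2⟩
  · exact (hce (inj (h1.trans h2.symm))).elim

/-- Latin functions taking the same pairs of values as `f` on `V` are determined there by one bit
for each component of the link graph. -/
lemma card_image_le_two_pow_compCount [Finite ι] {β : Type*} [DecidableEq β]
    {f : (ι → Fin 4) → Fin 4} (hf : IsLatin f) {j : ι} {a b : Fin 4} (V : Set (ι → Fin 4))
    (𝒢 : Finset ((ι → Fin 4) → Fin 4)) (h𝒢 : ∀ g ∈ 𝒢, IsLatin g ∧ ∀ y ∈ V, SamePair f g j a b y)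
    (r : ((ι → Fin 4) → Fin 4) → β)
    (hr : ∀ g ∈ 𝒢, ∀ g' ∈ 𝒢, (∀ y ∈ V, g (update y j a) = g' (update y j a) ∧
      g (update y j b) = g' (update y j b)) → r g = r g') :
    (𝒢.image r).card ≤ 2 ^ compCount (linkGraph f j a b) V := by
  classical
  let H := (linkGraph f j a b).induce V
  have : Fintype H.ConnectedComponent := Fintype.ofFinite _
  -- The bit of a component tells whether `g` agrees with `f` on it or takes the pairs in swapped
  -- order; along links this cannot change.
  let bits : ((ι → Fin 4) → Fin 4) → H.ConnectedComponent → Bool := fun g c =>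
    decide (∃ y, ∃ h : y ∈ V, H.connectedComponentMk ⟨y, h⟩ = c ∧
      g (update y j a) = f (update y j a))
  have prop : ∀ g ∈ 𝒢, ∀ x y : V, H.Reachable x y →
      g (update x j a) = f (update x j a) → g (update y j a) = f (update y j a) := by
    intro g hg x y hxy
    obtain ⟨w⟩ := hxy
    induction w with
    | nil => exact id
    | cons hadj _ ih =>
      intro h
      exact ih (agree_of_linked hf (h𝒢 g hg).1 hadj ((h𝒢 g hg).2 _ (Subtype.coe_prop _))
        ((h𝒢 g hg).2 _ (Subtype.coe_prop _)) h)
  have bits_spec : ∀ g ∈ 𝒢, ∀ y (h : y ∈ V), bits g (H.connectedComponentMk ⟨y, h⟩) = true ↔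
      g (update y j a) = f (update y j a) := by
    intro g hg y h
    simp only [bits, decide_eq_true_eq]
    constructor
    · rintro ⟨x, hx, hc, hx'⟩
      exact prop g hg ⟨x, hx⟩ ⟨y, h⟩ (SimpleGraph.ConnectedComponent.exact hc) hx'
    · intro h'
      exact ⟨y, h, rfl, h'⟩
  have det : ∀ g ∈ 𝒢, ∀ g' ∈ 𝒢, bits g = bits g' → r g = r g' := by
    intro g hg g' hg' hbits
    refine hr g hg g' hg' fun y hy => ?_
    have h1 := bits_spec g hg y hy
    have h2 := bits_spec g' hg' y hy
    rw [hbits] at h1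
    have h3 : g (update y j a) = f (update y j a) ↔ g' (update y j a) = f (update y j a) :=
      h1.symm.trans h2
    have h4 := (h𝒢 g hg).2 y hy
    have h5 := (h𝒢 g' hg').2 y hy
    unfold SamePair at h4 h5
    grind
  have h1 : (𝒢.image r).card ≤ (𝒢.image bits).card := by
    choose s hs using fun z (hz : z ∈ 𝒢.image r) => Finset.mem_image.1 hz
    refine Finset.card_le_card_of_injOn (fun z => if hz : z ∈ 𝒢.image r then bits (s z hz)
      else fun _ => true) ?_ ?_
    · intro z hz
      have hz' : z ∈ 𝒢.image r := hz
      simp only [hz', dif_pos]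
      exact Finset.mem_coe.2 (Finset.mem_image_of_mem _ (hs z hz').1)
    · intro z hz z' hz' h
      have hz1 : z ∈ 𝒢.image r := hz
      have hz2 : z' ∈ 𝒢.image r := hz'
      simp only [hz1, hz2, dif_pos] at h
      rw [← (hs z hz1).2, ← (hs z' hz2).2]
      exact det _ (hs z hz1).1 _ (hs z' hz2).1 h
  refine h1.trans ((Finset.card_le_univ _).trans ?_)
  rw [Fintype.card_fun, Fintype.card_bool, compCount, Nat.card_eq_fintype_card]

end Extension

/-! ### Releasing the coordinates one by one, starting from a binary box. -/

section Stages

open Function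

lemma exists_complementary_pair (a b : Fin 4) (hab : a ≠ b) : ∃ c e : Fin 4, c ≠ e ∧ a ≠ c ∧
    a ≠ e ∧ b ≠ c ∧ b ≠ e ∧ ∀ w, w = a ∨ w = b ∨ w = c ∨ w = e := by
  revert a b
  decide

/-- The points whose coordinates before `t` lie in the pairs given by `Q`. -/
def partialBox {d : ℕ} (Q : Fin d → DistinctPair) (t : ℕ) : Set (Fin d → Fin 4) :=
  {x | ∀ i : Fin d, (i : ℕ) < t → x i = (Q i).1.1 ∨ x i = (Q i).1.2}

lemma partialBox_succ_subset {d : ℕ} (Q : Fin d → DistinctPair) (t : ℕ) :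
    partialBox Q (t + 1) ⊆ partialBox Q t := fun _ hx i hi => hx i (by omega)

/-- Functions with the same restriction to the smaller box have the same pairs of values at the two
missing letters of coordinate `t`. Their orders cost one bit per component, and the missing letters
give the same link graph as the pair `Q t`. -/
lemma card_image_restrict_le {d : ℕ} (Q : Fin d → DistinctPair) (t : Fin d) (ℓ : ℕ)
    (𝒴 : Finset ((Fin d → Fin 4) → Fin 4)) (h𝒴 : ∀ f ∈ 𝒴, IsLatin f)
    (hℓ : ∀ f ∈ 𝒴, stageLoss f Q t ≤ ℓ) [DecidableEq (partialBox Q t → Fin 4)]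
    [DecidableEq (partialBox Q (t + 1) → Fin 4)] :
    (𝒴.image fun f => (partialBox Q t).domRestrict f).card ≤
      2 ^ ℓ * (𝒴.image fun f => (partialBox Q (t + 1)).domRestrict f).card := by
  classical
  let π : (partialBox Q t → Fin 4) → (partialBox Q (t + 1) → Fin 4) :=
    fun h x => h ⟨x, partialBox_succ_subset Q t x.2⟩
  have himg : (𝒴.image fun f => (partialBox Q (t + 1)).domRestrict f) =
      (𝒴.image fun f => (partialBox Q t).domRestrict f).image π := by
    rw [Finset.image_image]
    rfl
  rw [himg]
  refine Finset.card_le_mul_card_image _ _ fun h hh => ?_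
  simp only [Finset.mem_image, exists_exists_and_eq_and] at hh
  obtain ⟨f, hf, rfl⟩ := hh
  let 𝒢 := 𝒴.filter fun g => ∀ x ∈ partialBox Q (t + 1), g x = f x
  have hsub : ((𝒴.image fun f => (partialBox Q t).domRestrict f).filter
      fun x => π x = π ((partialBox Q t).domRestrict f)) ⊆
      𝒢.image fun f => (partialBox Q t).domRestrict f := by
    intro h hh
    simp only [Finset.mem_filter, Finset.mem_image] at hh
    obtain ⟨⟨g, hg, rfl⟩, hgf⟩ := hh
    refine Finset.mem_image_of_mem _ (Finset.mem_filter.2 ⟨hg, fun x hx => ?_⟩)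
    exact congrFun hgf ⟨x, hx⟩
  refine (Finset.card_le_card hsub).trans ?_
  obtain ⟨c, e, hce, hac, hae, hbc, hbe, hcov⟩ := exists_complementary_pair _ _ (Q t).2
  refine le_trans ?_ (Nat.pow_le_pow_right (by norm_num) (hℓ f hf))
  rw [stageLoss, linkGraph_compl (h𝒴 f hf) t hcov (Q t).2 hce hac hae hbc hbe]
  have hbox : ∀ y ∈ stageRegion Q t, ∀ u, u = (Q t).1.1 ∨ u = (Q t).1.2 →
      update y t u ∈ partialBox Q (t + 1) := by
    intro y hy u hu i hi
    by_cases hit : i = t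
    · subst hit; simpa using hu
    · rw [update_of_ne hit]
      have : (i : ℕ) ≠ t := fun h => hit (Fin.ext h)
      exact hy.1 i (Fin.lt_def.2 (by omega))
  refine card_image_le_two_pow_compCount (h𝒴 f hf) (stageRegion Q t) 𝒢 ?_ _ ?_
  · intro g hg
    obtain ⟨hg, hgf⟩ := Finset.mem_filter.1 hg
    refine ⟨h𝒴 g hg, fun y hy => ?_⟩
    refine SamePair.compl (h𝒴 f hf) (h𝒴 g hg) hcov hce hac hae hbc hbe (Or.inl ⟨?_, ?_⟩)
    · exact hgf _ (hbox y hy _ (Or.inl rfl))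
    · exact hgf _ (hbox y hy _ (Or.inr rfl))
  · intro g hg g' hg' hgg
    funext ⟨x, hx⟩
    change g x = g' x
    have hy : update x t 0 ∈ stageRegion Q t := by
      refine ⟨fun i hi => ?_, by simp⟩
      rw [update_of_ne hi.ne]
      exact hx i hi
    have hx' : x = update (update x t 0) t (x t) := by simp
    obtain ⟨hg1, hg2⟩ := Finset.mem_filter.1 hg
    obtain ⟨hg1', hg2'⟩ := Finset.mem_filter.1 hg'
    rcases hcov (x t) with h | h | h | h
    · have := hbox _ hy _ (Or.inl h)
      rw [← hx'] at this
      rw [hg2 x this, hg2' x this]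
    · have := hbox _ hy _ (Or.inr h)
      rw [← hx'] at this
      rw [hg2 x this, hg2' x this]
    · have := (hgg _ hy).1
      rw [← h, ← hx'] at this
      exact this
    · have := (hgg _ hy).2
      rw [← h, ← hx'] at this
      exact this

/-- Proper colourings of the `d`-dimensional cube with four colours. -/
def IsCubeColoring {d : ℕ} (φ : (Fin d → Bool) → Fin 4) : Prop :=
  ∀ ω i, φ (update ω i (!ω i)) ≠ φ ω

/-- The number of proper colourings of the `d`-dimensional cube with four colours. -/
noncomputable def cubeColoringCount (d : ℕ) : ℕ :=
  Nat.card {φ : (Fin d → Bool) → Fin 4 // IsCubeColoring φ}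

lemma card_image_restrict_box_le {d : ℕ} (Q : Fin d → DistinctPair)
    (𝒴 : Finset ((Fin d → Fin 4) → Fin 4)) (h𝒴 : ∀ f ∈ 𝒴, IsLatin f)
    [DecidableEq (partialBox Q d → Fin 4)] :
    (𝒴.image fun f => (partialBox Q d).domRestrict f).card ≤ cubeColoringCount d := by
  classical
  let pt : (Fin d → Bool) → (Fin d → Fin 4) := fun ω i => if ω i then (Q i).1.2 else (Q i).1.1
  have hpt : ∀ ω, pt ω ∈ partialBox Q d := by
    intro ω i _
    simp only [pt]
    split_ifs <;> simp
  have hsurj : ∀ x ∈ partialBox Q d, ∃ ω, pt ω = x := by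
    intro x hx
    refine ⟨fun i => decide (x i = (Q i).1.2), ?_⟩
    funext i
    have := hx i i.2
    simp only [pt, decide_eq_true_eq]
    split_ifs with h
    · exact h.symm
    · tauto
  have hupd : ∀ ω i, pt (update ω i (!ω i)) =
      update (pt ω) i (if ω i then (Q i).1.1 else (Q i).1.2) := by
    intro ω i
    funext k
    by_cases hk : k = i
    · subst hk
      simp only [pt, update_self]
      cases ω k <;> simp
    · simp [pt, hk]
  unfold cubeColoringCount
  rw [Nat.card_eq_fintype_card, Fintype.card_subtype]
  refine Finset.card_le_card_of_injOn (fun h ω => h ⟨pt ω, hpt ω⟩) ?_ ?_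
  · intro h hh
    simp only [Finset.coe_image, Set.mem_image, Finset.mem_coe] at hh
    obtain ⟨f, hf, rfl⟩ := hh
    simp only [Finset.coe_filter, Finset.mem_univ, true_and, Set.mem_ofPred_eq]
    intro ω i
    change f (pt (update ω i (!ω i))) ≠ f (pt ω)
    rw [hupd]
    refine h𝒴 f hf _ i _ ?_
    have := (Q i).2
    simp only [pt]
    split_ifs
    · exact this
    · exact this.symm
  · intro h _ h' _ hhh
    funext ⟨x, hx⟩
    obtain ⟨ω, rfl⟩ := hsurj x hx
    exact congrFun hhh ω

/-- The stages telescope from the whole space (`partialBox Q 0`) to the box (`partialBox Q d`),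
where cube colourings are counted. -/
lemma card_le_of_stageLoss_le {d : ℕ} (Q : Fin d → DistinctPair) (ℓ : Fin d → ℕ)
    (𝒴 : Finset ((Fin d → Fin 4) → Fin 4)) (h𝒴 : ∀ f ∈ 𝒴, IsLatin f)
    (hℓ : ∀ f ∈ 𝒴, ∀ t, stageLoss f Q t ≤ ℓ t) :
    𝒴.card ≤ 2 ^ (∑ t, ℓ t) * cubeColoringCount d := by
  classical
  have step : ∀ k (hk : k ≤ d), (𝒴.image fun f => (partialBox Q 0).domRestrict f).card ≤
      2 ^ (∑ t : Fin k, ℓ (Fin.castLE hk t)) *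
        (𝒴.image fun f => (partialBox Q k).domRestrict f).card := by
    intro k
    induction k with
    | zero => intro hk; simp
    | succ k ih =>
      intro hk
      refine (ih (by omega)).trans ?_
      rw [Fin.sum_univ_castSucc, pow_add, mul_assoc]
      refine Nat.mul_le_mul_left _ ?_
      have := card_image_restrict_le Q ⟨k, by omega⟩ (ℓ ⟨k, by omega⟩) 𝒴 h𝒴
        (fun f hf => hℓ f hf _)
      exact this
  have h0 : 𝒴.card = (𝒴.image fun f => (partialBox Q 0).domRestrict f).card := by
    rw [Finset.card_image_of_injective]
    intro f g h
    funext x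
    exact congrFun h ⟨x, fun i hi => absurd hi (by omega)⟩
  rw [h0]
  refine (step d le_rfl).trans ?_
  simp only [Fin.castLE_rfl, id]
  exact Nat.mul_le_mul_left _ (card_image_restrict_box_le Q 𝒴 h𝒴)

/-- The functions are sorted by their vectors of stage losses, of which there are at most (Λ+1)^d.
-/
lemma card_le_of_sum_stageLoss_le {d : ℕ} (Q : Fin d → DistinctPair) (Λ : ℕ)
    (𝒴 : Finset ((Fin d → Fin 4) → Fin 4)) (h𝒴 : ∀ f ∈ 𝒴, IsLatin f)
    (hΛ : ∀ f ∈ 𝒴, ∑ t, stageLoss f Q t ≤ Λ) :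
    𝒴.card ≤ (Λ + 1) ^ d * (2 ^ Λ * cubeColoringCount d) := by
  classical
  let vec : ((Fin d → Fin 4) → Fin 4) → Fin d → Fin (Λ + 1) :=
    -- Reduction modulo Λ+1 loses nothing on `𝒴`, where each stage loss is at most Λ.
    fun f t => Fin.ofNat (Λ + 1) (stageLoss f Q t)
  have hvec : ∀ f ∈ 𝒴, ∀ t, (vec f t : ℕ) = stageLoss f Q t := by
    intro f hf t
    have h1 : stageLoss f Q t ≤ ∑ t, stageLoss f Q t :=
      Finset.single_le_sum (f := fun t => stageLoss f Q t) (fun _ _ => Nat.zero_le _)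
        (Finset.mem_univ t)
    have h2 := hΛ f hf
    simp only [vec, Fin.val_ofNat]
    exact Nat.mod_eq_of_lt (by omega)
  have h := Finset.card_eq_sum_card_fiberwise (s := 𝒴) (f := vec) (t := Finset.univ)
    (by simp [Set.MapsTo])
  rw [h]
  calc ∑ v : Fin d → Fin (Λ + 1), (𝒴.filter fun f => vec f = v).card
      ≤ ∑ v : Fin d → Fin (Λ + 1), (2 ^ Λ * cubeColoringCount d) := by
        refine Finset.sum_le_sum fun v _ => ?_
        rcases (𝒴.filter fun f => vec f = v).eq_empty_or_nonempty with he | ⟨f, hf⟩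
        · rw [he]; simp
        · refine (card_le_of_stageLoss_le Q (fun t => (v t : ℕ)) _
            (fun f hf => h𝒴 f (Finset.mem_filter.1 hf).1) ?_).trans ?_
          · intro g hg t
            obtain ⟨hg', hv⟩ := Finset.mem_filter.1 hg
            rw [← hv]
            exact (hvec g hg' t).ge
          · refine Nat.mul_le_mul_right _ (Nat.pow_le_pow_right (by norm_num) ?_)
            obtain ⟨hf', hv⟩ := Finset.mem_filter.1 hf
            rw [← hv, Finset.sum_congr rfl fun t _ => hvec f hf' t]
            exact hΛ f hf'
    _ = _ := by simp

end Stages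

/-! ### Finner's inequality for the uniform measure. -/

section Finner

open Function MeasureTheory
open scoped ENNReal

/-- Hölder's inequality with d equal exponents 1/d, for the uniform probability measure on `α`. -/
lemma sum_prod_rpow_le {α U : Type*} [Fintype α] [Nonempty α] (D : Finset U) {d : ℕ} (hd : d ≠ 0)
    (hD : D.card = d) (f : U → α → ℝ≥0∞) :
    (Fintype.card α : ℝ≥0∞)⁻¹ * ∑ c, ∏ u ∈ D, f u c ^ (d⁻¹ : ℝ) ≤
      ∏ u ∈ D, ((Fintype.card α : ℝ≥0∞)⁻¹ * ∑ c, f u c) ^ (d⁻¹ : ℝ) := by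
  let _ : MeasurableSpace α := ⊤
  have h := ENNReal.lintegral_prod_norm_pow_le (μ := (Fintype.card α : ℝ≥0∞)⁻¹ • Measure.count) D
    (f := f) (p := fun _ => (d⁻¹ : ℝ)) (fun u _ => (measurable_of_finite _).aemeasurable)
    (by rw [Finset.sum_const, hD, nsmul_eq_mul]; field_simp) (fun _ _ => by positivity)
  simpa only [lintegral_smul_measure, lintegral_count, tsum_fintype, smul_eq_mul] using h

/-- Finner's inequality for functions of finitely many variables, each variable being used by
exactly `d` of the functions. -/
lemma finner_fin {U α : Type*} [Fintype U] [Fintype α] [Nonempty α] {d : ℕ} (hd : d ≠ 0) (n : ℕ)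
    (D : Fin n → Finset U) (hD : ∀ s, (D s).card = d) (f : U → (Fin n → α) → ℝ≥0∞)
    (hf : ∀ s, ∀ u ∉ D s, ∀ g c, f u (update g s c) = f u g) :
    ((Fintype.card α : ℝ≥0∞)⁻¹) ^ n * ∑ g, ∏ u, f u g ^ (d⁻¹ : ℝ) ≤
      ∏ u, (((Fintype.card α : ℝ≥0∞)⁻¹) ^ n * ∑ g, f u g) ^ (d⁻¹ : ℝ) := by
  classical
  induction n with
  | zero => simp
  | succ n ih =>
    set w : ℝ≥0∞ := (Fintype.card α : ℝ≥0∞)⁻¹ with hw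
    have hsplit : ∀ F : (Fin (n + 1) → α) → ℝ≥0∞,
        w ^ (n + 1) * ∑ g, F g = w ^ n * ∑ g : Fin n → α, w * ∑ c, F (Fin.cons c g) := by
      intro F
      rw [← (Fin.consEquiv (fun _ : Fin (n + 1) => α)).sum_comp, Fintype.sum_prod_type,
        Finset.sum_comm, ← Finset.mul_sum, pow_succ, mul_assoc]
      rfl
    let f' : U → (Fin n → α) → ℝ≥0∞ := fun u g => w * ∑ c, f u (Fin.cons c g)
    have hih := ih (fun s => D s.succ) (fun s => hD _) f' (by
      intro s u hu g c
      simp only [f', Fin.cons_update]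
      congr 1
      exact Finset.sum_congr rfl fun e _ => hf s.succ u hu _ _)
    rw [hsplit]
    simp only [hsplit]
    refine le_trans ?_ hih
    gcongr with g
    -- Functions that do not use coordinate 0 pass unchanged through the average over it; Hölder's
    -- inequality is needed only for the d others.
    have hconst : ∀ u ∉ D 0, ∀ c, f u (Fin.cons c g) = f' u g := by
      intro u hu c
      have h1 : ∀ e, f u (Fin.cons e g) = f u (Fin.cons c g) := by
        intro e
        have := hf 0 u hu (Fin.cons c g) e
        rwa [Fin.update_cons_zero] at this
      simp only [f', h1, Finset.sum_const, Finset.card_univ, nsmul_eq_mul]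
      rw [← mul_assoc, hw, ENNReal.inv_mul_cancel (by simp) (by simp), one_mul]
    have hprod : ∀ F : U → ℝ≥0∞, ∏ u, F u = (∏ u ∈ D 0, F u) * ∏ u ∈ (D 0)ᶜ, F u :=
      fun F => (Finset.prod_mul_prod_compl _ _).symm
    rw [hprod]
    simp only [hprod (fun u => f u _ ^ (d⁻¹ : ℝ))]
    have h2 : ∀ c, ∏ u ∈ (D 0)ᶜ, f u (Fin.cons c g) ^ (d⁻¹ : ℝ) =
        ∏ u ∈ (D 0)ᶜ, f' u g ^ (d⁻¹ : ℝ) := fun c =>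
      Finset.prod_congr rfl fun u hu => by rw [hconst u (Finset.mem_compl.1 hu)]
    simp only [h2, ← Finset.sum_mul, ← mul_assoc]
    gcongr
    exact sum_prod_rpow_le (D 0) hd (hD 0) fun u c => f u (Fin.cons c g)

lemma finner {U S α : Type*} [Fintype U] [Fintype S] [DecidableEq S] [Fintype α] [Nonempty α]
    {d : ℕ} (hd : d ≠ 0)
    (D : S → Finset U) (hD : ∀ s, (D s).card = d) (f : U → (S → α) → ℝ≥0∞)
    (hf : ∀ s, ∀ u ∉ D s, ∀ g c, f u (update g s c) = f u g) :
    ((Fintype.card α : ℝ≥0∞)⁻¹) ^ Fintype.card S * ∑ g, ∏ u, f u g ^ (d⁻¹ : ℝ) ≤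
      ∏ u, (((Fintype.card α : ℝ≥0∞)⁻¹) ^ Fintype.card S * ∑ g, f u g) ^ (d⁻¹ : ℝ) := by
  classical
  let e := Fintype.equivFin S
  have h := finner_fin hd (Fintype.card S) (fun s => D (e.symm s)) (fun s => hD _)
    (fun u g => f u (g ∘ e)) (by
      intro s u hu g c
      rw [← hf (e.symm s) u hu (g ∘ e) c]
      congr 1
      funext t
      by_cases ht : t = e.symm s
      · subst ht; simp
      · have : e t ≠ s := fun h => ht (by rw [← h]; simp)
        simp [ht, this])
  have hs : ∀ F : (S → α) → ℝ≥0∞, ∑ g : Fin (Fintype.card S) → α, F (g ∘ e) = ∑ g, F g :=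
    fun F => (Equiv.arrowCongr e.symm (Equiv.refl α)).sum_comp F
  rw [hs fun g => ∏ u, f u g ^ (d⁻¹ : ℝ)] at h
  have hs' : ∀ u, ∑ g : Fin (Fintype.card S) → α, f u (g ∘ e) = ∑ g, f u g := fun u => hs (f u)
  simp only [hs'] at h
  exact h

end Finner

/-! ### Proper 4-colourings of the cube. -/

section CubeColoring

open Function
open scoped ENNReal

variable {d : ℕ}

/-- The sign of a binary word. -/
def wordSign (v : Fin d → Bool) : Bool := decide ((∏ i, if v i then (-1 : ℤ) else 1) = 1)

lemma wordSign_flip (v : Fin d → Bool) (i : Fin d) :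
    wordSign (update v i (!v i)) = !wordSign v := by
  have h1 : (∏ k, if update v i (!v i) k then (-1 : ℤ) else 1) =
      - ∏ k, if v k then (-1 : ℤ) else 1 := by
    rw [← Finset.mul_prod_erase _ _ (Finset.mem_univ i),
      ← Finset.mul_prod_erase _ (fun k => if v k then (-1 : ℤ) else 1) (Finset.mem_univ i)]
    have : ∏ k ∈ Finset.univ.erase i, (if update v i (!v i) k then (-1 : ℤ) else 1) =
        ∏ k ∈ Finset.univ.erase i, if v k then (-1 : ℤ) else 1 :=
      Finset.prod_congr rfl fun k hk => by rw [update_of_ne (Finset.ne_of_mem_erase hk)]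
    rw [this, update_self]
    cases v i <;> simp
  have h2 : (∏ k, if v k then (-1 : ℤ) else 1) = 1 ∨
      (∏ k, if v k then (-1 : ℤ) else 1) = -1 := by
    refine Finset.prod_induction _ (fun z : ℤ => z = 1 ∨ z = -1) ?_ (Or.inl rfl) ?_
    · rintro a b (rfl | rfl) (rfl | rfl) <;> simp
    · intro k _
      split_ifs <;> simp
  unfold wordSign
  rw [h1]
  rcases h2 with h | h <;> rw [h] <;> decide

/-- A binary word together with its neighbours in the cube. -/
def closedNeighbors (v : Fin d → Bool) : Finset (Fin d → Bool) :=
  insert v (Finset.univ.image fun i => update v i (!v i))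

lemma card_closedNeighbors (v : Fin d → Bool) : (closedNeighbors v).card = d + 1 := by
  rw [closedNeighbors, Finset.card_insert_of_notMem, Finset.card_image_of_injective]
  · simp
  · intro i j h
    by_contra hij
    have : update v i (!v i) i = update v j (!v j) i := congrFun h i
    rw [update_self, update_of_ne hij] at this
    simp at this
  · simp only [Finset.mem_image, Finset.mem_univ, true_and, not_exists]
    intro i h
    have := congrFun h i
    simp at this

lemma mem_closedNeighbors_comm (v w : Fin d → Bool) :
    v ∈ closedNeighbors w ↔ w ∈ closedNeighbors v := by
  have : ∀ v w : Fin d → Bool, v ∈ closedNeighbors w → w ∈ closedNeighbors v := by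
    intro v w h
    simp only [closedNeighbors, Finset.mem_insert, Finset.mem_image, Finset.mem_univ,
      true_and] at h ⊢
    rcases h with rfl | ⟨i, rfl⟩
    · exact Or.inl rfl
    · exact Or.inr ⟨i, by simp⟩
  exact ⟨this v w, this w v⟩

/-- The (d+1)-cube is bipartite, and deleting the first letter identifies either half with the
d-cube. The neighbours of a vertex in one half then form a closed neighbourhood in the d-cube. Given
the colouring `g` of one half, each vertex of the other avoids the colours seen there. -/
lemma cubeColoringCount_succ_le :
    cubeColoringCount (d + 1) ≤ ∑ g : (Fin d → Bool) → Fin 4, ∏ v : Fin d → Bool,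
      (((closedNeighbors v).image g)ᶜ).card := by
  classical
  have : ∑ g : (Fin d → Bool) → Fin 4, ∏ v : Fin d → Bool,
      (((closedNeighbors v).image g)ᶜ).card =
      (Finset.univ.sigma fun g : (Fin d → Bool) → Fin 4 =>
        Fintype.piFinset fun v => ((closedNeighbors v).image g)ᶜ).card := by
    simp
  rw [this, cubeColoringCount, Nat.card_eq_fintype_card, ← Finset.card_univ]
  refine Finset.card_le_card_of_injOn (fun φ => ⟨fun v => φ.1 (Fin.cons (!wordSign v) v),
    fun v => φ.1 (Fin.cons (wordSign v) v)⟩) ?_ ?_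
  · rintro ⟨φ, hφ⟩ -
    simp only [Finset.coe_sigma, Finset.coe_univ, Set.mem_sigma_iff, Set.mem_univ, true_and,
      Finset.mem_coe, Fintype.mem_piFinset, Finset.mem_compl, Finset.mem_image, not_exists,
      not_and, closedNeighbors, Finset.mem_insert, Finset.mem_univ]
    rintro v w (rfl | ⟨i, rfl⟩)
    · have := hφ (Fin.cons (wordSign w) w) 0
      rwa [Fin.cons_zero, Fin.update_cons_zero] at this
    · have := hφ (Fin.cons (wordSign v) v) i.succ
      rw [wordSign_flip, Bool.not_not]
      rwa [Fin.cons_succ, ← Fin.cons_update] at this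
  · rintro ⟨φ, hφ⟩ - ⟨φ', hφ'⟩ - h
    simp only [Sigma.mk.injEq, heq_eq_eq] at h
    ext1
    funext ω
    obtain ⟨h1, h2⟩ := h
    have h1 := congrFun h1 (Fin.tail ω)
    have h2 := congrFun h2 (Fin.tail ω)
    have h3 : ω = Fin.cons (ω 0) (Fin.tail ω) := (Fin.cons_self_tail ω).symm
    by_cases hs : ω 0 = wordSign (Fin.tail ω)
    · rw [← hs, Fin.cons_self_tail] at h2
      exact h2
    · have : (!wordSign (Fin.tail ω)) = ω 0 := by
        revert hs
        cases ω 0 <;> cases wordSign (Fin.tail ω) <;> simp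
      rw [this, Fin.cons_self_tail] at h1
      exact h1

/-- Sort by the set C of colours seen. The proportion of `g` seeing exactly C is at most
(|C|/4)^(d+1), and |C|(4-|C|) ≤ 4, so each of the 16 sets contributes at most 1 to the average. -/
lemma sum_card_compl_pow_le (v : Fin d → Bool) :
    ∑ g : (Fin d → Bool) → Fin 4, (((closedNeighbors v).image g)ᶜ).card ^ (d + 1) ≤
      16 * 4 ^ Fintype.card (Fin d → Bool) := by
  classical
  have hpi : ∀ C : Finset (Fin 4), (Finset.univ.filter fun g : (Fin d → Bool) → Fin 4 =>
      (closedNeighbors v).image g = C).card * 4 ^ (d + 1) ≤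
      C.card ^ (d + 1) * 4 ^ Fintype.card (Fin d → Bool) := by
    intro C
    have h1 : (Finset.univ.filter fun g : (Fin d → Bool) → Fin 4 =>
        (closedNeighbors v).image g = C) ⊆ Fintype.piFinset fun w =>
          if w ∈ closedNeighbors v then C else Finset.univ := by
      intro g hg
      simp only [Finset.mem_filter, Finset.mem_univ, true_and] at hg
      rw [Fintype.mem_piFinset]
      intro w
      split_ifs with h
      · rw [← hg]; exact Finset.mem_image_of_mem g h
      · exact Finset.mem_univ _
    refine (Nat.mul_le_mul_right _ (Finset.card_le_card h1)).trans (le_of_eq ?_)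
    rw [Fintype.card_piFinset, ← Finset.prod_mul_prod_compl (closedNeighbors v),
      Finset.prod_congr rfl (g := fun _ => C.card) (fun w hw => by rw [if_pos hw]),
      Finset.prod_congr rfl (g := fun _ => 4) (s₁ := (closedNeighbors v)ᶜ)
        (fun w hw => by rw [if_neg (Finset.mem_compl.1 hw)]; simp),
      Finset.prod_const, Finset.prod_const, card_closedNeighbors, mul_assoc, ← pow_add,
      ← card_closedNeighbors v, Finset.card_compl_add_card]
  have h4 : (0 : ℕ) < 4 ^ (d + 1) := by positivity
  refine Nat.le_of_mul_le_mul_right ?_ h4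
  rw [← Finset.sum_fiberwise_of_maps_to (s := Finset.univ) (t := (Finset.univ : Finset (Finset (Fin 4))))
    (g := fun g : (Fin d → Bool) → Fin 4 => (closedNeighbors v).image g) (by simp), Finset.sum_mul]
  calc _ ≤ ∑ C : Finset (Fin 4), 4 ^ (d + 1) * 4 ^ Fintype.card (Fin d → Bool) := by
        refine Finset.sum_le_sum fun C _ => ?_
        rw [Finset.sum_congr rfl (g := fun _ => Cᶜ.card ^ (d + 1))
          (fun g hg => by rw [(Finset.mem_filter.1 hg).2]), Finset.sum_const, smul_eq_mul]
        have h5 : C.card * Cᶜ.card ≤ 4 := by revert C; decide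
        calc _ = Cᶜ.card ^ (d + 1) * ((Finset.univ.filter fun g : (Fin d → Bool) → Fin 4 =>
                (closedNeighbors v).image g = C).card * 4 ^ (d + 1)) := by ring
          _ ≤ Cᶜ.card ^ (d + 1) * (C.card ^ (d + 1) * 4 ^ Fintype.card (Fin d → Bool)) :=
            Nat.mul_le_mul_left _ (hpi C)
          _ = (C.card * Cᶜ.card) ^ (d + 1) * 4 ^ Fintype.card (Fin d → Bool) := by
            rw [mul_pow]; ring
          _ ≤ _ := by gcongr
    _ = _ := by
        simp only [Finset.sum_const, Finset.card_univ, Fintype.card_finset, Fintype.card_fin,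
          smul_eq_mul]
        ring

/-- Upper bound for the number of proper colourings of the cube with four colours. -/
lemma cubeColoringCount_le :
    (cubeColoringCount (d + 1) : ℝ) ≤
      (2 : ℝ) ^ ((2 : ℝ) ^ (d + 1) + (2 : ℝ) ^ (d + 2) / (d + 1)) := by
  classical
  -- The power d+1 cancels the exponent 1/(d+1) in Finner's inequality: each variable lies in d+1
  -- closed neighbourhoods.
  let F : (Fin d → Bool) → ((Fin d → Bool) → Fin 4) → ℝ≥0∞ :=
    fun v g => ((((closedNeighbors v).image g)ᶜ).card : ℝ≥0∞) ^ (d + 1)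
  have hfin := finner (U := Fin d → Bool) (S := Fin d → Bool) (α := Fin 4) (d := d + 1)
    (by omega) closedNeighbors card_closedNeighbors F (by
      intro s u hu g c
      rw [mem_closedNeighbors_comm] at hu
      simp only [F]
      rw [Finset.image_congr (g := g)]
      intro w hw
      rw [update_of_ne]
      rintro rfl
      exact hu hw)
  have hroot : ∀ v g, F v g ^ (((d + 1 : ℕ) : ℝ)⁻¹) =
      ((((closedNeighbors v).image g)ᶜ).card : ℝ≥0∞) := by
    intro v g
    exact ENNReal.pow_rpow_inv_natCast (by omega) _
  have hcard : Fintype.card (Fin d → Bool) = 2 ^ d := by simp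
  have hF : ∀ v, (4 : ℝ≥0∞)⁻¹ ^ (2 ^ d) * ∑ g, F v g ≤ 16 := by
    intro v
    have h1 : ∑ g, F v g ≤ 16 * 4 ^ (2 ^ d) := by
      have := sum_card_compl_pow_le v
      rw [hcard] at this
      simp only [F]
      exact_mod_cast this
    calc _ ≤ (4 : ℝ≥0∞)⁻¹ ^ (2 ^ d) * (16 * 4 ^ (2 ^ d)) := by gcongr
      _ = 16 * ((4 : ℝ≥0∞)⁻¹ * 4) ^ (2 ^ d) := by rw [mul_pow]; ring
      _ = 16 := by rw [ENNReal.inv_mul_cancel (by simp) (by simp)]; simp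
  simp only [hroot, hcard, Fintype.card_fin] at hfin
  have hprod : ∏ u : Fin d → Bool, ((4 : ℝ≥0∞)⁻¹ ^ (2 ^ d) * ∑ g, F u g) ^ (((d + 1 : ℕ) : ℝ)⁻¹) ≤
      ((16 : ℝ≥0∞) ^ (((d + 1 : ℕ) : ℝ)⁻¹)) ^ (2 ^ d) := by
    calc _ ≤ ∏ u : Fin d → Bool, (16 : ℝ≥0∞) ^ (((d + 1 : ℕ) : ℝ)⁻¹) := by
          refine Finset.prod_le_prod' fun u _ => ?_
          gcongr
          exact hF u
      _ = _ := by simp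
  have htot : (cubeColoringCount (d + 1) : ℝ≥0∞) ≤
      4 ^ (2 ^ d) * ((16 : ℝ≥0∞) ^ (((d + 1 : ℕ) : ℝ)⁻¹)) ^ (2 ^ d) := by
    have h1 : (cubeColoringCount (d + 1) : ℝ≥0∞) ≤ ∑ g : (Fin d → Bool) → Fin 4,
        ∏ v : Fin d → Bool, ((((closedNeighbors v).image g)ᶜ).card : ℝ≥0∞) := by
      exact_mod_cast cubeColoringCount_succ_le
    refine h1.trans ?_
    calc _ = 4 ^ (2 ^ d) * ((4 : ℝ≥0∞)⁻¹ ^ (2 ^ d) * ∑ g : (Fin d → Bool) → Fin 4,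
        ∏ v : Fin d → Bool, ((((closedNeighbors v).image g)ᶜ).card : ℝ≥0∞)) := by
          rw [← mul_assoc, ← mul_pow, ENNReal.mul_inv_cancel (by simp) (by simp)]; simp
      _ ≤ _ := by
          gcongr
          exact hfin.trans hprod
  have hreal : (cubeColoringCount (d + 1) : ℝ) ≤
      4 ^ (2 ^ d) * ((16 : ℝ) ^ (((d + 1 : ℕ) : ℝ)⁻¹)) ^ (2 ^ d) := by
    have h16 : (16 : ℝ≥0∞) ^ (((d + 1 : ℕ) : ℝ)⁻¹) =
        ENNReal.ofReal ((16 : ℝ) ^ (((d + 1 : ℕ) : ℝ)⁻¹)) := by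
      rw [← ENNReal.ofReal_rpow_of_pos (by norm_num)]
      norm_num
    have h4 : (4 : ℝ≥0∞) = ENNReal.ofReal 4 := by norm_num
    rw [h16, h4, ← ENNReal.ofReal_pow (by positivity), ← ENNReal.ofReal_pow (by positivity),
      ← ENNReal.ofReal_mul (by positivity), ← ENNReal.ofReal_natCast] at htot
    exact (ENNReal.ofReal_le_ofReal_iff (by positivity)).1 htot
  refine hreal.trans (le_of_eq ?_)
  have h4 : (4 : ℝ) = (2 : ℝ) ^ (2 : ℝ) := by norm_num
  have h16 : (16 : ℝ) = (2 : ℝ) ^ (4 : ℝ) := by norm_num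
  rw [h16, h4, ← Real.rpow_natCast, ← Real.rpow_natCast, ← Real.rpow_mul (by norm_num),
    ← Real.rpow_mul (by norm_num), ← Real.rpow_mul (by norm_num), ← Real.rpow_add (by norm_num)]
  congr 1
  push_cast
  field_simp
  ring

end CubeColoring

/-! ### Balanced functions are determined by a link-closed set. -/

section Propagation

open Function

/-- A binary word of length four with two occurrences of each letter. -/
def IsBalancedLine (ℓ : Fin 4 → Bool) : Prop := (Finset.univ.filter fun c => ℓ c = true).card = 2

instance (ℓ : Fin 4 → Bool) : Decidable (IsBalancedLine ℓ) :=
  inferInstanceAs (Decidable (_ = _))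

lemma IsBalancedLine.exists_eq {ℓ : Fin 4 → Bool} (h : IsBalancedLine ℓ) (a : Fin 4) :
    ∃ b, b ≠ a ∧ ℓ b = ℓ a := by
  revert ℓ a
  decide

lemma IsBalancedLine.eq_of_three {ℓ ℓ' : Fin 4 → Bool} (h : IsBalancedLine ℓ)
    (h' : IsBalancedLine ℓ') {e : Fin 4} (he : ∀ c, c ≠ e → ℓ c = ℓ' c) : ℓ e = ℓ' e := by
  revert ℓ ℓ' e
  decide

lemma IsBalancedLine.ne_of_pair {ℓ : Fin 4 → Bool} (h : IsBalancedLine ℓ) {a b c : Fin 4}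
    (hab : a ≠ b) (hca : c ≠ a) (hcb : c ≠ b) (hl : ℓ a = ℓ b) : ℓ c = !ℓ a := by
  revert ℓ a b c
  decide

lemma IsBalancedLine.eq_of_pair_ne {ℓ : Fin 4 → Bool} (h : IsBalancedLine ℓ) {a b : Fin 4}
    (hab : a ≠ b) (hl : ∀ c, c ≠ a → c ≠ b → ℓ c = !ℓ a) : ℓ b = ℓ a := by
  revert ℓ a b
  decide

/-- `K` contains with any point `x` its neighbours `y` such that `φ y` is not opposite to `φ x`. -/
def LinkClosed {X V : Type*} (adj : X → X → Prop) (φ : X → V → Bool) (K : Set X) : Prop :=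
  ∀ x ∈ K, ∀ y, adj x y → (φ y ≠ fun v => !φ x v) → y ∈ K

/-- Functions of the class `𝒞` are determined by their restriction to any nonempty link-closed
set. -/
def Propagates {X V : Type*} (adj : X → X → Prop) (𝒞 : Set (X → V → Bool)) : Prop :=
  ∀ φ ∈ 𝒞, ∀ φ' ∈ 𝒞, ∀ K : Set X, K.Nonempty → (∀ x ∈ K, φ x = φ' x) → LinkClosed adj φ K →
    LinkClosed adj φ' K → φ = φ'

variable {X X' V : Type*} {adj : X → X → Prop} {adj' : X' → X' → Prop}

lemma LinkClosed.slice {φ : X' → V → Bool} {K : Set X'} (hK : LinkClosed adj' φ K) (ι : X → X')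
    (hadj : ∀ x y, adj x y → adj' (ι x) (ι y)) : LinkClosed adj (fun x => φ (ι x)) (ι ⁻¹' K) :=
  fun x hx y hxy h => hK (ι x) hx (ι y) (hadj x y hxy) h

/-- On a line meeting a link-closed set in one point, the set contains a second point. -/
lemma LinkClosed.exists_mem_line [Nonempty V] {φ : X' → V → Bool} {K : Set X'}
    (hK : LinkClosed adj' φ K) (p : Fin 4 → X') (hp : ∀ c e, c ≠ e → adj' (p c) (p e))
    (hbal : ∀ v, IsBalancedLine fun c => φ (p c) v) {a : Fin 4} (ha : p a ∈ K) :
    ∃ b, b ≠ a ∧ p b ∈ K := by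
  obtain ⟨v⟩ := ‹Nonempty V›
  obtain ⟨b, hb, hv⟩ := (hbal v).exists_eq a
  refine ⟨b, hb, hK _ ha _ (hp a b hb.symm) fun h => ?_⟩
  have h1 := congrFun h v
  rw [hv] at h1
  simp at h1

lemma LinkClosed.eq_of_line {φ : X' → V → Bool} {K : Set X'}
    (hK : LinkClosed adj' φ K) (p : Fin 4 → X') (hp : ∀ c e, c ≠ e → adj' (p c) (p e))
    (hbal : ∀ v, IsBalancedLine fun c => φ (p c) v) {a b : Fin 4} (hab : a ≠ b) (ha : p a ∈ K)
    (hout : ∀ c, c ≠ a → c ≠ b → p c ∉ K) : φ (p b) = φ (p a) := by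
  funext v
  refine (hbal v).eq_of_pair_ne hab fun c hca hcb => ?_
  by_contra hcon
  exact hout c hca hcb (hK _ ha _ (hp a c hca.symm) fun h => hcon (congrFun h v))

/-- A nonempty link-closed set meets at least two of the four slices. By the hypothesis on slices
the functions agree on each slice that is met. If three are met, balance gives the fourth. If only
two are met, each function is forced to coincide on these two and to take the opposite values on the
others. -/
lemma Propagates.line [Nonempty V] {𝒞 : Set (X → V → Bool)} {𝒞' : Set (X' → V → Bool)}
    (h : Propagates adj 𝒞) (ι : Fin 4 → X → X') (hι : ∀ z, ∃ c x, ι c x = z)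
    (hadj : ∀ c x y, adj x y → adj' (ι c x) (ι c y))
    (hline : ∀ c e x, c ≠ e → adj' (ι c x) (ι e x))
    (h𝒞 : ∀ φ ∈ 𝒞', ∀ c, (fun x => φ (ι c x)) ∈ 𝒞)
    (hbal : ∀ φ ∈ 𝒞', ∀ x v, IsBalancedLine fun c => φ (ι c x) v) : Propagates adj' 𝒞' := by
  intro φ hφ φ' hφ' K hne heq hcl hcl'
  have hS : ∀ c, (ι c ⁻¹' K).Nonempty → (fun x => φ (ι c x)) = fun x => φ' (ι c x) := by
    intro c hc
    exact h _ (h𝒞 φ hφ c) _ (h𝒞 φ' hφ' c) (ι c ⁻¹' K) hc (fun x hx => heq _ hx)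
      (hcl.slice (ι c) (hadj c)) (hcl'.slice (ι c) (hadj c))
  have hfin : ∀ e, (∀ c, c ≠ e → (fun x => φ (ι c x)) = fun x => φ' (ι c x)) → φ = φ' := by
    intro e he
    funext z
    obtain ⟨c, x, rfl⟩ := hι z
    by_cases hce : c = e
    · subst hce
      funext v
      exact (hbal φ hφ x v).eq_of_three (hbal φ' hφ' x v)
        fun c' hc' => congrFun (congrFun (he c' hc') x) v
    · exact congrFun (he c hce) x
  obtain ⟨z, hz⟩ := hne
  obtain ⟨a, x₀, rfl⟩ := hι z
  obtain ⟨b, hba, hb⟩ := hcl.exists_mem_line (fun c => ι c x₀) (fun c e => hline c e x₀)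
    (hbal φ hφ x₀) hz
  by_cases hthree : ∃ c, c ≠ a ∧ c ≠ b ∧ (ι c ⁻¹' K).Nonempty
  · obtain ⟨c, hca, hcb, hc⟩ := hthree
    obtain ⟨e, hea⟩ : ∃ e : Fin 4, ∀ c', c' ≠ e → c' = a ∨ c' = b ∨ c' = c := by
      clear * - hba hca hcb; revert a b c; decide
    refine hfin e fun c' hc' => ?_
    rcases hea c' hc' with rfl | rfl | rfl
    · exact hS _ ⟨x₀, hz⟩
    · exact hS _ ⟨x₀, hb⟩
    · exact hS _ hc
  -- Only the slices `a` and `b` are met. Over a point of `K` the two outer values must be opposite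
  -- to the inner one, so the values at `a` and `b` are equal; propagation inside one slice extends
  -- this equality to all points.
  · have hout : ∀ x c, c ≠ a → c ≠ b → ι c x ∉ K := fun x c hca hcb hx =>
      hthree ⟨c, hca, hcb, ⟨x, hx⟩⟩
    have hab : ∀ φ ∈ 𝒞', LinkClosed adj' φ K → ∀ x, ι a x ∈ K → φ (ι b x) = φ (ι a x) :=
      fun φ hφ hcl x hx => hcl.eq_of_line (fun c => ι c x) (fun c e => hline c e x)
        (hbal φ hφ x) hba.symm hx (hout x)
    have hKab : ι a ⁻¹' K = ι b ⁻¹' K := by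
      ext x
      constructor
      · intro hx
        obtain ⟨c, hc, hcx⟩ := hcl.exists_mem_line (fun c => ι c x) (fun c e => hline c e x)
          (hbal φ hφ x) (a := a) hx
        by_cases hcb : c = b
        · subst hcb; exact hcx
        · exact (hout x c hc hcb hcx).elim
      · intro hx
        obtain ⟨c, hc, hcx⟩ := hcl.exists_mem_line (fun c => ι c x) (fun c e => hline c e x)
          (hbal φ hφ x) (a := b) hx
        by_cases hcb : c = a
        · subst hcb; exact hcx
        · exact (hout x c hcb hc hcx).elim
    have hglob : ∀ φ ∈ 𝒞', LinkClosed adj' φ K → ∀ x, φ (ι a x) = φ (ι b x) := by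
      intro φ hφ hcl x
      refine congrFun (h _ (h𝒞 φ hφ a) _ (h𝒞 φ hφ b) (ι a ⁻¹' K) ⟨x₀, hz⟩
        (fun x hx => (hab φ hφ hcl x hx).symm) (hcl.slice (ι a) (hadj a)) ?_) x
      rw [hKab]
      exact hcl.slice (ι b) (hadj b)
    have hSa := hS a ⟨x₀, hz⟩
    have hSb := hS b ⟨x₀, hb⟩
    funext z
    obtain ⟨c, x, rfl⟩ := hι z
    by_cases hca : c = a
    · subst hca; exact congrFun hSa x
    by_cases hcb : c = b
    · subst hcb; exact congrFun hSb x
    funext v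
    have h1 := (hbal φ hφ x v).ne_of_pair hba.symm hca hcb (congrFun (hglob φ hφ hcl x) v)
    have h2 := (hbal φ' hφ' x v).ne_of_pair hba.symm hca hcb (congrFun (hglob φ' hφ' hcl' x) v)
    rw [h1, h2, congrFun hSa x]

end Propagation

/-! ### Balanced set-valued functions on the Hamming cube. -/

section Hamming

open Function

variable {k : ℕ} {V : Type*}

/-- Points differing in at most one coordinate. -/
def HammingAdj {ι : Type*} [DecidableEq ι] (x y : ι → Fin 4) : Prop := ∃ i c, y = update x i c

lemma HammingAdj.cons {x y : Fin k → Fin 4} (c : Fin 4) (h : HammingAdj x y) :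
    HammingAdj (Fin.cons c x : Fin (k + 1) → Fin 4) (Fin.cons c y) := by
  obtain ⟨i, e, rfl⟩ := h
  exact ⟨i.succ, e, by rw [Fin.cons_update]⟩

lemma hammingAdj_cons_cons (c e : Fin 4) (x : Fin k → Fin 4) :
    HammingAdj (Fin.cons c x : Fin (k + 1) → Fin 4) (Fin.cons e x) :=
  ⟨0, e, by rw [Fin.update_cons_zero]⟩

/-- Set-valued functions such that on every line each element belongs to exactly two sets. -/
def balancedLists (k : ℕ) (V : Type*) : Set ((Fin k → Fin 4) → V → Bool) :=
  {L | ∀ x i v, IsBalancedLine fun c => L (update x i c) v}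

lemma balancedLists_cons {L : (Fin (k + 1) → Fin 4) → V → Bool} (hL : L ∈ balancedLists (k + 1) V)
    (c : Fin 4) : (fun x => L (Fin.cons c x)) ∈ balancedLists k V := by
  intro x i v
  have := hL (Fin.cons c x) i.succ v
  simpa only [Fin.cons_update] using this

lemma balancedLists_line {L : (Fin (k + 1) → Fin 4) → V → Bool}
    (hL : L ∈ balancedLists (k + 1) V) (x : Fin k → Fin 4) (v : V) :
    IsBalancedLine fun c => L (Fin.cons c x) v := by
  have := hL (Fin.cons 0 x) 0 v
  simpa only [Fin.update_cons_zero] using this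

lemma exists_cons_eq (z : Fin (k + 1) → Fin 4) : ∃ c x, (Fin.cons c x : Fin (k + 1) → Fin 4) = z :=
  ⟨z 0, Fin.tail z, Fin.cons_self_tail z⟩

lemma propagates_balancedLists [Nonempty V] (k : ℕ) :
    Propagates (HammingAdj (ι := Fin k)) (balancedLists k V) := by
  induction k with
  | zero =>
    rintro φ - φ' - K ⟨x, hx⟩ h - -
    funext y
    rw [Subsingleton.elim y x]
    exact h x hx
  | succ k ih =>
    exact ih.line (fun c x => Fin.cons c x) exists_cons_eq (fun c _ _ h => h.cons c)
      (fun c e x _ => hammingAdj_cons_cons c e x) (fun φ hφ c => balancedLists_cons hφ c)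
      fun φ hφ => balancedLists_line hφ

/-- The slice of a set of words at a given first letter. -/
def consSlice (K : Finset (Fin (k + 1) → Fin 4)) (c : Fin 4) : Finset (Fin k → Fin 4) :=
  Finset.univ.filter fun x => (Fin.cons c x : Fin (k + 1) → Fin 4) ∈ K

lemma mem_consSlice {K : Finset (Fin (k + 1) → Fin 4)} {c : Fin 4} {x : Fin k → Fin 4} :
    x ∈ consSlice K c ↔ (Fin.cons c x : Fin (k + 1) → Fin 4) ∈ K := by simp [consSlice]

lemma sum_card_consSlice (K : Finset (Fin (k + 1) → Fin 4)) :
    ∑ c, (consSlice K c).card = K.card := by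
  have h : ∀ c, (consSlice K c).card = (K.filter fun z => z 0 = c).card := by
    intro c
    refine Finset.card_bij (fun x _ => Fin.cons c x) ?_ ?_ ?_
    · intro x hx
      exact Finset.mem_filter.2 ⟨mem_consSlice.1 hx, rfl⟩
    · intro x _ y _ hxy
      exact Fin.cons_right_injective (α := fun _ => Fin 4) c hxy
    · intro z hz
      obtain ⟨hz, rfl⟩ := Finset.mem_filter.1 hz
      exact ⟨Fin.tail z, mem_consSlice.2 (by rwa [Fin.cons_self_tail]), Fin.cons_self_tail z⟩
  simp only [h]
  exact (Finset.card_eq_sum_card_fiberwise (f := fun z : Fin (k + 1) → Fin 4 => z 0)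
    (t := Finset.univ) (by simp [Set.MapsTo])).symm

lemma LinkClosed.cons_slice {L : (Fin (k + 1) → Fin 4) → V → Bool}
    {K : Finset (Fin (k + 1) → Fin 4)} (h : LinkClosed HammingAdj L (K : Set _)) (c : Fin 4) :
    LinkClosed HammingAdj (fun x => L (Fin.cons c x)) (consSlice K c : Set (Fin k → Fin 4)) := by
  have := h.slice (adj := HammingAdj) (fun x => (Fin.cons c x : Fin (k + 1) → Fin 4))
    fun x y h => h.cons c
  convert this using 1
  ext x
  simp [mem_consSlice]

variable [Nonempty V]

lemma LinkClosed.exists_cons_mem {L : (Fin (k + 1) → Fin 4) → V → Bool}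
    (hL : L ∈ balancedLists (k + 1) V) {K : Finset (Fin (k + 1) → Fin 4)}
    (h : LinkClosed HammingAdj L (K : Set _)) {a : Fin 4} {x : Fin k → Fin 4}
    (hx : x ∈ consSlice K a) : ∃ b, b ≠ a ∧ x ∈ consSlice K b := by
  simp only [mem_consSlice] at hx ⊢
  exact h.exists_mem_line (fun c => (Fin.cons c x : Fin (k + 1) → Fin 4))
    (fun c e _ => hammingAdj_cons_cons c e x) (balancedLists_line hL x) hx

lemma LinkClosed.exists_two_slices {L : (Fin (k + 1) → Fin 4) → V → Bool}
    (hL : L ∈ balancedLists (k + 1) V) {K : Finset (Fin (k + 1) → Fin 4)}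
    (h : LinkClosed HammingAdj L (K : Set _)) (hne : K.Nonempty) :
    ∃ a b, a ≠ b ∧ (consSlice K a).Nonempty ∧ (consSlice K b).Nonempty := by
  obtain ⟨z, hz⟩ := hne
  obtain ⟨a, x, rfl⟩ := exists_cons_eq z
  obtain ⟨b, hb, hx⟩ := h.exists_cons_mem hL (mem_consSlice.2 hz)
  exact ⟨a, b, hb.symm, ⟨x, mem_consSlice.2 hz⟩, ⟨x, hx⟩⟩

/-- Two slices are nonempty in every dimension, so the size at least doubles. -/
lemma LinkClosed.two_pow_le_card {L : (Fin k → Fin 4) → V → Bool}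
    (hL : L ∈ balancedLists k V) {K : Finset (Fin k → Fin 4)}
    (h : LinkClosed HammingAdj L (K : Set _)) (hne : K.Nonempty) : 2 ^ k ≤ K.card := by
  induction k with
  | zero => simpa using hne.card_pos
  | succ k ih =>
    obtain ⟨a, b, hab, ha, hb⟩ := h.exists_two_slices hL hne
    have h1 := ih (balancedLists_cons hL a) (h.cons_slice a) ha
    have h2 := ih (balancedLists_cons hL b) (h.cons_slice b) hb
    have h3 : (consSlice K a).card + (consSlice K b).card ≤ K.card := by
      rw [← sum_card_consSlice K, ← Finset.sum_pair (f := fun c => (consSlice K c).card) hab]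
      exact Finset.sum_le_sum_of_subset (Finset.subset_univ _)
    rw [pow_succ]
    omega

end Hamming

/-! ### Only exponentially many balanced functions have a small link-closed set. -/

section ListPairs

open Function

variable {k : ℕ}

/-- A binary word of length four with an even number of ones. -/
def IsEvenLine (κ : Fin 4 → Bool) : Prop := (κ 0 ^^ κ 1 ^^ κ 2 ^^ κ 3) = false

instance (κ : Fin 4 → Bool) : Decidable (IsEvenLine κ) := inferInstanceAs (Decidable (_ = _))

lemma isEvenLine_of_closed {κ : Fin 4 → Bool} (h1 : ∀ a, κ a = true → ∃ b, b ≠ a ∧ κ b = true)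
    (h3 : ∀ e, (∀ c, c ≠ e → κ c = true) → κ e = true) : IsEvenLine κ := by
  revert κ
  decide

lemma IsEvenLine.eq_of_three {κ κ' : Fin 4 → Bool} (h : IsEvenLine κ) (h' : IsEvenLine κ')
    {e : Fin 4} (he : ∀ c, c ≠ e → κ c = κ' c) : κ e = κ' e := by
  revert κ κ' e
  decide

/-- A set-valued function and a set of words. -/
abbrev ListPair (k : ℕ) : Type := ((Fin k → Fin 4) → Fin 4 → Bool) × Finset (Fin k → Fin 4)

/-- The balanced set-valued functions together with a link-closed nonempty set of bounded
size. -/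
def listPairs (k b : ℕ) : Set (ListPair k) :=
  {p | p.1 ∈ balancedLists k (Fin 4) ∧ p.2.Nonempty ∧ LinkClosed HammingAdj p.1 (p.2 : Set _) ∧
    2 * p.2.card ≤ b * 2 ^ k}

/-- The slice of a pair at a given first letter. -/
def ListPair.slice (p : ListPair (k + 1)) (c : Fin 4) : ListPair k :=
  (fun x => p.1 (Fin.cons c x), consSlice p.2 c)

lemma ListPair.slice_mem {b b' : ℕ} {p : ListPair (k + 1)} (hp : p ∈ listPairs (k + 1) b)
    {c : Fin 4} (hne : (consSlice p.2 c).Nonempty) (hc : 2 * (consSlice p.2 c).card ≤ b' * 2 ^ k) :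
    p.slice c ∈ listPairs k b' :=
  ⟨balancedLists_cons hp.1 c, hne, hp.2.2.1.cons_slice c, hc⟩

/-- A single point on a line is excluded because balance supplies a second. With exactly three
points, the fourth value would be opposite to all three others, against balance. -/
lemma listPairs_even {b : ℕ} {p : ListPair (k + 1)} (hp : p ∈ listPairs (k + 1) b)
    (x : Fin k → Fin 4) : IsEvenLine fun c => decide (x ∈ consSlice p.2 c) := by
  refine isEvenLine_of_closed ?_ fun e he => ?_
  · simp only [decide_eq_true_eq]
    exact fun a ha => hp.2.2.1.exists_cons_mem hp.1 ha
  simp only [decide_eq_true_eq] at he ⊢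
  by_contra hcon
  rw [mem_consSlice] at hcon
  have h1 : ∀ c, c ≠ e → p.1 (Fin.cons e x) 0 = !p.1 (Fin.cons c x) 0 := by
    intro c hc
    by_contra hne
    exact hcon (hp.2.2.1 _ (mem_consSlice.1 (he c hc)) _ (hammingAdj_cons_cons c e x)
      fun h => hne (congrFun h 0))
  have h2 := balancedLists_line hp.1 x 0
  clear * - h1 h2
  have : ∀ (ℓ : Fin 4 → Bool) e, IsBalancedLine ℓ → (∀ c, c ≠ e → ℓ e = !ℓ c) → False := by decide
  exact this _ e h2 h1

/-- By propagation only the values over the link-closed set have to be compared. -/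
lemma listPairs_ext {b b' : ℕ} {p p' : ListPair (k + 1)} (hp : p ∈ listPairs (k + 1) b)
    (hp' : p' ∈ listPairs (k + 1) b') (hK : ∀ c, consSlice p.2 c = consSlice p'.2 c)
    (hL : ∀ c, ∀ x ∈ consSlice p.2 c, p.1 (Fin.cons c x) = p'.1 (Fin.cons c x)) : p = p' := by
  have h2 : p.2 = p'.2 := by
    ext z
    obtain ⟨c, x, rfl⟩ := exists_cons_eq z
    rw [← mem_consSlice, hK c, mem_consSlice]
  refine Prod.ext ?_ h2
  refine propagates_balancedLists (k + 1) _ hp.1 _ hp'.1 (p.2 : Set _) (by simpa using hp.2.1) ?_ hp.2.2.1 ?_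
  · intro z hz
    obtain ⟨c, x, rfl⟩ := exists_cons_eq z
    exact hL c x (mem_consSlice.2 hz)
  · rw [h2]
    exact hp'.2.2.1

lemma listPairs_eq_of_empty {b : ℕ} {p : ListPair (k + 1)} (hp : p ∈ listPairs (k + 1) b)
    {a c : Fin 4} (hac : a ≠ c) {x : Fin k → Fin 4} (hx : x ∈ consSlice p.2 a)
    (hout : ∀ e, e ≠ a → e ≠ c → x ∉ consSlice p.2 e) :
    p.1 (Fin.cons c x) = p.1 (Fin.cons a x) :=
  hp.2.2.1.eq_of_line (fun c => (Fin.cons c x : Fin (k + 1) → Fin 4))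
    (fun c e _ => hammingAdj_cons_cons c e x) (balancedLists_line hp.1 x) hac
    (mem_consSlice.1 hx) fun e h1 h2 h => hout e h1 h2 (mem_consSlice.2 h)

lemma listPairs_slice_eq_of_two {b : ℕ} {p : ListPair (k + 1)} (hp : p ∈ listPairs (k + 1) b)
    {a c : Fin 4} (hac : a ≠ c) (hout : ∀ e, e ≠ a → e ≠ c → consSlice p.2 e = ∅) :
    consSlice p.2 c = consSlice p.2 a := by
  have key : ∀ a c, a ≠ c → (∀ e, e ≠ a → e ≠ c → consSlice p.2 e = ∅) →
      consSlice p.2 c ⊆ consSlice p.2 a := by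
    intro a c hac hout x hx
    obtain ⟨e, he, hxe⟩ := hp.2.2.1.exists_cons_mem hp.1 hx
    by_cases hea : e = a
    · subst hea; exact hxe
    · rw [hout e hea he] at hxe
      simp at hxe
  exact Finset.Subset.antisymm (key a c hac hout)
    (key c a hac.symm fun e h1 h2 => hout e h2 h1)

/-- When only the slices `a` and `c` are occupied, evenness makes them equal as sets and balance
makes the values over them equal, so one slice carries everything. -/
lemma listPairs_injOn_two (b : ℕ) {a c : Fin 4} (hac : a ≠ c) :
    Set.InjOn (fun p : ListPair (k + 1) => p.slice a) {p | p ∈ listPairs (k + 1) b ∧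
      ∀ e, e ≠ a → e ≠ c → consSlice p.2 e = ∅} := by
  rintro p ⟨hp, hout⟩ p' ⟨hp', hout'⟩ h
  obtain ⟨hL, hK⟩ := Prod.ext_iff.1 h
  simp only [ListPair.slice] at hL hK
  have hKc : consSlice p.2 c = consSlice p.2 a := listPairs_slice_eq_of_two hp hac hout
  have hKc' : consSlice p'.2 c = consSlice p'.2 a := listPairs_slice_eq_of_two hp' hac hout'
  refine listPairs_ext hp hp' (fun e => ?_) fun e x hx => ?_
  · by_cases hea : e = a
    · subst hea; exact hK
    by_cases hec : e = c
    · subst hec; rw [hKc, hKc', hK]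
    rw [hout e hea hec, hout' e hea hec]
  · by_cases hea : e = a
    · subst hea; exact congrFun hL x
    by_cases hec : e = c
    · subst hec
      rw [hKc] at hx
      rw [listPairs_eq_of_empty hp hac hx fun e h1 h2 => by rw [hout e h1 h2]; simp,
        listPairs_eq_of_empty hp' hac (hK ▸ hx) fun e h1 h2 => by rw [hout' e h1 h2]; simp]
      exact congrFun hL x
    · rw [hout e hea hec] at hx
      simp at hx

/-- The fourth slice of the set is found by parity. A point of it has exactly one companion, in
slice `a` or `c`, and shares its value. -/
lemma listPairs_injOn_three (b : ℕ) {a c e : Fin 4} (hac : a ≠ c) (hea : e ≠ a) (hec : e ≠ c) :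
    Set.InjOn (fun p : ListPair (k + 1) => (p.slice a, p.slice c))
      {p | p ∈ listPairs (k + 1) b ∧ consSlice p.2 e = ∅} := by
  rintro p ⟨hp, hout⟩ p' ⟨hp', hout'⟩ h
  obtain ⟨ha, hc⟩ := Prod.ext_iff.1 h
  obtain ⟨hLa, hKa⟩ := Prod.ext_iff.1 ha
  obtain ⟨hLc, hKc⟩ := Prod.ext_iff.1 hc
  simp only [ListPair.slice] at hLa hKa hLc hKc
  obtain ⟨u, hua, huc, hue, hcov⟩ : ∃ u, u ≠ a ∧ u ≠ c ∧ u ≠ e ∧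
      ∀ w, w = a ∨ w = c ∨ w = e ∨ w = u := by
    have : ∀ a c e : Fin 4, a ≠ c → e ≠ a → e ≠ c →
        ∃ u, ∀ w, w = u ↔ w ≠ a ∧ w ≠ c ∧ w ≠ e := by decide
    obtain ⟨u, hu⟩ := this a c e hac hea hec
    obtain ⟨h1, h2, h3⟩ := (hu u).1 rfl
    refine ⟨u, h1, h2, h3, fun w => ?_⟩
    have := hu w
    tauto
  have hK : ∀ w, w ≠ u → consSlice p.2 w = consSlice p'.2 w := by
    intro w hw
    rcases hcov w with rfl | rfl | rfl | rfl
    · exact hKa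
    · exact hKc
    · rw [hout, hout']
    · exact (hw rfl).elim
  have hKu : consSlice p.2 u = consSlice p'.2 u := by
    ext x
    have := (listPairs_even hp x).eq_of_three (listPairs_even hp' x) (e := u)
      fun c hc => by rw [hK c hc]
    simpa using this
  have hKall : ∀ w, consSlice p.2 w = consSlice p'.2 w := fun w => by
    by_cases hw : w = u
    · subst hw; exact hKu
    · exact hK w hw
  have hev : ∀ x ∈ consSlice p.2 u, x ∈ consSlice p.2 a → x ∉ consSlice p.2 c := by
    intro x hxu hxa hxc
    have h1 : x ∉ consSlice p.2 e := by rw [hout]; simp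
    have h2 := listPairs_even hp x
    have h3 := h2.eq_of_three (κ' := fun _ => true) (by decide) (e := e) (by
        intro w hw
        rcases hcov w with rfl | rfl | rfl | rfl
        · simpa using hxa
        · simpa using hxc
        · exact (hw rfl).elim
        · simpa using hxu)
    simp [h1] at h3
  refine listPairs_ext hp hp' hKall fun w x hx => ?_
  rcases hcov w with rfl | rfl | rfl | rfl
  · exact congrFun hLa x
  · exact congrFun hLc x
  · rw [hout] at hx
    simp at hx
  · have h1 : x ∉ consSlice p.2 e := by rw [hout]; simp
    by_cases hxa : x ∈ consSlice p.2 a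
    · have hxc := hev x hx hxa
      have hx2 : ∀ f, f ≠ a → f ≠ w → x ∉ consSlice p.2 f := by
        intro f hfa hfw
        rcases hcov f with rfl | rfl | rfl | rfl
        · exact (hfa rfl).elim
        · exact hxc
        · exact h1
        · exact (hfw rfl).elim
      rw [listPairs_eq_of_empty hp hua.symm hxa hx2, listPairs_eq_of_empty hp' hua.symm
        (hKa ▸ hxa) fun f h1 h2 => hKall f ▸ hx2 f h1 h2]
      exact congrFun hLa x
    · obtain ⟨f, hf, hxf⟩ := hp.2.2.1.exists_cons_mem hp.1 hx
      have hxc : x ∈ consSlice p.2 c := by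
        rcases hcov f with rfl | rfl | rfl | rfl
        · exact (hxa hxf).elim
        · exact hxf
        · exact (h1 hxf).elim
        · exact (hf rfl).elim
      have hx2 : ∀ f, f ≠ c → f ≠ w → x ∉ consSlice p.2 f := by
        intro f hfc hfw
        rcases hcov f with rfl | rfl | rfl | rfl
        · exact hxa
        · exact (hfc rfl).elim
        · exact h1
        · exact (hfw rfl).elim
      rw [listPairs_eq_of_empty hp huc.symm hxc hx2, listPairs_eq_of_empty hp' huc.symm
        (hKc ▸ hxc) fun f h1 h2 => hKall f ▸ hx2 f h1 h2]
      exact congrFun hLc x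

lemma listPairs_injOn_four (b : ℕ) {a c e : Fin 4} (hac : a ≠ c) (hea : e ≠ a) (hec : e ≠ c) :
    Set.InjOn (fun p : ListPair (k + 1) => (p.slice a, p.slice c, p.slice e))
      (listPairs (k + 1) b) := by
  intro p hp p' hp' h
  obtain ⟨ha, h'⟩ := Prod.ext_iff.1 h
  obtain ⟨hc, he⟩ := Prod.ext_iff.1 h'
  obtain ⟨hLa, hKa⟩ := Prod.ext_iff.1 ha
  obtain ⟨hLc, hKc⟩ := Prod.ext_iff.1 hc
  obtain ⟨hLe, hKe⟩ := Prod.ext_iff.1 he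
  simp only [ListPair.slice] at hLa hKa hLc hKc hLe hKe
  obtain ⟨u, hcov⟩ : ∃ u, ∀ w, w ≠ u → w = a ∨ w = c ∨ w = e := by
    clear * - hac hea hec; revert a c e; decide
  have hK : ∀ w, w ≠ u → consSlice p.2 w = consSlice p'.2 w := by
    intro w hw
    rcases hcov w hw with rfl | rfl | rfl <;> assumption
  have hL : ∀ w, w ≠ u → ∀ x, p.1 (Fin.cons w x) = p'.1 (Fin.cons w x) := by
    intro w hw x
    rcases hcov w hw with rfl | rfl | rfl
    · exact congrFun hLa x
    · exact congrFun hLc x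
    · exact congrFun hLe x
  refine listPairs_ext hp hp' (fun w => ?_) fun w x _ => ?_
  · by_cases hw : w = u
    · subst hw
      ext x
      have := (listPairs_even hp x).eq_of_three (listPairs_even hp' x) (e := w)
        fun c hc => by rw [hK c hc]
      simpa using this
    · exact hK w hw
  · by_cases hw : w = u
    · subst hw
      funext v
      exact (balancedLists_line hp.1 x v).eq_of_three (balancedLists_line hp'.1 x v)
        fun c hc => by rw [hL c hc x]
    · exact hL w hw x

/-- Sizes are measured in units of 2^(k-1), half the least size of a nonempty link-closed set. If at
least three slices are occupied, discard a largest one. For any other occupied slice x, twice its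
size plus 2^k for a third slice is at most (b+1)2^k, so the bound drops from b+1 to b. If only two
slices are occupied they are equal, and one of them is kept under the old bound. -/
lemma listPairs_succ_subset (b : ℕ) : listPairs (k + 1) (b + 1) ⊆
    (⋃ q : {q : Fin 4 × Fin 4 // q.1 ≠ q.2},
      {p ∈ listPairs (k + 1) (b + 1) | p.slice q.1.1 ∈ listPairs k (b + 1) ∧
        ∀ e, e ≠ q.1.1 → e ≠ q.1.2 → consSlice p.2 e = ∅}) ∪
    ⋃ q : {q : Fin 4 × Fin 4 × Fin 4 // q.1 ≠ q.2.1 ∧ q.2.2 ≠ q.1 ∧ q.2.2 ≠ q.2.1},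
      ({p ∈ listPairs (k + 1) (b + 1) | (p.slice q.1.1 ∈ listPairs k b ∧
        p.slice q.1.2.1 ∈ listPairs k b) ∧ consSlice p.2 q.1.2.2 = ∅} ∪
      {p ∈ listPairs (k + 1) (b + 1) | p.slice q.1.1 ∈ listPairs k b ∧
        p.slice q.1.2.1 ∈ listPairs k b ∧ p.slice q.1.2.2 ∈ listPairs k b}) := by
  intro p hp
  have hsum := sum_card_consSlice p.2
  set w : Fin 4 → ℕ := fun c => (consSlice p.2 c).card with hw
  have hw0 : ∀ c, (consSlice p.2 c).Nonempty → 2 ^ k ≤ w c := fun c hc =>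
    (hp.2.2.1.cons_slice c).two_pow_le_card (balancedLists_cons hp.1 c) hc
  have htot : ∑ c, w c ≤ (b + 1) * 2 ^ k := by
    have := hp.2.2.2
    rw [pow_succ] at this
    rw [hsum]
    nlinarith
  obtain ⟨a, c, hac, ha, hc⟩ := hp.2.2.1.exists_two_slices hp.1 hp.2.1
  by_cases htwo : ∀ e, e ≠ a → e ≠ c → consSlice p.2 e = ∅
  · left
    refine Set.mem_iUnion.2 ⟨⟨(a, c), hac⟩, hp, ?_, htwo⟩
    refine ListPair.slice_mem hp ha ?_
    have h1 : w a + w c ≤ ∑ c, w c := by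
      rw [← Finset.sum_pair (f := w) hac]
      exact Finset.sum_le_sum_of_subset (Finset.subset_univ _)
    have h2 : w c = w a := by
      simp only [hw]
      rw [listPairs_slice_eq_of_two hp hac htwo]
    change 2 * w a ≤ _
    omega
  · right
    push Not at htwo
    obtain ⟨e, hea, hec, he⟩ := htwo
    obtain ⟨u, -, hu⟩ := Finset.exists_max_image Finset.univ w ⟨0, Finset.mem_univ _⟩
    have hperm : ∀ x y z t : Fin 4, x ≠ y → z ≠ x → z ≠ y → t ≠ x → t ≠ y → t ≠ z →
        ∑ c, w c = w x + w y + w z + w t := by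
      intro x y z t h1 h2 h3 h4 h5 h6
      have : (Finset.univ : Finset (Fin 4)) = {x, y, z, t} := by
        clear * - h1 h2 h3 h4 h5 h6
        revert x y z t
        decide
      rw [this, Finset.sum_insert, Finset.sum_insert, Finset.sum_pair h6.symm]
      · ring
      · simp [h3.symm, h5.symm]
      · simp [h1, h2.symm, h4.symm]
    by_cases hfour : ∀ f, (consSlice p.2 f).Nonempty
    · obtain ⟨x, y, z, h1, h2, h3, h4, h5, h6⟩ : ∃ x y z : Fin 4, x ≠ y ∧ z ≠ x ∧ z ≠ y ∧
          u ≠ x ∧ u ≠ y ∧ u ≠ z := by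
        clear * -
        revert u
        decide
      have h7 := hperm x y z u h1 h2 h3 h4 h5 h6
      have hx := hw0 x (hfour x)
      have hy := hw0 y (hfour y)
      have hz := hw0 z (hfour z)
      have ux := hu x (Finset.mem_univ _)
      have uy := hu y (Finset.mem_univ _)
      have uz := hu z (Finset.mem_univ _)
      rw [h7, Nat.succ_mul] at htot
      refine Set.mem_iUnion.2 ⟨⟨(x, y, z), h1, h2, h3⟩, Or.inr ⟨hp, ?_, ?_, ?_⟩⟩
      · exact ListPair.slice_mem hp (hfour x) (show 2 * w x ≤ _ by omega)
      · exact ListPair.slice_mem hp (hfour y) (show 2 * w y ≤ _ by omega)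
      · exact ListPair.slice_mem hp (hfour z) (show 2 * w z ≤ _ by omega)
    · push Not at hfour
      obtain ⟨f, hf⟩ := hfour
      have hne : ∀ c, (consSlice p.2 c).Nonempty → f ≠ c := by
        rintro c hc rfl
        rw [hf] at hc
        simp at hc
      have hfa := hne a ha
      have hfc := hne c hc
      have hfe := hne e he
      have hall : ∀ c, c ≠ f → (consSlice p.2 c).Nonempty := by
        intro c' hc'
        have : c' = a ∨ c' = c ∨ c' = e := by
          clear * - hac hea hec hfa hfc hfe hc'
          revert a c e f c'
          decide
        rcases this with rfl | rfl | rfl <;> assumption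
      have huf : u ≠ f := by
        rintro rfl
        have h1 := hu a (Finset.mem_univ _)
        have h2 := hw0 a ha
        have h3 : w u = 0 := by simp [hw, hf]
        have h4 : 0 < 2 ^ k := by positivity
        omega
      obtain ⟨x, y, h1, h2, h3, h4, h5⟩ : ∃ x y : Fin 4, x ≠ y ∧ f ≠ x ∧ f ≠ y ∧
          u ≠ x ∧ u ≠ y := by
        clear * -
        revert u f
        decide
      have h7 := hperm x y f u h1 h2 h3 h4 h5 huf
      have hx := hw0 x (hall x h2.symm)
      have hy := hw0 y (hall y h3.symm)
      have ux := hu x (Finset.mem_univ _)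
      have uy := hu y (Finset.mem_univ _)
      rw [h7, Nat.succ_mul] at htot
      refine Set.mem_iUnion.2 ⟨⟨(x, y, f), h1, h2, h3⟩, Or.inl ⟨hp, ⟨?_, ?_⟩, hf⟩⟩
      · exact ListPair.slice_mem hp (hall x h2.symm) (show 2 * w x ≤ _ by omega)
      · exact ListPair.slice_mem hp (hall y h3.symm) (show 2 * w y ≤ _ by omega)

lemma ncard_listPairs_succ_le (b : ℕ) : (listPairs (k + 1) (b + 1)).ncard ≤
    12 * (listPairs k (b + 1)).ncard +
      24 * ((listPairs k b).ncard ^ 2 + (listPairs k b).ncard ^ 3) := by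
  refine (Set.ncard_le_ncard (listPairs_succ_subset b) (Set.toFinite _)).trans ?_
  refine (Set.ncard_union_le _ _).trans (Nat.add_le_add ?_ ?_)
  · refine (Set.ncard_iUnion_le_of_fintype _).trans ?_
    calc _ ≤ ∑ q : {q : Fin 4 × Fin 4 // q.1 ≠ q.2}, (listPairs k (b + 1)).ncard := by
          refine Finset.sum_le_sum fun q _ => ?_
          refine Set.ncard_le_ncard_of_injOn (fun p => p.slice q.1.1) (fun p hp => hp.2.1) ?_
            (Set.toFinite _)
          refine (listPairs_injOn_two (b + 1) q.2).mono ?_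
          exact fun p hp => ⟨hp.1, hp.2.2⟩
      _ = _ := by
          rw [Finset.sum_const, smul_eq_mul]
          congr 1
  · refine (Set.ncard_iUnion_le_of_fintype _).trans ?_
    calc _ ≤ ∑ q : {q : Fin 4 × Fin 4 × Fin 4 // q.1 ≠ q.2.1 ∧ q.2.2 ≠ q.1 ∧ q.2.2 ≠ q.2.1},
          ((listPairs k b).ncard ^ 2 + (listPairs k b).ncard ^ 3) := by
          refine Finset.sum_le_sum fun q _ => (Set.ncard_union_le _ _).trans (Nat.add_le_add ?_ ?_)
          · rw [sq, ← Set.ncard_prod]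
            refine Set.ncard_le_ncard_of_injOn (t := listPairs k b ×ˢ listPairs k b)
              (fun p => (p.slice q.1.1, p.slice q.1.2.1))
              (fun p hp => ⟨hp.2.1.1, hp.2.1.2⟩) ?_ (Set.toFinite _)
            refine (listPairs_injOn_three (b + 1) q.2.1 q.2.2.1 q.2.2.2).mono ?_
            exact fun p hp => ⟨hp.1, hp.2.2⟩
          · rw [pow_succ', sq, ← Set.ncard_prod, ← Set.ncard_prod]
            refine Set.ncard_le_ncard_of_injOn
              (t := listPairs k b ×ˢ (listPairs k b ×ˢ listPairs k b))
              (fun p => (p.slice q.1.1, p.slice q.1.2.1, p.slice q.1.2.2))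
              (fun p hp => ⟨hp.2.1, hp.2.2.1, hp.2.2.2⟩) ?_ (Set.toFinite _)
            exact (listPairs_injOn_four (b + 1) q.2.1 q.2.2.1 q.2.2.2).mono fun p hp => hp.1
      _ = _ := by
          rw [Finset.sum_const, smul_eq_mul]
          congr 1

lemma ncard_listPairs_zero_right : (listPairs k 0).ncard = 0 := by
  rw [Set.ncard_eq_zero]
  ext p
  simp only [Set.mem_empty_iff_false, iff_false]
  rintro ⟨-, h1, -, h2⟩
  have := h1.card_pos
  omega

/-- For every size bound there are only exponentially many (in the dimension) pairs. -/
lemma exists_ncard_listPairs_le (b : ℕ) : ∃ E : ℕ, ∀ k, (listPairs k b).ncard ≤ 2 ^ (E * (k + 1)) := by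
  induction b with
  | zero => exact ⟨0, fun k => by simp [ncard_listPairs_zero_right]⟩
  | succ b ih =>
    obtain ⟨E, hE⟩ := ih
    -- The cube in the recursion requires 3E; the 6 is for 12 + 24 + 24 ≤ 2^6.
    refine ⟨3 * E + 6, fun k => ?_⟩
    induction k with
    | zero =>
      have h1 : (listPairs 0 (b + 1)).ncard ≤
          (Set.univ ×ˢ Set.univ : Set (ListPair 0)).ncard :=
        Set.ncard_le_ncard (by simp) (Set.toFinite _)
      -- In dimension 0 there are 2^4 values at the only point and two sets of points.
      have h2 : (Set.univ ×ˢ Set.univ : Set (ListPair 0)).ncard = 32 := by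
        rw [Set.univ_prod_univ, Set.ncard_univ, Nat.card_eq_fintype_card]
        simp
      calc _ ≤ 2 ^ 5 := by rw [h2] at h1; exact h1
        _ ≤ _ := Nat.pow_le_pow_right (by norm_num) (by omega)
    | succ k ihk =>
      have h1 := ncard_listPairs_succ_le (k := k) b
      have h2 := hE k
      set P := (listPairs k b).ncard
      set R := 2 ^ ((3 * E + 6) * (k + 1)) with hR
      have h3 : P ^ 3 ≤ (2 ^ (E * (k + 1))) ^ 3 := Nat.pow_le_pow_left h2 3
      have h4 : P ^ 2 ≤ P ^ 3 := by
        rcases Nat.eq_zero_or_pos P with h | h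
        · simp [h]
        · exact Nat.pow_le_pow_right h (by norm_num)
      have h5 : (2 ^ (E * (k + 1))) ^ 3 ≤ R := by
        rw [hR, ← pow_mul]
        refine Nat.pow_le_pow_right (by norm_num) ?_
        nlinarith
      have h6 : 2 ^ ((3 * E + 6) * (k + 1 + 1)) = 2 ^ (3 * E + 6) * R := by
        rw [hR, ← pow_add]
        congr 1
        ring
      have h7 : 2 ^ 6 ≤ 2 ^ (3 * E + 6) := Nat.pow_le_pow_right (by norm_num) (by omega)
      have h8 : 2 ^ 6 * R ≤ 2 ^ (3 * E + 6) * R := Nat.mul_le_mul_right _ h7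
      rw [h6]
      omega

end ListPairs

/-! ### Latin functions whose first link graph has many components. -/

section Nice

open Function

variable {d : ℕ}

/-- The set of Latin functions of `d` variables. -/
def latinSet (d : ℕ) : Set ((Fin d → Fin 4) → Fin 4) := {f | IsLatin f}

/-- The pair of values of `f` when the first argument is `a` or `b`. -/
def pairList (f : (Fin (d + 1) → Fin 4) → Fin 4) (a b : Fin 4) : (Fin d → Fin 4) → Fin 4 → Bool :=
  fun y v => decide (f (Fin.cons a y) = v ∨ f (Fin.cons b y) = v)

lemma IsLatin.injective_cons {f : (Fin (d + 1) → Fin 4) → Fin 4} (hf : IsLatin f)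
    (y : Fin d → Fin 4) : Injective fun c => f (Fin.cons c y) := by
  have := hf.injective (Fin.cons 0 y) 0
  simpa only [Fin.update_cons_zero] using this

lemma pairList_mem {f : (Fin (d + 1) → Fin 4) → Fin 4} (hf : IsLatin f) {a b : Fin 4}
    (hab : a ≠ b) : pairList f a b ∈ balancedLists d (Fin 4) := by
  intro x i v
  simp only [pairList, IsBalancedLine, decide_eq_true_eq]
  obtain ⟨p, hp⟩ := (hf.cons a).surjective x i v
  obtain ⟨q, hq⟩ := (hf.cons b).surjective x i v
  have hpi := (hf.cons a).injective x i
  have hqi := (hf.cons b).injective x i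
  have hpq : p ≠ q := by
    rintro rfl
    exact hab (hf.injective_cons _ (hp.trans hq.symm))
  have : (Finset.univ.filter fun c => f (Fin.cons a (update x i c)) = v ∨
      f (Fin.cons b (update x i c)) = v) = {p, q} := by
    ext c
    simp only [Finset.mem_filter, Finset.mem_univ, true_and, Finset.mem_insert,
      Finset.mem_singleton]
    constructor
    · rintro (h | h)
      · exact Or.inl (hpi (h.trans hp.symm))
      · exact Or.inr (hqi (h.trans hq.symm))
    · rintro (rfl | rfl)
      · exact Or.inl hp
      · exact Or.inr hq
  rw [this, Finset.card_pair hpq]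

lemma exists_eq_of_pairList_ne {f : (Fin (d + 1) → Fin 4) → Fin 4} (hf : IsLatin f)
    {a b : Fin 4} (hab : a ≠ b) {x y : Fin d → Fin 4}
    (h : pairList f a b y ≠ fun v => !pairList f a b x v) :
    ∃ u, (u = a ∨ u = b) ∧ ∃ w, (w = a ∨ w = b) ∧ f (Fin.cons u x) = f (Fin.cons w y) := by
  have hx : f (Fin.cons a x) ≠ f (Fin.cons b x) := fun h => hab (hf.injective_cons x h)
  have hy : f (Fin.cons a y) ≠ f (Fin.cons b y) := fun h => hab (hf.injective_cons y h)
  have key : ∀ p q r s : Fin 4, p ≠ q → r ≠ s → (∃ v, decide (r = v ∨ s = v) ≠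
      !decide (p = v ∨ q = v)) → p = r ∨ p = s ∨ q = r ∨ q = s := by decide
  rcases key _ _ _ _ hx hy (by by_contra hcon; push Not at hcon; exact h (funext hcon)) with
    h | h | h | h
  · exact ⟨a, Or.inl rfl, a, Or.inl rfl, h⟩
  · exact ⟨a, Or.inl rfl, b, Or.inr rfl, h⟩
  · exact ⟨b, Or.inr rfl, a, Or.inl rfl, h⟩
  · exact ⟨b, Or.inr rfl, b, Or.inr rfl, h⟩

/-- The number of components of the link graph of the first coordinate. -/
noncomputable def topLoss (f : (Fin (d + 1) → Fin 4) → Fin 4) (a b : Fin 4) : ℕ :=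
  compCount (linkGraph f 0 a b) {y | y 0 = 0}

lemma stageRegion_zero (Q : Fin (d + 1) → DistinctPair) : stageRegion Q 0 = {y | y 0 = 0} := by
  ext y
  simp [stageRegion]

lemma stageLoss_zero (f : (Fin (d + 1) → Fin 4) → Fin 4) (Q : Fin (d + 1) → DistinctPair) :
    stageLoss f Q 0 = topLoss f (Q 0).1.1 (Q 0).1.2 := by
  rw [stageLoss, topLoss, stageRegion_zero]

lemma topLoss_le {f : (Fin (d + 1) → Fin 4) → Fin 4} (hf : IsLatin f) {a b : Fin 4}
    (hab : a ≠ b) : topLoss f a b ≤ 2 ^ d := by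
  have := stageLoss_zero_le hf (fun _ => ⟨(a, b), hab⟩)
  rwa [stageLoss_zero] at this

lemma ncard_zero_slice : ({y | y 0 = 0} : Set (Fin (d + 1) → Fin 4)).ncard = 2 ^ d * 2 ^ d := by
  have : ({y | y 0 = 0} : Set (Fin (d + 1) → Fin 4)) =
      (fun y : Fin d → Fin 4 => (Fin.cons 0 y : Fin (d + 1) → Fin 4)) '' Set.univ := by
    ext y
    simp only [Set.mem_ofPred_eq, Set.image_univ, Set.mem_range]
    constructor
    · intro h
      exact ⟨Fin.tail y, by rw [← h]; exact Fin.cons_self_tail y⟩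
    · rintro ⟨z, rfl⟩
      rfl
  rw [this, Set.ncard_image_of_injective _ (Fin.cons_right_injective (α := fun _ => Fin 4) 0),
    Set.ncard_univ, ← mul_pow]
  simp

/-- Among 4^d positions and at least 2^d/s components, some component has at most s 2^d positions.
It is link-closed for the pair function because non-opposite pairs of values intersect. -/
lemma exists_mem_listPairs {f : (Fin (d + 1) → Fin 4) → Fin 4} (hf : IsLatin f) {a b : Fin 4}
    (hab : a ≠ b) {s : ℕ} (hs : 2 ^ d ≤ s * topLoss f a b) :
    ∃ K, (pairList f a b, K) ∈ listPairs d (2 * s) := by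
  classical
  obtain ⟨c, hc⟩ : ∃ c : ((linkGraph f 0 a b).induce {y | y 0 = 0}).ConnectedComponent,
      (compSet _ c).ncard ≤ s * 2 ^ d := by
    by_contra hcon
    push Not at hcon
    have h1 := compCount_mul_le (linkGraph f 0 a b) {y | y 0 = 0} (s * 2 ^ d + 1)
      fun c => hcon c
    rw [ncard_zero_slice] at h1
    change topLoss f a b * _ ≤ _ at h1
    have h2 : 0 < topLoss f a b := by
      rcases Nat.eq_zero_or_pos (topLoss f a b) with h | h
      · rw [h] at hs
        have : 0 < 2 ^ d := by positivity
        omega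
      · exact h
    nlinarith [Nat.mul_le_mul_right (2 ^ d) hs]
  let K : Finset (Fin d → Fin 4) := Finset.univ.filter fun x =>
    (Fin.cons 0 x : Fin (d + 1) → Fin 4) ∈ compSet _ c
  have hmem : ∀ x, x ∈ K ↔ (Fin.cons 0 x : Fin (d + 1) → Fin 4) ∈ compSet _ c := by simp [K]
  refine ⟨K, pairList_mem hf hab, ?_, ?_, ?_⟩
  · obtain ⟨y, hy⟩ := compSet_nonempty _ c
    refine ⟨Fin.tail y, (hmem _).2 ?_⟩
    have h0 : y 0 = 0 := compSet_subset _ c hy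
    have h1 : (Fin.cons 0 (Fin.tail y) : Fin (d + 1) → Fin 4) = y := by
      rw [← h0]; exact Fin.cons_self_tail y
    rwa [h1]
  · rintro x hx y ⟨i, e, rfl⟩ hne
    have hx' := (hmem _).1 hx
    refine (hmem _).2 ?_
    by_cases heq : update x i e = x
    · rwa [heq]
    · refine compSet_closed _ c hx' rfl ⟨fun h => heq ?_, ⟨i.succ, Fin.succ_ne_zero i, e, ?_⟩, ?_⟩
      · exact (Fin.cons_right_injective (α := fun _ => Fin 4) 0 h).symm
      · rw [Fin.cons_update]
      · simp only [Fin.update_cons_zero]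
        exact exists_eq_of_pairList_ne hf hab hne
  · have h1 : K.card ≤ (compSet _ c).ncard := by
      rw [← Set.ncard_coe_finset]
      exact Set.ncard_le_ncard_of_injOn (fun x => (Fin.cons 0 x : Fin (d + 1) → Fin 4))
        (fun x hx => (hmem x).1 hx) ((Fin.cons_right_injective (α := fun _ => Fin 4) 0).injOn)
        (Set.toFinite _)
    calc 2 * K.card ≤ 2 * (s * 2 ^ d) := by omega
      _ = _ := by ring

lemma samePair_of_pairList_eq {f g : (Fin (d + 1) → Fin 4) → Fin 4} (hg : IsLatin g)
    {a b : Fin 4} (hab : a ≠ b) (h : pairList g a b = pairList f a b) (y : Fin (d + 1) → Fin 4) :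
    SamePair f g 0 a b y := by
  have h1 : ∀ v, (g (Fin.cons a (Fin.tail y)) = v ∨ g (Fin.cons b (Fin.tail y)) = v) ↔
      (f (Fin.cons a (Fin.tail y)) = v ∨ f (Fin.cons b (Fin.tail y)) = v) := by
    intro v
    have := congrFun (congrFun h (Fin.tail y)) v
    simpa only [pairList, decide_eq_decide] using this
  have h2 : ∀ c, update y 0 c = Fin.cons c (Fin.tail y) := by
    intro c
    conv_lhs => rw [← Fin.cons_self_tail y]
    rw [Fin.update_cons_zero]
  have h3 : g (Fin.cons a (Fin.tail y)) ≠ g (Fin.cons b (Fin.tail y)) :=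
    fun h => hab (hg.injective_cons _ h)
  simp only [SamePair, h2]
  have ha := (h1 (g (Fin.cons a (Fin.tail y)))).1 (Or.inl rfl)
  have hb := (h1 (g (Fin.cons b (Fin.tail y)))).1 (Or.inr rfl)
  rcases ha with ha | ha <;> rcases hb with hb | hb
  · exact (h3 (ha.symm.trans hb)).elim
  · exact Or.inl ⟨ha.symm, hb.symm⟩
  · exact Or.inr ⟨ha.symm, hb.symm⟩
  · exact (h3 (ha.symm.trans hb)).elim

lemma card_le_card_mul_card_image {α β γ : Type*} [DecidableEq β] [DecidableEq γ] (s : Finset α)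
    (r : α → β) (t : α → γ) (h : ∀ x ∈ s, ∀ y ∈ s, r x = r y → t x = t y → x = y) :
    s.card ≤ (s.image r).card * (s.image t).card := by
  rw [← Finset.card_product]
  refine Finset.card_le_card_of_injOn (fun x => (r x, t x)) ?_ ?_
  · intro x hx
    exact Finset.mem_coe.2 (Finset.mem_product.2
      ⟨Finset.mem_image_of_mem _ hx, Finset.mem_image_of_mem _ hx⟩)
  · intro x hx y hy hxy
    exact h x hx y hy (Prod.ext_iff.1 hxy).1 (Prod.ext_iff.1 hxy).2

lemma card_image_pair_le {f : (Fin (d + 1) → Fin 4) → Fin 4} (hf : IsLatin f) {a b : Fin 4}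
    (𝒢 : Finset ((Fin (d + 1) → Fin 4) → Fin 4))
    (h𝒢 : ∀ g ∈ 𝒢, IsLatin g ∧ ∀ y, SamePair f g 0 a b y) :
    (𝒢.image fun g => fun y : Fin d → Fin 4 =>
      (g (Fin.cons a y), g (Fin.cons b y))).card ≤ 2 ^ topLoss f a b := by
  refine card_image_le_two_pow_compCount hf {y | y 0 = 0} 𝒢
    (fun g hg => ⟨(h𝒢 g hg).1, fun y _ => (h𝒢 g hg).2 y⟩) _ ?_
  intro g _ g' _ h
  funext y
  have := h (Fin.cons 0 y) rfl
  simp only [Fin.update_cons_zero] at this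
  exact Prod.ext this.1 this.2

/-- The pairs at `a`, `b` fix the complementary pairs too. Ordering each of the two families costs
at most 2^d bits. -/
lemma card_latin_of_pairList_le {a b : Fin 4} (hab : a ≠ b)
    (L : (Fin d → Fin 4) → Fin 4 → Bool) :
    {f ∈ latinSet (d + 1) | pairList f a b = L}.ncard ≤ 2 ^ 2 ^ (d + 1) := by
  classical
  rcases Set.eq_empty_or_nonempty {f ∈ latinSet (d + 1) | pairList f a b = L} with h | ⟨f, hf, hL⟩
  · rw [h]; simp
  obtain ⟨c, e, hce, hac, hae, hbc, hbe, hcov⟩ := exists_complementary_pair a b hab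
  rw [Set.ncard_eq_toFinset_card']
  set 𝒢 := {f ∈ latinSet (d + 1) | pairList f a b = L}.toFinset
  have h𝒢 : ∀ g ∈ 𝒢, IsLatin g ∧ ∀ y, SamePair f g 0 a b y := by
    intro g hg
    obtain ⟨hg1, hg2⟩ := Set.mem_toFinset.1 hg
    exact ⟨hg1, samePair_of_pairList_eq hg1 hab (hg2.trans hL.symm)⟩
  have h1 := card_image_pair_le hf 𝒢 h𝒢
  have h2 := card_image_pair_le hf (a := c) (b := e) 𝒢 fun g hg => ⟨(h𝒢 g hg).1, fun y =>
    SamePair.compl hf (h𝒢 g hg).1 hcov hce hac hae hbc hbe ((h𝒢 g hg).2 y)⟩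
  refine (card_le_card_mul_card_image 𝒢 (fun g => fun y : Fin d → Fin 4 =>
      (g (Fin.cons a y), g (Fin.cons b y))) (fun g => fun y : Fin d → Fin 4 =>
      (g (Fin.cons c y), g (Fin.cons e y))) ?_).trans ?_
  · intro g _ g' _ hr ht
    funext z
    obtain ⟨u, x, rfl⟩ := exists_cons_eq z
    have hr := Prod.ext_iff.1 (congrFun hr x)
    have ht := Prod.ext_iff.1 (congrFun ht x)
    rcases hcov u with rfl | rfl | rfl | rfl
    · exact hr.1
    · exact hr.2
    · exact ht.1
    · exact ht.2
  · calc _ ≤ 2 ^ 2 ^ d * 2 ^ 2 ^ d := Nat.mul_le_mul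
          (h1.trans (Nat.pow_le_pow_right (by norm_num) (topLoss_le hf hab)))
          (h2.trans (Nat.pow_le_pow_right (by norm_num) (topLoss_le hf hce)))
      _ = _ := by rw [← pow_add]; congr 1; ring

/-- Some link graph of the first coordinate has many components. -/
def IsNice (s : ℕ) (f : (Fin (d + 1) → Fin 4) → Fin 4) : Prop :=
  ∃ a b : Fin 4, a ≠ b ∧ 2 ^ d ≤ s * topLoss f a b

lemma ncard_nice_le (s : ℕ) : {f ∈ latinSet (d + 1) | IsNice s f}.ncard ≤
    12 * ((listPairs d (2 * s)).ncard * 2 ^ 2 ^ (d + 1)) := by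
  classical
  have hsub : {f ∈ latinSet (d + 1) | IsNice s f} ⊆ ⋃ q : DistinctPair,
      ⋃ p : listPairs d (2 * s), {f ∈ latinSet (d + 1) | pairList f q.1.1 q.1.2 = p.1.1} := by
    rintro f ⟨hf, a, b, hab, h⟩
    obtain ⟨K, hK⟩ := exists_mem_listPairs hf hab h
    exact Set.mem_iUnion.2 ⟨⟨(a, b), hab⟩, Set.mem_iUnion.2 ⟨⟨_, hK⟩, hf, rfl⟩⟩
  refine (Set.ncard_le_ncard hsub (Set.toFinite _)).trans ?_
  refine (Set.ncard_iUnion_le_of_fintype _).trans ?_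
  have hP : Fintype.card DistinctPair = 12 := by decide
  calc _ ≤ ∑ q : DistinctPair, ((listPairs d (2 * s)).ncard * 2 ^ 2 ^ (d + 1)) := by
        refine Finset.sum_le_sum fun q _ => ?_
        have : Fintype (listPairs d (2 * s)) := Fintype.ofFinite _
        refine (Set.ncard_iUnion_le_of_fintype _).trans ?_
        refine (Finset.sum_le_sum fun p _ => card_latin_of_pairList_le q.2 p.1.1).trans ?_
        rw [Finset.sum_const, smul_eq_mul, Finset.card_univ, ← Nat.card_eq_fintype_card]
        rfl
    _ = _ := by rw [Finset.sum_const, smul_eq_mul, Finset.card_univ, hP]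

/-- Two slices give the complementary pairs for the other two, and the link graph that governs their
order has few components because the function is not nice. -/
lemma ncard_not_nice_of_slices_le {s : ℕ} (hs : s ≠ 0) {a b : Fin 4} (hab : a ≠ b)
    (g h : (Fin d → Fin 4) → Fin 4) :
    {f ∈ latinSet (d + 1) | ¬IsNice s f ∧ (fun y => f (Fin.cons a y)) = g ∧
      (fun y => f (Fin.cons b y)) = h}.ncard ≤ 2 ^ (2 ^ d / s) := by
  classical
  rcases Set.eq_empty_or_nonempty {f ∈ latinSet (d + 1) | ¬IsNice s f ∧
    (fun y => f (Fin.cons a y)) = g ∧ (fun y => f (Fin.cons b y)) = h} with h0 |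
    ⟨f, hf, hnice, hfa, hfb⟩
  · rw [h0]; simp
  obtain ⟨c, e, hce, hac, hae, hbc, hbe, hcov⟩ := exists_complementary_pair a b hab
  rw [Set.ncard_eq_toFinset_card']
  set 𝒢 := {f ∈ latinSet (d + 1) | ¬IsNice s f ∧ (fun y => f (Fin.cons a y)) = g ∧
      (fun y => f (Fin.cons b y)) = h}.toFinset
  have h𝒢 : ∀ g' ∈ 𝒢, IsLatin g' ∧ (∀ y, g' (Fin.cons a y) = f (Fin.cons a y)) ∧
      ∀ y, g' (Fin.cons b y) = f (Fin.cons b y) := by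
    intro g' hg'
    obtain ⟨hg1, -, hg2, hg3⟩ := Set.mem_toFinset.1 hg'
    exact ⟨hg1, congrFun (hg2.trans hfa.symm), congrFun (hg3.trans hfb.symm)⟩
  have h2 := card_image_pair_le hf (a := c) (b := e) 𝒢 fun g' hg' => ⟨(h𝒢 g' hg').1, fun y =>
    SamePair.compl hf (h𝒢 g' hg').1 hcov hce hac hae hbc hbe (samePair_of_pairList_eq
      (h𝒢 g' hg').1 hab (by
        funext y v
        simp only [pairList, (h𝒢 g' hg').2.1, (h𝒢 g' hg').2.2]) y)⟩
  have h3 : topLoss f c e ≤ 2 ^ d / s := by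
    rw [Nat.le_div_iff_mul_le (by omega)]
    by_contra hcon
    exact hnice ⟨c, e, hce, by rw [mul_comm]; omega⟩
  refine le_trans ?_ (h2.trans (Nat.pow_le_pow_right (by norm_num) h3))
  rw [Finset.card_image_of_injOn]
  intro g₁ hg₁ g₂ hg₂ hr
  have h1 := h𝒢 g₁ hg₁
  have h2 := h𝒢 g₂ hg₂
  funext z
  obtain ⟨u, x, rfl⟩ := exists_cons_eq z
  have hr := Prod.ext_iff.1 (congrFun hr x)
  rcases hcov u with rfl | rfl | rfl | rfl
  · rw [h1.2.1, h2.2.1]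
  · rw [h1.2.2, h2.2.2]
  · exact hr.1
  · exact hr.2

/-- No iterated slice at the top `T` levels is nice. -/
def IsBad (s : ℕ) : ℕ → ∀ d : ℕ, ((Fin d → Fin 4) → Fin 4) → Prop
  | 0, _, _ => True
  | _ + 1, 0, _ => True
  | T + 1, d + 1, f => ¬IsNice s f ∧ ∀ c, IsBad s T d fun y => f (Fin.cons c y)

/-- The number of Latin functions that are nice at some of the top `T` levels. -/
noncomputable def notBadCount (s T d : ℕ) : ℕ := {f ∈ latinSet d | ¬IsBad s T d f}.ncard

lemma notBadCount_zero (s d : ℕ) : notBadCount s 0 d = 0 := by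
  simp [notBadCount, IsBad]

/-- Either the function itself is nice, or one of its four slices is not bad one level down. In the
second case a further arbitrary slice determines it up to 2^d/s bits. -/
lemma notBadCount_succ_le {s : ℕ} (hs : s ≠ 0) (T d : ℕ) : notBadCount s (T + 1) (d + 1) ≤
    12 * ((listPairs d (2 * s)).ncard * 2 ^ 2 ^ (d + 1)) +
      4 * (notBadCount s T d * (latinSet d).ncard * 2 ^ (2 ^ d / s)) := by
  classical
  have hsub : {f ∈ latinSet (d + 1) | ¬IsBad s (T + 1) (d + 1) f} ⊆
      {f ∈ latinSet (d + 1) | IsNice s f} ∪ ⋃ a : Fin 4,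
        ⋃ p : ({f ∈ latinSet d | ¬IsBad s T d f} ×ˢ latinSet d : Set _),
          {f ∈ latinSet (d + 1) | ¬IsNice s f ∧ (fun y => f (Fin.cons a y)) = p.1.1 ∧
            (fun y => f (Fin.cons (a + 1) y)) = p.1.2} := by
    rintro f ⟨hf, hbad⟩
    by_cases hn : IsNice s f
    · exact Or.inl ⟨hf, hn⟩
    · right
      simp only [IsBad, not_and, not_forall] at hbad
      obtain ⟨a, ha⟩ := hbad hn
      exact Set.mem_iUnion.2 ⟨a, Set.mem_iUnion.2 ⟨⟨(fun y => f (Fin.cons a y),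
        fun y => f (Fin.cons (a + 1) y)), ⟨IsLatin.cons hf a, ha⟩, IsLatin.cons hf (a + 1)⟩,
        hf, hn, rfl, rfl⟩⟩
  refine (Set.ncard_le_ncard hsub (Set.toFinite _)).trans ?_
  refine (Set.ncard_union_le _ _).trans (Nat.add_le_add (ncard_nice_le s) ?_)
  refine (Set.ncard_iUnion_le_of_fintype _).trans ?_
  calc _ ≤ ∑ a : Fin 4, (notBadCount s T d * (latinSet d).ncard * 2 ^ (2 ^ d / s)) := by
        refine Finset.sum_le_sum fun a _ => ?_
        have : Fintype ({f ∈ latinSet d | ¬IsBad s T d f} ×ˢ latinSet d : Set _) :=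
          Fintype.ofFinite _
        refine (Set.ncard_iUnion_le_of_fintype _).trans ?_
        -- Addition is modulo four; the second slice only has to differ from the first.
        have ha : a ≠ a + 1 := by revert a; decide
        refine (Finset.sum_le_sum fun p _ =>
          ncard_not_nice_of_slices_le hs ha p.1.1 p.1.2).trans ?_
        rw [Finset.sum_const, smul_eq_mul, Finset.card_univ, ← Nat.card_eq_fintype_card,
          notBadCount, ← Set.ncard_prod]
        rfl
    _ = _ := by simp

/-- A later stage costs at most the sum of the costs in two slices, which are bad one level down. At
the first coordinate the bound is the failure of niceness. -/
lemma IsBad.stageLoss_le {s T d : ℕ} {f : (Fin d → Fin 4) → Fin 4} (hf : IsBad s T d f)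
    (Q : Fin d → DistinctPair) (t : Fin d) (ht : (t : ℕ) < T) :
    2 * (s * stageLoss f Q t) ≤ 2 ^ d := by
  induction d generalizing T with
  | zero => exact t.elim0
  | succ d ih =>
    obtain _ | T := T
    · omega
    obtain ⟨hn, hb⟩ := hf
    refine Fin.cases (fun _ => ?_) (fun t ht => ?_) t ht
    · rw [stageLoss_zero]
      by_contra hcon
      refine hn ⟨(Q 0).1.1, (Q 0).1.2, (Q 0).2, ?_⟩
      rw [pow_succ] at hcon
      omega
    · have h1 : stageLoss f Q t.succ ≤
          stageLoss (fun y => f (Fin.cons (Q 0).1.1 y)) (Fin.tail Q) t +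
          stageLoss (fun y => f (Fin.cons (Q 0).1.2 y)) (Fin.tail Q) t := by
        rw [stageLoss, stageRegion_succ]
        refine (compCount_union_le _ _ _).trans (Nat.add_le_add ?_ ?_) <;>
        exact compCount_stageSlice_le f _ _ _ t _
      have h2 := ih (hb (Q 0).1.1) (Fin.tail Q) t (by simpa using ht)
      have h3 := ih (hb (Q 0).1.2) (Fin.tail Q) t (by simpa using ht)
      have h4 := Nat.mul_le_mul_left s h1
      rw [mul_add] at h4
      rw [pow_succ]
      omega

end Nice

/-! ### Bootstrapping the exponent. -/

section Asymptotics

open Function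

lemma sum_fin_le_of_geometric {d T : ℕ} {A B r : ℝ} (hA : 0 ≤ A) (hB : 0 ≤ B) (hr0 : 0 ≤ r)
    (hr1 : r < 1) (g : Fin d → ℝ) (h1 : ∀ t : Fin d, (t : ℕ) < T → g t ≤ A)
    (h2 : ∀ t : Fin d, g t ≤ B * r ^ (t : ℕ)) : ∑ t, g t ≤ T * A + B * (r ^ T / (1 - r)) := by
  have h3 : ∑ t, g t ≤ ∑ t : Fin d, ((if (t : ℕ) < T then A else 0) +
      if T ≤ (t : ℕ) then B * r ^ (t : ℕ) else 0) := by
    refine Finset.sum_le_sum fun t _ => ?_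
    by_cases ht : (t : ℕ) < T
    · simpa [ht, not_le.2 ht] using h1 t ht
    · simpa [ht, not_lt.1 ht] using h2 t
  refine h3.trans ?_
  rw [Finset.sum_add_distrib, Fin.sum_univ_eq_sum_range (fun t => if t < T then A else 0),
    Fin.sum_univ_eq_sum_range (fun t => if T ≤ t then B * r ^ t else 0)]
  refine add_le_add ?_ ?_
  · rw [← Finset.sum_filter, Finset.sum_const, nsmul_eq_mul]
    refine mul_le_mul_of_nonneg_right ?_ hA
    have : ((Finset.range d).filter fun t => t < T) ⊆ Finset.range T := by
      intro t ht
      simpa using (Finset.mem_filter.1 ht).2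
    have := Finset.card_le_card this
    rw [Finset.card_range] at this
    exact_mod_cast this
  · rw [← Finset.sum_filter, ← Finset.mul_sum]
    refine mul_le_mul_of_nonneg_left ?_ hB
    refine le_trans (le_of_eq ?_) (geom_sum_Ico_le_of_lt_one (m := T) (n := d) hr0 hr1)
    refine Finset.sum_congr ?_ fun _ _ => rfl
    ext t
    simp only [Finset.mem_filter, Finset.mem_range, Finset.mem_Ico]
    tauto

/-- Average over `Q`: each stage before T costs at most 2^d/(2s) for every `Q`, and the later stages
form a geometric tail with mean at most 3(5/6)^T 2^d. -/
lemma exists_sum_stageLoss_le {d s T Λ : ℕ} (hs : s ≠ 0) {f : (Fin d → Fin 4) → Fin 4}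
    (hf : IsLatin f) (hbad : IsBad s T d f)
    (hΛ : (2 : ℝ) ^ d * (T / (2 * s) + 3 * (5 / 6) ^ T) ≤ Λ) :
    ∃ Q : Fin d → DistinctPair, ∑ t, stageLoss f Q t ≤ Λ := by
  by_contra hcon
  push Not at hcon
  have hs' : (0 : ℝ) < s := by positivity
  have hP : Fintype.card DistinctPair = 12 := by decide
  have h1 : ∑ Q : Fin d → DistinctPair, (Λ : ℝ) <
      ∑ Q : Fin d → DistinctPair, ∑ t, (stageLoss f Q t : ℝ) := by
    refine Finset.sum_lt_sum_of_nonempty ⟨fun _ => ⟨(0, 1), by decide⟩, Finset.mem_univ _⟩ ?_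
    intro Q _
    exact_mod_cast hcon Q
  rw [Finset.sum_comm, Finset.sum_const, Finset.card_univ, Fintype.card_fun, hP, Fintype.card_fin,
    nsmul_eq_mul] at h1
  push_cast at h1
  have h2 := sum_fin_le_of_geometric (A := 12 ^ d * (2 ^ d / (2 * s))) (B := 12 ^ d * 2 ^ d / 2)
    (r := 5 / 6) (T := T) (by positivity) (by positivity) (by norm_num) (by norm_num)
    (fun t : Fin d => ∑ Q : Fin d → DistinctPair, (stageLoss f Q t : ℝ)) ?_ ?_
  · have h3 : (T : ℝ) * (12 ^ d * (2 ^ d / (2 * s))) +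
        12 ^ d * 2 ^ d / 2 * ((5 / 6) ^ T / (1 - 5 / 6)) =
        12 ^ d * ((2 : ℝ) ^ d * (T / (2 * s) + 3 * (5 / 6) ^ T)) := by ring
    rw [h3] at h2
    have h4 := mul_le_mul_of_nonneg_left hΛ (by positivity : (0 : ℝ) ≤ 12 ^ d)
    linarith
  · intro t ht
    have h3 : ∑ Q : Fin d → DistinctPair, (stageLoss f Q t : ℝ) ≤
        ∑ Q : Fin d → DistinctPair, (2 : ℝ) ^ d / (2 * s) := by
      refine Finset.sum_le_sum fun Q _ => ?_
      rw [le_div_iff₀ (by positivity)]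
      have := hbad.stageLoss_le Q t ht
      have h4 : (2 : ℝ) * (s * stageLoss f Q t) ≤ 2 ^ d := by exact_mod_cast this
      linarith
    rw [Finset.sum_const, Finset.card_univ, Fintype.card_fun, hP, Fintype.card_fin,
      nsmul_eq_mul] at h3
    push_cast at h3
    exact h3
  · intro t
    have h3 := sum_stageLoss_le hf t
    have h4 : (2 : ℝ) * ∑ Q : Fin d → DistinctPair, (stageLoss f Q t : ℝ) * 6 ^ (t : ℕ) ≤
        12 ^ d * 2 ^ d * 5 ^ (t : ℕ) := by exact_mod_cast h3
    rw [← Finset.sum_mul] at h4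
    have h5 : (0 : ℝ) < 6 ^ (t : ℕ) := by positivity
    rw [div_pow, mul_div_assoc', le_div_iff₀ h5]
    linarith

lemma ncard_bad_le {d s T Λ : ℕ} (hs : s ≠ 0)
    (hΛ : (2 : ℝ) ^ d * (T / (2 * s) + 3 * (5 / 6) ^ T) ≤ Λ) :
    {f ∈ latinSet d | IsBad s T d f}.ncard ≤
      12 ^ d * ((Λ + 1) ^ d * (2 ^ Λ * cubeColoringCount d)) := by
  classical
  have hP : Fintype.card DistinctPair = 12 := by decide
  have hsub : {f ∈ latinSet d | IsBad s T d f} ⊆ ⋃ Q : Fin d → DistinctPair,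
      {f ∈ latinSet d | ∑ t, stageLoss f Q t ≤ Λ} := by
    rintro f ⟨hf, hb⟩
    obtain ⟨Q, hQ⟩ := exists_sum_stageLoss_le hs hf hb hΛ
    exact Set.mem_iUnion.2 ⟨Q, hf, hQ⟩
  refine (Set.ncard_le_ncard hsub (Set.toFinite _)).trans ?_
  refine (Set.ncard_iUnion_le_of_fintype _).trans ?_
  calc _ ≤ ∑ Q : Fin d → DistinctPair, ((Λ + 1) ^ d * (2 ^ Λ * cubeColoringCount d)) := by
        refine Finset.sum_le_sum fun Q _ => ?_
        rw [Set.ncard_eq_toFinset_card']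
        refine card_le_of_sum_stageLoss_le Q Λ _ (fun f hf => ?_) fun f hf => ?_
        · exact (Set.mem_toFinset.1 hf).1
        · exact (Set.mem_toFinset.1 hf).2
    _ = _ := by
        rw [Finset.sum_const, smul_eq_mul, Finset.card_univ, Fintype.card_fun, hP, Fintype.card_fin]

/-- `a d ≤ 2 ^ (C * 2 ^ d)` for all large `d`. -/
def DoubleExpBound (a : ℕ → ℕ) (C : ℝ) : Prop :=
  ∀ᶠ d in atTop, (a d : ℝ) ≤ (2 : ℝ) ^ (C * 2 ^ d)

lemma tendsto_poly_div_two_pow (A B C : ℝ) :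
    Tendsto (fun d : ℕ => (A * d ^ 2 + B * d + C) / (2 : ℝ) ^ d) atTop (𝓝 0) := by
  have h2 := (tendsto_pow_const_div_const_pow_of_one_lt 2 (by norm_num : (1 : ℝ) < 2)).const_mul A
  have h1 := (tendsto_pow_const_div_const_pow_of_one_lt 1 (by norm_num : (1 : ℝ) < 2)).const_mul B
  have h0 := (tendsto_pow_const_div_const_pow_of_one_lt 0 (by norm_num : (1 : ℝ) < 2)).const_mul C
  have h := (h2.add h1).add h0
  simp only [mul_zero, add_zero] at h
  refine h.congr fun d => ?_
  simp only [pow_one, pow_zero]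
  ring

lemma eventually_poly_le (A B C : ℝ) {η : ℝ} (hη : 0 < η) :
    ∀ᶠ d : ℕ in atTop, A * d ^ 2 + B * d + C ≤ η * 2 ^ d := by
  filter_upwards [(tendsto_poly_div_two_pow A B C).eventually_le_const hη] with d hd
  rwa [div_le_iff₀ (by positivity)] at hd

lemma doubleExpBound_bad {s : ℕ} (hs : s ≠ 0) (T : ℕ) {C : ℝ}
    (hC : 1 + (T / (2 * s) + 3 * (5 / 6) ^ T) < C) :
    DoubleExpBound (fun d => {f ∈ latinSet d | IsBad s T d f}.ncard) C := by
  set β : ℝ := T / (2 * s) + 3 * (5 / 6) ^ T with hβ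
  have hβ0 : 0 ≤ β := by positivity
  have hβT : β ≤ T + 3 := by
    have h1 : (1 : ℝ) ≤ s := by exact_mod_cast Nat.one_le_iff_ne_zero.2 hs
    have h2 : (T : ℝ) / (2 * s) ≤ T := div_le_self (by positivity) (by linarith)
    have h3 : (5 / 6 : ℝ) ^ T ≤ 1 := pow_le_one₀ (by norm_num) (by norm_num)
    linarith
  -- One half of the slack absorbs the error term of the cube count, the other the factors 12^d and
  -- (Λ+1)^d, whose logarithms are quadratic in d.
  set η := (C - (1 + β)) / 2 with hη
  have hηpos : 0 < η := by rw [hη]; linarith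
  have hd2 : ∀ᶠ d : ℕ in atTop, 2 / η ≤ (d : ℝ) :=
    tendsto_natCast_atTop_atTop.eventually_ge_atTop _
  filter_upwards [eventually_poly_le 1 (T + 9) 1 hηpos, hd2, eventually_ge_atTop 1]
    with d hpoly hd hd1
  obtain ⟨e, rfl⟩ : ∃ e, d = e + 1 := ⟨d - 1, by omega⟩
  set d := e + 1 with hde
  have hdpos : (0 : ℝ) < d := by positivity
  set Λ := ⌈(2 : ℝ) ^ d * β⌉₊ with hΛ
  have hΛ1 : (2 : ℝ) ^ d * β ≤ Λ := Nat.le_ceil _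
  have hΛ2 : (Λ : ℝ) ≤ 2 ^ d * β + 1 := (Nat.ceil_lt_add_one (by positivity)).le
  have h1 := ncard_bad_le hs hΛ1
  have h2 : ({f ∈ latinSet d | IsBad s T d f}.ncard : ℝ) ≤
      12 ^ d * ((Λ + 1) ^ d * (2 ^ Λ * cubeColoringCount d)) := by exact_mod_cast h1
  refine h2.trans ?_
  have hcube := cubeColoringCount_le (d := e)
  have hΛ3 : (Λ : ℝ) + 1 ≤ (2 : ℝ) ^ (d + T + 5) := by
    have h3 : (T : ℝ) + 5 ≤ 2 ^ (T + 5) := by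
      have := (Nat.lt_two_pow_self (n := T + 5)).le
      exact_mod_cast this
    have h4 : (1 : ℝ) ≤ 2 ^ d := one_le_pow₀ (by norm_num)
    calc (Λ : ℝ) + 1 ≤ 2 ^ d * (T + 5) := by nlinarith
      _ ≤ 2 ^ d * 2 ^ (T + 5) := by gcongr
      _ = _ := by rw [← pow_add]; congr 1
  have e1 : (12 : ℝ) ^ d ≤ (2 : ℝ) ^ (4 * (d : ℝ)) := by
    rw [Real.rpow_mul (by norm_num), Real.rpow_natCast]
    exact pow_le_pow_left₀ (by norm_num) (by norm_num) _
  have e2 : ((Λ : ℝ) + 1) ^ d ≤ (2 : ℝ) ^ (((d : ℝ) + T + 5) * d) := by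
    rw [Real.rpow_mul (by norm_num), Real.rpow_natCast]
    refine pow_le_pow_left₀ (by positivity) ?_ _
    refine hΛ3.trans (le_of_eq ?_)
    rw [← Real.rpow_natCast]
    push_cast
    rfl
  have e3 : (2 : ℝ) ^ Λ ≤ (2 : ℝ) ^ ((2 : ℝ) ^ d * β + 1) := by
    rw [← Real.rpow_natCast]
    exact Real.rpow_le_rpow_of_exponent_le (by norm_num) hΛ2
  have e4 : (cubeColoringCount d : ℝ) ≤ (2 : ℝ) ^ ((2 : ℝ) ^ d + η * 2 ^ d) := by
    refine hcube.trans (Real.rpow_le_rpow_of_exponent_le (by norm_num) ?_)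
    have : (2 : ℝ) ^ (e + 2) / (e + 1) ≤ η * 2 ^ d := by
      rw [div_le_iff₀ (by positivity)]
      rw [div_le_iff₀ hηpos] at hd
      have h5 : (d : ℝ) = e + 1 := by rw [hde]; push_cast; rfl
      rw [← h5, pow_succ (2 : ℝ) (e + 1)]
      have h6 : (0 : ℝ) < 2 ^ d := by positivity
      nlinarith
    linarith
  calc (12 : ℝ) ^ d * ((Λ + 1) ^ d * (2 ^ Λ * cubeColoringCount d))
      ≤ (2 : ℝ) ^ (4 * (d : ℝ)) * ((2 : ℝ) ^ (((d : ℝ) + T + 5) * d) *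
        ((2 : ℝ) ^ ((2 : ℝ) ^ d * β + 1) * (2 : ℝ) ^ ((2 : ℝ) ^ d + η * 2 ^ d))) := by
        gcongr
    _ = (2 : ℝ) ^ (4 * (d : ℝ) + (((d : ℝ) + T + 5) * d + (((2 : ℝ) ^ d * β + 1) +
        ((2 : ℝ) ^ d + η * 2 ^ d)))) := by
        simp only [← Real.rpow_add (by norm_num : (0 : ℝ) < 2)]
    _ ≤ _ := by
        refine Real.rpow_le_rpow_of_exponent_le (by norm_num) ?_
        have h6 : C = 1 + β + 2 * η := by rw [hη]; ring
        rw [h6]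
        nlinarith

lemma add_le_two_rpow {x y z : ℝ} {a b : ℝ} (ha : a ≤ (2 : ℝ) ^ x) (hb : b ≤ (2 : ℝ) ^ y)
    (hx : x + 1 ≤ z) (hy : y + 1 ≤ z) : a + b ≤ (2 : ℝ) ^ z := by
  have h1 : (2 : ℝ) ^ x ≤ 2 ^ (z - 1) :=
    Real.rpow_le_rpow_of_exponent_le (by norm_num) (by linarith)
  have h2 : (2 : ℝ) ^ y ≤ 2 ^ (z - 1) :=
    Real.rpow_le_rpow_of_exponent_le (by norm_num) (by linarith)
  have h3 : (2 : ℝ) ^ z = 2 ^ (z - 1) * 2 := by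
    rw [Real.rpow_sub_one (by norm_num)]
    ring
  linarith

/-- The new exponent must exceed 1 for the nice functions. For the pairs of slices it must exceed (c
+ C + 1/s)/2, halved because the exponents refer to 2^d in one dimension less. -/
lemma doubleExpBound_notBad_succ {s : ℕ} (hs : s ≠ 0) (T : ℕ) {c C c' : ℝ} (h1 : 1 < c')
    (h2 : c + C + 1 / s < 2 * c') (hT : DoubleExpBound (notBadCount s T) c)
    (hC : DoubleExpBound (fun d => (latinSet d).ncard) C) :
    DoubleExpBound (notBadCount s (T + 1)) c' := by
  obtain ⟨E, hE⟩ := exists_ncard_listPairs_le (2 * s)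
  unfold DoubleExpBound
  rw [← map_add_atTop_eq_nat 1, eventually_map]
  filter_upwards [hT, hC, eventually_poly_le 0 E (E + 5) (sub_pos.2 h1),
    eventually_poly_le 0 0 3 (sub_pos.2 h2)] with d hTd hCd hp1 hp2
  have hrec : (notBadCount s (T + 1) (d + 1) : ℝ) ≤
      12 * ((listPairs d (2 * s)).ncard * 2 ^ 2 ^ (d + 1)) +
      4 * (notBadCount s T d * (latinSet d).ncard * 2 ^ (2 ^ d / s)) := by
    exact_mod_cast notBadCount_succ_le hs T d
  refine hrec.trans ?_
  have hs' : (0 : ℝ) < s := by positivity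
  have hpos : (0 : ℝ) < 2 ^ d := by positivity
  have a1 : (12 : ℝ) * ((listPairs d (2 * s)).ncard * 2 ^ 2 ^ (d + 1)) ≤
      (2 : ℝ) ^ (4 + ((E : ℝ) * (d + 1) + 2 ^ (d + 1))) := by
    rw [Real.rpow_add (by norm_num), Real.rpow_add (by norm_num)]
    have b1 : ((listPairs d (2 * s)).ncard : ℝ) ≤ (2 : ℝ) ^ ((E : ℝ) * (d + 1)) := by
      have : ((listPairs d (2 * s)).ncard : ℝ) ≤ 2 ^ (E * (d + 1)) := by exact_mod_cast hE d
      rw [← Real.rpow_natCast] at this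
      push_cast at this
      exact this
    have b2 : (2 : ℝ) ^ 2 ^ (d + 1) = (2 : ℝ) ^ ((2 : ℝ) ^ (d + 1)) := by
      rw [← Real.rpow_natCast]
      push_cast
      rfl
    rw [b2]
    gcongr
    norm_num
  have a2 : (4 : ℝ) * (notBadCount s T d * (latinSet d).ncard * 2 ^ (2 ^ d / s)) ≤
      (2 : ℝ) ^ (2 + (c * 2 ^ d + C * 2 ^ d + 1 / s * 2 ^ d)) := by
    rw [Real.rpow_add (by norm_num), Real.rpow_add (by norm_num), Real.rpow_add (by norm_num)]
    have b2 : (2 : ℝ) ^ (2 ^ d / s) ≤ (2 : ℝ) ^ (1 / (s : ℝ) * 2 ^ d) := by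
      rw [← Real.rpow_natCast]
      refine Real.rpow_le_rpow_of_exponent_le (by norm_num) ?_
      refine (Nat.cast_div_le).trans (le_of_eq ?_)
      push_cast
      ring
    gcongr
    norm_num
  refine add_le_two_rpow a1 a2 ?_ ?_
  · rw [pow_succ]
    nlinarith
  · rw [pow_succ]
    nlinarith

/-- The iteration c ↦ (c + C)/2 started at 1 reaches C - (C-1)/2^T; the term 2/s dominates the
accumulated errors 1/s. -/
lemma doubleExpBound_notBad {s : ℕ} (hs : s ≠ 0) (T : ℕ) {C : ℝ} (h1 : 1 ≤ C)
    (hC : DoubleExpBound (fun d => (latinSet d).ncard) C) :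
    DoubleExpBound (notBadCount s T) (C - (C - 1) * (1 / 2) ^ T + 2 / s) := by
  have hs' : (0 : ℝ) < 1 / s := by positivity
  have h2 : (2 : ℝ) / s = 2 * (1 / s) := by ring
  rw [h2]
  induction T with
  | zero =>
    refine Eventually.of_forall fun d => ?_
    rw [notBadCount_zero]
    push_cast
    positivity
  | succ T ih =>
    refine doubleExpBound_notBad_succ hs T ?_ ?_ ih hC
    · have : (1 / 2 : ℝ) ^ (T + 1) ≤ 1 := pow_le_one₀ (by norm_num) (by norm_num)
      nlinarith
    · rw [pow_succ]
      linarith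

lemma DoubleExpBound.of_add {a b c : ℕ → ℕ} {A B C : ℝ} (ha : DoubleExpBound a A)
    (hb : DoubleExpBound b B) (hc : ∀ d, c d ≤ a d + b d) (hA : A < C) (hB : B < C) :
    DoubleExpBound c C := by
  filter_upwards [ha, hb, eventually_poly_le 0 0 1 (sub_pos.2 hA),
    eventually_poly_le 0 0 1 (sub_pos.2 hB)] with d had hbd h1 h2
  have : (c d : ℝ) ≤ a d + b d := by exact_mod_cast hc d
  refine this.trans (add_le_two_rpow had hbd ?_ ?_) <;> linarith

lemma ncard_latinSet_le (s T d : ℕ) : (latinSet d).ncard ≤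
    {f ∈ latinSet d | IsBad s T d f}.ncard + notBadCount s T d := by
  refine le_trans (Set.ncard_le_ncard ?_ (Set.toFinite _)) (Set.ncard_union_le _ _)
  intro f hf
  by_cases h : IsBad s T d f
  · exact Or.inl ⟨hf, h⟩
  · exact Or.inr ⟨hf, h⟩

lemma doubleExpBound_latin_step {s : ℕ} (hs : s ≠ 0) (T : ℕ) {C C' : ℝ} (h1 : 1 ≤ C)
    (hC : DoubleExpBound (fun d => (latinSet d).ncard) C)
    (h2 : 1 + (T / (2 * s) + 3 * (5 / 6) ^ T) + 1 / s < C')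
    (h3 : C - (C - 1) * (1 / 2) ^ T + 2 / s < C') :
    DoubleExpBound (fun d => (latinSet d).ncard) C' := by
  have hs' : (0 : ℝ) < 1 / s := by positivity
  exact (doubleExpBound_bad hs T (lt_add_of_pos_right _ hs')).of_add (doubleExpBound_notBad hs T h1 hC)
    (ncard_latinSet_le s T) h2 h3

/-- The number of Latin functions of `d` variables is at most `2 ^ ((1 + o(1)) 2 ^ d)`. -/
theorem doubleExpBound_latin {C : ℝ} (hC : 1 < C) :
    DoubleExpBound (fun d => (latinSet d).ncard) C := by
  have mono : ∀ {C C' : ℝ}, C ≤ C' → DoubleExpBound (fun d => (latinSet d).ncard) C →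
      DoubleExpBound (fun d => (latinSet d).ncard) C' := by
    intro C C' h hC
    filter_upwards [hC] with d hd
    refine hd.trans (Real.rpow_le_rpow_of_exponent_le (by norm_num) ?_)
    gcongr
  let S : Set ℝ := {C | 1 ≤ C ∧ DoubleExpBound (fun d => (latinSet d).ncard) C}
  have hSne : S.Nonempty := by
    -- With T = 0 every function is bad and the stages cost at most 3 * 2^d on top of the cube
    -- count, so any exponent above 4 is admissible.
    refine ⟨6, by norm_num, ?_⟩
    have h0 : DoubleExpBound (notBadCount 1 0) 1 := by
      refine Eventually.of_forall fun d => ?_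
      rw [notBadCount_zero]
      push_cast
      positivity
    exact (doubleExpBound_bad one_ne_zero 0 (C := 5) (by norm_num)).of_add h0
      (ncard_latinSet_le 1 0) (by norm_num) (by norm_num)
  have hbdd : BddBelow S := ⟨1, fun C h => h.1⟩
  have hge : 1 ≤ sInf S := le_csInf hSne fun C h => h.1
  have hinf : sInf S ≤ 1 := by
    by_contra hcon
    push Not at hcon
    set C₀ := sInf S
    set δ := C₀ - 1 with hδ
    have hδpos : 0 < δ := by rw [hδ]; linarith
    -- T makes the geometric tail at most a quarter of δ. Then s is taken so large that the errors
    -- are small even against the gain δκ. Since C is within δκ/4 of the infimum, one bootstrap step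
    -- goes below it.
    obtain ⟨T, hT⟩ : ∃ T : ℕ, (5 / 6 : ℝ) ^ T < δ / 12 :=
      exists_pow_lt_of_lt_one (by positivity) (by norm_num)
    set κ : ℝ := (1 / 2) ^ T with hκ
    have hκpos : 0 < κ := by positivity
    have hκ1 : κ ≤ 1 := pow_le_one₀ (by norm_num) (by norm_num)
    obtain ⟨s, hs⟩ := exists_nat_gt (max (8 * (T + 2) / δ) (8 / (δ * κ)))
    have hs1 := (le_max_left _ _).trans_lt hs
    have hs2 := (le_max_right _ _).trans_lt hs
    have hspos : (0 : ℝ) < s := lt_of_le_of_lt (by positivity) hs2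
    have hs0 : s ≠ 0 := by rintro rfl; simp at hspos
    rw [div_lt_iff₀ (by positivity)] at hs1 hs2
    obtain ⟨C, hCS, hC1⟩ := exists_lt_of_csInf_lt hSne
      (show C₀ < C₀ + δ * κ / 4 from by
        have : 0 < δ * κ / 4 := by positivity
        linarith)
    have hCC : C₀ ≤ C := csInf_le hbdd hCS
    have hinv1 : (T + 2 : ℝ) / s < δ / 8 := by
      rw [div_lt_iff₀ hspos]
      linarith
    have hinv2 : (1 : ℝ) / s < δ * κ / 8 := by
      rw [div_lt_iff₀ hspos]
      linarith
    have hinv3 : (T : ℝ) / (2 * s) + 1 / s = (T + 2 : ℝ) / s / 2 := by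
      field_simp
    have hinv4 : (2 : ℝ) / s = 2 * (1 / s) := by ring
    have hnew : DoubleExpBound (fun d => (latinSet d).ncard) (C₀ - δ * κ / 8) := by
      refine doubleExpBound_latin_step hs0 T hCS.1 hCS.2 ?_ ?_
      · have : δ * κ ≤ δ := by nlinarith
        linarith
      · rw [← hκ, hinv4]
        nlinarith
    have : C₀ ≤ C₀ - δ * κ / 8 := csInf_le hbdd ⟨by nlinarith, hnew⟩
    have : 0 < δ * κ / 8 := by positivity
    linarith
  obtain ⟨C', hC'S, hC'⟩ := exists_lt_of_csInf_lt hSne (hinf.trans_lt hC)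
  exact mono hC'.le hC'S.2

end Asymptotics

/-! ### Finite checks on the Shrikhande graph, by 16-bit masks. -/

section Masks

/-- The vertices of the Shrikhande graph. -/
abbrev ShVertex : Type := ZMod 4 × ZMod 4

/-- The position of a vertex in a bit mask. -/
def vertexIndex (v : ShVertex) : ℕ := 4 * v.1.val + v.2.val

/-- The vertex at a given position of a bit mask. -/
def vertexAt (p : ℕ) : ShVertex := ((p / 4 : ℕ), (p % 4 : ℕ))

/-- The set of vertices encoded by a bit mask. -/
def maskFun (j : ℕ) (v : ShVertex) : Bool := j.testBit (vertexIndex v)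

lemma vertexAt_vertexIndex (v : ShVertex) : vertexAt (vertexIndex v) = v := by
  revert v; decide

lemma vertexIndex_lt (v : ShVertex) : vertexIndex v < 16 := by
  revert v; decide

lemma vertexIndex_vertexAt {p : ℕ} (hp : p < 16) : vertexIndex (vertexAt p) = p := by
  interval_cases p <;> decide

lemma testBit_eq_maskFun (j : ℕ) {p : ℕ} (hp : p < 16) : j.testBit p = maskFun j (vertexAt p) := by
  rw [maskFun, vertexIndex_vertexAt hp]

lemma testBit_of_le {j p : ℕ} (hj : j < 65536) (hp : 16 ≤ p) : j.testBit p = false :=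
  Nat.testBit_lt_two_pow (hj.trans_le (by
    calc 65536 = 2 ^ 16 := by norm_num
      _ ≤ 2 ^ p := Nat.pow_le_pow_right (by norm_num) hp))

lemma land_eq_zero_of_disjoint {j k : ℕ} (hj : j < 65536)
    (h : ∀ v, maskFun j v = true → maskFun k v = false) : j &&& k = 0 := by
  refine Nat.eq_of_testBit_eq fun p => ?_
  rw [Nat.testBit_land, Nat.zero_testBit]
  by_cases hp : p < 16
  · rw [testBit_eq_maskFun j hp, testBit_eq_maskFun k hp]
    have := h (vertexAt p)
    cases h1 : maskFun j (vertexAt p)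
    · rfl
    · rw [this h1]; rfl
  · rw [testBit_of_le hj (by omega)]; rfl

/-- The bit mask of a row of a set of vertices. -/
def rowMask (J : ShVertex → Bool) (a : ZMod 4) : ℕ :=
  (J (a, 0)).toNat + 2 * (J (a, 1)).toNat + 4 * (J (a, 2)).toNat + 8 * (J (a, 3)).toNat

/-- The bit mask of a set of vertices. -/
def setMask (J : ShVertex → Bool) : ℕ :=
  rowMask J 0 + 16 * rowMask J 1 + 256 * rowMask J 2 + 4096 * rowMask J 3

lemma rowMask_lt (J : ShVertex → Bool) (a : ZMod 4) : rowMask J a < 16 := by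
  have h0 := (J (a, 0)).toNat_lt
  have h1 := (J (a, 1)).toNat_lt
  have h2 := (J (a, 2)).toNat_lt
  have h3 := (J (a, 3)).toNat_lt
  unfold rowMask
  omega

lemma setMask_lt (J : ShVertex → Bool) : setMask J < 65536 := by
  have h0 := rowMask_lt J 0
  have h1 := rowMask_lt J 1
  have h2 := rowMask_lt J 2
  have h3 := rowMask_lt J 3
  unfold setMask
  omega

lemma testBit_rowMask (J : ShVertex → Bool) (a b : ZMod 4) :
    (rowMask J a).testBit b.val = J (a, b) := by
  have h : ∀ x y z w : Bool, ∀ c : ZMod 4, (x.toNat + 2 * y.toNat + 4 * z.toNat +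
      8 * w.toNat).testBit c.val = if c = 0 then x else if c = 1 then y else if c = 2 then z
      else w := by decide
  rw [rowMask, h]
  have hb : b = 0 ∨ b = 1 ∨ b = 2 ∨ b = 3 := by revert b; decide
  rcases hb with rfl | rfl | rfl | rfl <;> rfl

lemma setMask_div (J : ShVertex → Bool) (a : ZMod 4) :
    setMask J / 2 ^ (4 * a.val) % 16 = rowMask J a := by
  have h0 := rowMask_lt J 0
  have h1 := rowMask_lt J 1
  have h2 := rowMask_lt J 2
  have h3 := rowMask_lt J 3
  have ha : a = 0 ∨ a = 1 ∨ a = 2 ∨ a = 3 := by revert a; decide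
  unfold setMask
  rcases ha with rfl | rfl | rfl | rfl
  · change _ / 1 % 16 = _; omega
  · change _ / 16 % 16 = _; omega
  · change _ / 256 % 16 = _; omega
  · change _ / 4096 % 16 = _; omega

lemma maskFun_setMask (J : ShVertex → Bool) : maskFun (setMask J) = J := by
  funext v
  obtain ⟨a, b⟩ := v
  have hb : b.val < 4 := ZMod.val_lt b
  rw [← testBit_rowMask J a b, ← setMask_div J a, maskFun, vertexIndex]
  have h16 : (16 : ℕ) = 2 ^ 4 := by norm_num
  rw [h16, Nat.testBit_mod_two_pow, Nat.testBit_div_two_pow]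
  simp [hb, add_comm]

lemma shrikhande_adj_iff (v w : ShVertex) : shrikhande.Adj v w ↔
    (v - w = (1, 0) ∨ v - w = (0, 1) ∨ v - w = (1, 1)) ∨
      (w - v = (1, 0) ∨ w - v = (0, 1) ∨ w - v = (1, 1)) := by
  have : (v - w = (1, 0) ∨ v - w = (0, 1) ∨ v - w = (1, 1)) ∨
      (w - v = (1, 0) ∨ w - v = (0, 1) ∨ w - v = (1, 1)) → v ≠ w := by
    revert v w; decide
  simp only [shrikhande, SimpleGraph.circulantGraph, SimpleGraph.fromRel_adj,
    Set.mem_insert_iff, Set.mem_singleton_iff]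
  tauto

instance : DecidableRel shrikhande.Adj := fun v w => decidable_of_iff _ (shrikhande_adj_iff v w).symm

/-- The neighbourhoods of the vertices as bit masks. -/
def neighborMasks : List ℕ := [36922, 12389, 24778, 49301, 937, 1619, 3238, 2396, 14992, 25904,
  51808, 38336, 43267, 21254, 42508, 23561]

lemma testBit_neighborMasks : ∀ p < 16, ∀ q < 16,
    (neighborMasks.getD p 0).testBit q = decide (shrikhande.Adj (vertexAt p) (vertexAt q)) := by
  decide +kernel

/-- The independent sets of size four of the Shrikhande graph, as bit masks. -/
def codeMasks : List ℕ := [1285, 2565, 16705, 9345, 1290, 2570, 18450, 33410, 5140, 33060, 10280,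
  4680, 20560, 41040, 20640, 41120]

/-- Whether a bit mask encodes an independent set of size four. -/
def isCodeMask (j : ℕ) : Bool :=
  ((List.range 16).all fun p => !j.testBit p || (j &&& neighborMasks.getD p 0) == 0) &&
    ((List.range 16).countP fun p => j.testBit p) == 4

/-- An independent set of size four. -/
def IsShCode (J : ShVertex → Bool) : Prop :=
  (∀ v w, shrikhande.Adj v w → J v = true → J w = false) ∧ ∑ v, (J v).toNat = 4

/-- A row is a 4-cycle with only seven independent sets, so 7^4 masks suffice instead of 2^16. -/
lemma isCodeMask_sound : ([0, 1, 2, 4, 5, 8, 10].all fun r₀ => [0, 1, 2, 4, 5, 8, 10].all fun r₁ =>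
    [0, 1, 2, 4, 5, 8, 10].all fun r₂ => [0, 1, 2, 4, 5, 8, 10].all fun r₃ =>
      !isCodeMask (r₀ + 16 * r₁ + 256 * r₂ + 4096 * r₃) ||
        codeMasks.contains (r₀ + 16 * r₁ + 256 * r₂ + 4096 * r₃)) = true := by
  decide +kernel

lemma IsShCode.isCodeMask {J : ShVertex → Bool} (hJ : IsShCode J) :
    isCodeMask (setMask J) = true := by
  rw [_root_.isCodeMask, Bool.and_eq_true]
  constructor
  · rw [List.all_eq_true]
    intro p hp
    rw [List.mem_range] at hp
    rw [Bool.or_eq_true, Bool.not_eq_true', beq_iff_eq, or_iff_not_imp_left, Bool.not_eq_false]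
    intro hpj
    rw [testBit_eq_maskFun _ hp, maskFun_setMask] at hpj
    refine land_eq_zero_of_disjoint (setMask_lt J) fun v hv => ?_
    rw [maskFun_setMask] at hv
    rw [maskFun, testBit_neighborMasks p hp _ (vertexIndex_lt v), vertexAt_vertexIndex,
      decide_eq_false_iff_not]
    intro hadj
    rw [hJ.1 _ _ hadj hpj] at hv
    simp at hv
  · have h := hJ.2
    rw [beq_iff_eq, ← h]
    have h1 : ∀ p < 16, (setMask J).testBit p = J (vertexAt p) := fun p hp => by
      rw [testBit_eq_maskFun _ hp, maskFun_setMask]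
    have h2 : ((List.range 16).countP fun p => (setMask J).testBit p) =
        (List.range 16).countP fun p => J (vertexAt p) := by
      refine List.countP_congr fun p hp => ?_
      rw [h1 p (List.mem_range.1 hp)]
    have h3 : ∑ v, (J v).toNat = ∑ p ∈ Finset.range 16, (J (vertexAt p)).toNat := by
      symm
      refine Finset.sum_bij (fun p _ => vertexAt p) (fun _ _ => Finset.mem_univ _) ?_ ?_ fun _ _ => rfl
      · intro p hp q hq h
        rw [← vertexIndex_vertexAt (Finset.mem_range.1 hp), h,
          vertexIndex_vertexAt (Finset.mem_range.1 hq)]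
      · intro v _
        exact ⟨vertexIndex v, Finset.mem_range.2 (vertexIndex_lt v), vertexAt_vertexIndex v⟩
    have h4 : ∀ n (g : ℕ → Bool), (List.range n).countP g = ∑ p ∈ Finset.range n, (g p).toNat := by
      intro n g
      induction n with
      | zero => rfl
      | succ n ih =>
        rw [List.range_succ, List.countP_append, ih, Finset.sum_range_succ]
        cases hg : g n <;> simp [hg]
    rw [h2, h3, h4 16 fun p => J (vertexAt p)]

lemma IsShCode.rowMask_mem {J : ShVertex → Bool} (hJ : IsShCode J) (a : ZMod 4) :
    rowMask J a ∈ [0, 1, 2, 4, 5, 8, 10] := by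
  have h : ∀ x y z w : Bool, (x = true → y = false) → (y = true → z = false) →
      (z = true → w = false) → (w = true → x = false) →
      x.toNat + 2 * y.toNat + 4 * z.toNat + 8 * w.toNat ∈ [0, 1, 2, 4, 5, 8, 10] := by decide
  refine h _ _ _ _ (hJ.1 _ _ ?_) (hJ.1 _ _ ?_) (hJ.1 _ _ ?_) (hJ.1 _ _ ?_) <;>
  · rw [shrikhande_adj_iff]
    simp only [Prod.mk_sub_mk, sub_self, Prod.mk.injEq]
    decide +revert

lemma IsShCode.exists_mask {J : ShVertex → Bool} (hJ : IsShCode J) :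
    ∃ j ∈ codeMasks, J = maskFun j := by
  refine ⟨setMask J, ?_, (maskFun_setMask J).symm⟩
  have h := isCodeMask_sound
  simp only [List.all_eq_true] at h
  have := h _ (hJ.rowMask_mem 0) _ (hJ.rowMask_mem 1) _ (hJ.rowMask_mem 2) _ (hJ.rowMask_mem 3)
  have hm : _root_.isCodeMask (rowMask J 0 + 16 * rowMask J 1 + 256 * rowMask J 2 +
    4096 * rowMask J 3) = true := hJ.isCodeMask
  rw [hm] at this
  simpa [setMask] using this

/-- The unions of two disjoint independent sets of size four, as bit masks. -/
def balancedMasks : List ℕ := [3855, 5965, 7710, 11565, 11915, 14025, 15420, 19275, 19735, 21845,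
  21850, 21925, 21930, 23125, 23130, 23205, 23210, 26985, 27795, 29905, 30840, 34695, 35630, 37740,
  38550, 42325, 42330, 42405, 42410, 43605, 43610, 43685, 43690, 45800, 46260, 50115, 51510, 53620,
  53970, 57825, 59570, 61680]

/-- The connected components of the graphs induced by the balanced sets, as bit masks. -/
def componentMasks : List ℕ := [15, 240, 3840, 4369, 5965, 6210, 7710, 8580, 8738, 11565, 11915,
  14025, 15420, 16920, 17476, 19275, 19735, 21850, 21925, 21930, 23125, 23205, 23210, 26985, 27795,
  29905, 30840, 33825, 34695, 34952, 35630, 37740, 38550, 42325, 42330, 42410, 43605, 43610, 43685,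
  45800, 46260, 50115, 51510, 53620, 53970, 57825, 59570, 61440]

/-- The union of two disjoint independent sets of size four. -/
def IsShBalanced (G : ShVertex → Bool) : Prop :=
  ∃ J J', IsShCode J ∧ IsShCode J' ∧ (∀ v, J v = true → J' v = false) ∧ ∀ v, G v = (J v || J' v)

lemma lor_mem_balancedMasks : (codeMasks.all fun j => codeMasks.all fun j' =>
    (j &&& j') != 0 || balancedMasks.contains (j ||| j')) = true := by
  decide +kernel

lemma IsShBalanced.exists_mask {G : ShVertex → Bool} (hG : IsShBalanced G) :
    ∃ g ∈ balancedMasks, G = maskFun g := by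
  obtain ⟨J, J', hJ, hJ', hdis, hG⟩ := hG
  obtain ⟨j, hj, rfl⟩ := hJ.exists_mask
  obtain ⟨j', hj', rfl⟩ := hJ'.exists_mask
  refine ⟨j ||| j', ?_, ?_⟩
  · have h := lor_mem_balancedMasks
    simp only [List.all_eq_true] at h
    have h1 := h j hj j' hj'
    have hlt : ∀ j ∈ codeMasks, j < 65536 := by decide
    rw [land_eq_zero_of_disjoint (hlt j hj) hdis] at h1
    simpa using h1
  · funext v
    rw [hG, maskFun, maskFun, maskFun, Nat.testBit_lor]

/-- One step of growing a set inside `U`. -/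
def floodStep (U m : ℕ) : ℕ :=
  (List.range 16).foldr (fun p acc => if m.testBit p then acc ||| (neighborMasks.getD p 0 &&& U)
    else acc) m

/-- The part of `U` within distance four of a vertex. -/
def floodMask (U p : ℕ) : ℕ := floodStep U (floodStep U (floodStep U (floodStep U (1 <<< p))))

lemma floodMask_mem : (balancedMasks.all fun g => (List.range 16).all fun p =>
    !g.testBit p || (componentMasks.contains (floodMask g p) && (floodMask g p).testBit p)) = true := by
  decide +kernel

lemma compl_mem_balancedMasks : (balancedMasks.all fun g =>
    balancedMasks.contains (65535 ^^^ g)) = true := by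
  decide +kernel

/-- Each listed component lies in at most one balanced set, so constancy on it with a known value
determines a balanced function. -/
lemma balancedMasks_const : (componentMasks.all fun c => balancedMasks.all fun g =>
    !((g &&& c) == c) || balancedMasks.all fun g' => !((g' &&& c) == c) || g == g') = true := by
  decide +kernel

/-- Applied in both orders, this says that listed components on which two different balanced sets
agree are disjoint or equal. -/
lemma balancedMasks_separated : (balancedMasks.all fun g => balancedMasks.all fun g' => g == g' ||
    let A := componentMasks.filter fun c => (c &&& (g ^^^ g')) == 0
    A.all fun c => A.all fun c' => (c &&& c') == 0 || (c &&& c') == c) = true := by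
  decide +kernel

lemma maskFun_compl (g : ℕ) (v : ShVertex) : maskFun (65535 ^^^ g) v = !maskFun g v := by
  have h : (65535 : ℕ).testBit (vertexIndex v) = true := by revert v; decide
  rw [maskFun, maskFun, Nat.testBit_xor, h, Bool.true_xor]

/-- The bits of `m` correspond to vertices in `S`. -/
def MaskSubset (m : ℕ) (S : Set ShVertex) : Prop := ∀ q, m.testBit q = true → q < 16 ∧ vertexAt q ∈ S

lemma MaskSubset.floodStep {g m : ℕ} {S : Set ShVertex}
    (hS : ∀ v ∈ S, ∀ w, shrikhande.Adj v w → maskFun g w = true → w ∈ S) (hm : MaskSubset m S) :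
    MaskSubset (floodStep g m) S := by
  have key : ∀ l : List ℕ, MaskSubset (l.foldr (fun p acc => if m.testBit p then
      acc ||| (neighborMasks.getD p 0 &&& g) else acc) m) S := by
    intro l
    induction l with
    | nil => exact hm
    | cons p l ih =>
      rw [List.foldr_cons]
      split_ifs with hp
      · obtain ⟨hp16, hpS⟩ := hm p hp
        intro q hq
        rw [Nat.testBit_lor, Bool.or_eq_true] at hq
        rcases hq with hq | hq
        · exact ih q hq
        · rw [Nat.testBit_land, Bool.and_eq_true] at hq
          have hq16 : q < 16 := by
            by_contra hcon
            have hlt : ∀ p < 16, neighborMasks.getD p 0 < 65536 := by decide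
            rw [testBit_of_le (hlt p hp16) (by omega)] at hq
            simp at hq
          rw [testBit_neighborMasks p hp16 q hq16, decide_eq_true_eq] at hq
          exact ⟨hq16, hS _ hpS _ hq.1 (by rw [← testBit_eq_maskFun _ hq16]; exact hq.2)⟩
      · exact ih
  exact key _

/-- Flooding from `v` inside the level set never leaves the closed set `S`, and by the finite check
it ends in a listed component. -/
lemma exists_component_of_mask {g : ℕ} (hg : g ∈ balancedMasks) {S : Set ShVertex}
    (hS : ∀ v ∈ S, ∀ w, shrikhande.Adj v w → maskFun g w = true → w ∈ S) {v : ShVertex}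
    (hv : v ∈ S) (hgv : maskFun g v = true) :
    ∃ c ∈ componentMasks, maskFun c v = true ∧ ∀ w, maskFun c w = true → w ∈ S := by
  have h := floodMask_mem
  simp only [List.all_eq_true] at h
  have h1 := h g hg _ (List.mem_range.2 (vertexIndex_lt v))
  rw [show g.testBit (vertexIndex v) = true from hgv] at h1
  simp only [Bool.not_true, Bool.false_or, Bool.and_eq_true, List.contains_iff_mem] at h1
  refine ⟨_, h1.1, h1.2, ?_⟩
  have h0 : MaskSubset (1 <<< vertexIndex v) S := by
    intro q hq
    rw [Nat.one_shiftLeft, Nat.testBit_two_pow] at hq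
    rw [← of_decide_eq_true hq]
    exact ⟨vertexIndex_lt v, by rwa [vertexAt_vertexIndex]⟩
  have h4 : MaskSubset (floodMask g (vertexIndex v)) S :=
    (((h0.floodStep hS).floodStep hS).floodStep hS).floodStep hS
  intro w hw
  have := (h4 _ hw).2
  rwa [vertexAt_vertexIndex] at this

lemma exists_mask_eq_iff {G : ShVertex → Bool} (hG : IsShBalanced G) (u : Bool) :
    ∃ g ∈ balancedMasks, ∀ v, maskFun g v = true ↔ G v = u := by
  obtain ⟨g, hg, rfl⟩ := hG.exists_mask
  cases u
  · have h := compl_mem_balancedMasks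
    simp only [List.all_eq_true, List.contains_iff_mem] at h
    exact ⟨_, h g hg, fun v => by rw [maskFun_compl]; simp⟩
  · exact ⟨g, hg, fun v => Iff.rfl⟩

/-- A set closed inside a level set of a balanced function contains a component. -/
lemma IsShBalanced.exists_component {G : ShVertex → Bool} (hG : IsShBalanced G) {u : Bool}
    {S : Set ShVertex} (hS : ∀ v ∈ S, ∀ w, shrikhande.Adj v w → G w = u → w ∈ S) {v : ShVertex}
    (hv : v ∈ S) (hu : G v = u) :
    ∃ c ∈ componentMasks, maskFun c v = true ∧ ∀ w, maskFun c w = true → w ∈ S := by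
  obtain ⟨g, hg, hgG⟩ := exists_mask_eq_iff hG u
  exact exists_component_of_mask hg (fun v hv w hw h => hS v hv w hw ((hgG w).1 h)) hv
    ((hgG v).2 hu)

lemma land_eq_of_subset {c g : ℕ} (hc : c < 65536)
    (h : ∀ v, maskFun c v = true → maskFun g v = true) : g &&& c = c := by
  refine Nat.eq_of_testBit_eq fun p => ?_
  rw [Nat.testBit_land]
  by_cases hp : p < 16
  · rw [testBit_eq_maskFun c hp, testBit_eq_maskFun g hp]
    have := h (vertexAt p)
    cases h1 : maskFun c (vertexAt p)
    · simp
    · rw [this h1]; rfl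
  · rw [testBit_of_le hc (by omega)]; simp

lemma componentMasks_lt : ∀ c ∈ componentMasks, c < 65536 := by decide

lemma IsShBalanced.eq_of_const {G G' : ShVertex → Bool} (hG : IsShBalanced G)
    (hG' : IsShBalanced G') {c : ℕ} (hc : c ∈ componentMasks) {u : Bool}
    (h : ∀ v, maskFun c v = true → G v = u) (h' : ∀ v, maskFun c v = true → G' v = u) : G = G' := by
  obtain ⟨g, hg, hgG⟩ := exists_mask_eq_iff hG u
  obtain ⟨g', hg', hgG'⟩ := exists_mask_eq_iff hG' u
  have hk := balancedMasks_const
  simp only [List.all_eq_true] at hk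
  have h1 := hk c hc g hg
  rw [land_eq_of_subset (componentMasks_lt c hc) fun v hv => (hgG v).2 (h v hv)] at h1
  simp only [BEq.rfl, Bool.not_true, Bool.false_or, List.all_eq_true] at h1
  have h2 := h1 g' hg'
  rw [land_eq_of_subset (componentMasks_lt c hc) fun v hv => (hgG' v).2 (h' v hv)] at h2
  simp only [BEq.rfl, Bool.not_true, Bool.false_or, beq_iff_eq] at h2
  subst h2
  funext v
  have h3 : G v = u ↔ G' v = u := (hgG v).symm.trans (hgG' v)
  revert h3
  cases G v <;> cases G' v <;> cases u <;> simp

lemma IsShBalanced.eq_of_union {G G' : ShVertex → Bool} (hG : IsShBalanced G)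
    (hG' : IsShBalanced G') {c c' : ℕ} (hc : c ∈ componentMasks) (hc' : c' ∈ componentMasks)
    {v₀ v₁ : ShVertex} (h0 : maskFun c v₀ = true) (h0' : maskFun c' v₀ = true)
    (h1 : maskFun c v₁ = true) (h1' : maskFun c' v₁ = false)
    (h : ∀ v, maskFun c v = true ∨ maskFun c' v = true → G v = G' v) : G = G' := by
  obtain ⟨g, hg, rfl⟩ := hG.exists_mask
  obtain ⟨g', hg', rfl⟩ := hG'.exists_mask
  have hk := balancedMasks_separated
  simp only [List.all_eq_true] at hk
  have hk := hk g hg g' hg'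
  rw [Bool.or_eq_true, beq_iff_eq] at hk
  rcases hk with rfl | hk
  · rfl
  exfalso
  simp only [List.all_eq_true, List.mem_filter, beq_iff_eq, Bool.or_eq_true] at hk
  have hz : ∀ c ∈ componentMasks, (∀ v, maskFun c v = true → maskFun g v = maskFun g' v) →
      c &&& (g ^^^ g') = 0 := by
    intro c hc hcv
    refine land_eq_zero_of_disjoint (componentMasks_lt c hc) fun v hv => ?_
    have := hcv v hv
    simp only [maskFun] at this
    rw [maskFun, Nat.testBit_xor, this, Bool.xor_self]
  rcases hk c ⟨hc, hz c hc fun v hv => h v (Or.inl hv)⟩ c'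
    ⟨hc', hz c' hc' fun v hv => h v (Or.inr hv)⟩ with h2 | h2
  · have h3 : (c &&& c').testBit (vertexIndex v₀) = true := by
      rw [Nat.testBit_land, Bool.and_eq_true]; exact ⟨h0, h0'⟩
    rw [h2] at h3
    simp at h3
  · have h3 : c.testBit (vertexIndex v₁) = true := h1
    rw [← h2, Nat.testBit_land, Bool.and_eq_true] at h3
    have h4 : c'.testBit (vertexIndex v₁) = false := h1'
    rw [h4] at h3
    simp at h3

end Masks

/-! ### The three types of independent 4-sets. -/

section ShTypes

/-- The elements of the set lie in rows of the same parity. -/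
def IsRowType (J : ShVertex → Bool) : Prop :=
  ∀ v w, J v = true → J w = true → v.1 = w.1 ∨ v.1 = w.1 + 2

/-- The sets of row type that are not of another type. -/
def skewSet (α β : ZMod 4) (v : ShVertex) : Bool :=
  decide ((v.1 = α ∧ (v.2 = β ∨ v.2 = β + 2)) ∨ (v.1 = α + 2 ∧ (v.2 = β + 1 ∨ v.2 = β + 3)))

/-- An automorphism of the Shrikhande graph permuting the types of independent sets. -/
def shRotation : ShVertex ≃ ShVertex where
  toFun v := (v.1 - v.2, v.1)
  invFun v := (v.2, v.2 - v.1)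
  left_inv v := by simp
  right_inv v := by simp

lemma shRotation_adj {v w : ShVertex} (h : shrikhande.Adj v w) :
    shrikhande.Adj (shRotation v) (shRotation w) := by
  rw [shrikhande_adj_iff] at h ⊢
  have : shRotation v - shRotation w = shRotation (v - w) := by
    simp only [shRotation, Equiv.coe_fn_mk, Prod.mk_sub_mk, Prod.fst_sub, Prod.snd_sub]
    congr 1
    abel
  have h2 : shRotation w - shRotation v = shRotation (w - v) := by
    simp only [shRotation, Equiv.coe_fn_mk, Prod.mk_sub_mk, Prod.fst_sub, Prod.snd_sub]
    congr 1
    abel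
  rw [this, h2]
  have h3 : w - v = -(v - w) := by abel
  rw [h3] at h ⊢
  generalize v - w = z at h ⊢
  revert z
  decide

lemma IsShCode.rotate {J : ShVertex → Bool} (hJ : IsShCode J) :
    IsShCode fun v => J (shRotation v) :=
  ⟨fun _ _ h => hJ.1 _ _ (shRotation_adj h),
    (shRotation.sum_comp fun v => (J v).toNat).trans hJ.2⟩

lemma forall_isShCode {P : (ShVertex → Bool) → Prop} (h : ∀ j ∈ codeMasks, P (maskFun j))
    {J : ShVertex → Bool} (hJ : IsShCode J) : P J := by
  obtain ⟨j, hj, rfl⟩ := hJ.exists_mask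
  exact h j hj

lemma IsShCode.types {J : ShVertex → Bool} (hJ : IsShCode J) :
    IsRowType J ∨ ∃ α β, (∀ v, J v = skewSet α β v) ∨
      (∀ v, J (shRotation v) = skewSet α β v) ∨
      ∀ v, J (shRotation (shRotation v)) = skewSet α β v := by
  refine forall_isShCode (P := fun J => (∀ v w, J v = true → J w = true → v.1 = w.1 ∨
    v.1 = w.1 + 2) ∨ ∃ α β, (∀ v, J v = skewSet α β v) ∨
      (∀ v, J (shRotation v) = skewSet α β v) ∨
      ∀ v, J (shRotation (shRotation v)) = skewSet α β v) ?_ hJ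
  decide +kernel

lemma IsShCode.eq_skewSet {J : ShVertex → Bool} (hJ : IsShCode J) {α β γ : ZMod 4}
    (hdis : ∀ v, skewSet α β v = true → J v = false) (hγ : J (α, γ) = true) (v : ShVertex) :
    J v = skewSet α (β + 1) v := by
  refine forall_isShCode (P := fun J => ∀ α β γ, (∀ v, skewSet α β v = true → J v = false) →
    J (α, γ) = true → ∀ v, J v = skewSet α (β + 1) v) ?_ hJ α β γ hdis hγ v
  decide +kernel

lemma skewSet_row (α β : ZMod 4) : (skewSet α β (α, 0) || skewSet α β (α, 1)) = true ∧
    (skewSet α β (α, 2) || skewSet α β (α, 3)) = true := by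
  revert α β
  decide

/-- A 4-set not of row type meets every row in exactly one point, so exactly one half of row `α` is
hit. -/
lemma IsShCode.isRowType {J : ShVertex → Bool} (hJ : IsShCode J) (α : ZMod 4)
    (h : (J (α, 0) || J (α, 1)) = (J (α, 2) || J (α, 3))) : IsRowType J := by
  refine forall_isShCode (P := fun J => ∀ α, (J (α, 0) || J (α, 1)) = (J (α, 2) || J (α, 3)) →
    ∀ v w, J v = true → J w = true → v.1 = w.1 ∨ v.1 = w.1 + 2) ?_ hJ α h
  decide +kernel

lemma IsShCode.add_two {J : ShVertex → Bool} (hJ : IsShCode J) (hA : IsRowType J) (v : ShVertex) :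
    J (v.1, v.2 + 2) = J v := by
  refine forall_isShCode (P := fun J => (∀ v w, J v = true → J w = true → v.1 = w.1 ∨
    v.1 = w.1 + 2) → ∀ v, J (v.1, v.2 + 2) = J v) ?_ hJ hA v
  decide +kernel

/-- A representative of the vertices congruent to `(c / 2, c % 2)` modulo two. -/
def quarterPoint (ε : Bool) (c : Fin 4) : ShVertex :=
  (((c.val / 2 : ℕ) : ZMod 4) + (if ε then 2 else 0), ((c.val % 2 : ℕ) : ZMod 4))

/-- A set of row type consists of a pair at distance two in each of two rows α and α+2; `ε` selects
one of these rows and the residue modulo two locates the pair. -/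
lemma IsShCode.existsUnique_quarterPoint {J : ShVertex → Bool} (hJ : IsShCode J)
    (hA : IsRowType J) (ε : Bool) : ∃ c, ∀ e, J (quarterPoint ε e) = true ↔ e = c := by
  refine forall_isShCode (P := fun J => (∀ v w, J v = true → J w = true → v.1 = w.1 ∨
    v.1 = w.1 + 2) → ∀ ε, ∃ c, ∀ e, J (quarterPoint ε e) = true ↔ e = c) ?_ hJ hA ε
  decide +kernel

lemma exists_quarterPoint (v : ShVertex) :
    ∃ ε c, quarterPoint ε c = v ∨ quarterPoint ε c = (v.1, v.2 + 2) := by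
  revert v
  decide

end ShTypes

/-! ### Maximum independent sets meet every fibre tightly. -/

section DoobCode

open Function

variable {m n : ℕ}

/-- Every Shrikhande fibre is an independent set of size four and every line over a complete
factor contains exactly one point. -/
def IsDoobCode (M : DoobVertex m n → Bool) : Prop :=
  (∀ (p : DoobVertex m n) i, IsShCode fun v => M (update p.1 i v, p.2)) ∧
    ∀ (p : DoobVertex m n) j, ∃ c, ∀ e, M (p.1, update p.2 j e) = true ↔ e = c

lemma doobGraph_adj_left (p : DoobVertex m n) (i : Fin m) {v w : ShVertex}
    (h : shrikhande.Adj v w) :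
    (doobGraph m n).Adj (update p.1 i v, p.2) (update p.1 i w, p.2) := by
  rw [doobGraph, SimpleGraph.boxProd_adj]
  exact Or.inl ⟨⟨i, by simpa using h, fun k hk => by simp [hk]⟩, rfl⟩

lemma doobGraph_adj_right (p : DoobVertex m n) (j : Fin n) {c e : Fin 4} (h : c ≠ e) :
    (doobGraph m n).Adj (p.1, update p.2 j c) (p.1, update p.2 j e) := by
  rw [doobGraph, SimpleGraph.boxProd_adj]
  exact Or.inr ⟨⟨j, by simpa using h, fun k hk => by simp [hk]⟩, rfl⟩

lemma codeMasks_dominating : ∀ j ∈ codeMasks, ∀ v, maskFun j v = true ∨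
    ∃ w, maskFun j w = true ∧ shrikhande.Adj w v := by
  decide +kernel

/-- Every independent 4-set is dominating, so it cannot be enlarged. -/
lemma shrikhande_indep_sum_le {J : ShVertex → Bool}
    (hJ : ∀ v w, shrikhande.Adj v w → J v = true → J w = false) : ∑ v, (J v).toNat ≤ 4 := by
  classical
  by_contra hcon
  have hsum : ∀ J : ShVertex → Bool, ∑ v, (J v).toNat = (Finset.univ.filter fun v => J v = true).card := by
    intro J
    rw [Finset.card_filter]
    exact Finset.sum_congr rfl fun v _ => by cases J v <;> rfl
  rw [hsum J] at hcon
  obtain ⟨T, hT, hT4⟩ := Finset.exists_subset_card_eq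
    (show 4 ≤ (Finset.univ.filter fun v => J v = true).card by omega)
  have hTJ : ∀ v ∈ T, J v = true := fun v hv => (Finset.mem_filter.1 (hT hv)).2
  have hcode : IsShCode fun v => decide (v ∈ T) := by
    refine ⟨fun v w hvw hv => ?_, ?_⟩
    · rw [decide_eq_true_eq] at hv
      rw [decide_eq_false_iff_not]
      intro hw
      have := hJ v w hvw (hTJ v hv)
      rw [hTJ w hw] at this
      simp at this
    · rw [hsum]
      simpa using hT4
  obtain ⟨v, hv, hvT⟩ : ∃ v, J v = true ∧ v ∉ T := by
    by_contra hno
    push Not at hno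
    have : (Finset.univ.filter fun v => J v = true) ⊆ T := fun v hv =>
      hno v (Finset.mem_filter.1 hv).2
    have := Finset.card_le_card this
    omega
  have hdom := forall_isShCode (P := fun J => ∀ v, J v = true ∨
    ∃ w, J w = true ∧ shrikhande.Adj w v) codeMasks_dominating hcode v
  simp only [decide_eq_true_eq] at hdom
  rcases hdom with h | ⟨w, hw, hadj⟩
  · exact hvT h
  · have := hJ w v hadj (hTJ w hw)
    rw [hv] at this
    simp at this

/-- If a set meets each orbit-like fibre in at most `k` points and its size is as large as
possible, then it meets each fibre in exactly `k` points. -/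
lemma fibre_sum_eq {X G : Type*} [Fintype X] [Fintype G] (σ : G → Equiv.Perm X) (M : X → Bool)
    (k : ℕ) (hle : ∀ x, ∑ g, (M (σ g x)).toNat ≤ k)
    (hM : k * Fintype.card X ≤ Fintype.card G * ∑ x, (M x).toNat) (x : X) :
    ∑ g, (M (σ g x)).toNat = k := by
  have h1 : ∑ x, ∑ g, (M (σ g x)).toNat = Fintype.card G * ∑ x, (M x).toNat := by
    rw [Finset.sum_comm, Finset.sum_congr rfl fun g _ => Equiv.sum_comp (σ g) fun x => (M x).toNat,
      Finset.sum_const, smul_eq_mul, Finset.card_univ]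
  have h2 : ∑ x : X, k = k * Fintype.card X := by
    rw [Finset.sum_const, smul_eq_mul, Finset.card_univ, mul_comm]
  have h3 : ∑ x, ∑ g, (M (σ g x)).toNat = ∑ x : X, k :=
    le_antisymm (Finset.sum_le_sum fun x _ => hle x) (by rw [h1, h2]; exact hM)
  exact (Finset.sum_eq_sum_iff_of_le fun x _ => hle x).1 h3 x (Finset.mem_univ x)

/-- The residues modulo two of a vertex of the Shrikhande graph. -/
def shColor (v : ShVertex) : ZMod 2 × ZMod 2 := ((v.1.val : ZMod 2), (v.2.val : ZMod 2))

/-- A bijection of the four vertices onto `ℤ₂ × ℤ₂`. -/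
def completeColor (c : Fin 4) : ZMod 2 × ZMod 2 := (((c.val / 2 : ℕ) : ZMod 2), (c.val : ZMod 2))

lemma shColor_ne {v w : ShVertex} (h : shrikhande.Adj v w) : shColor v ≠ shColor w := by
  revert v w
  decide

lemma completeColor_ne {c e : Fin 4} (h : c ≠ e) : completeColor c ≠ completeColor e := by
  revert c e
  decide

lemma sum_ne_sum {κ α β : Type*} [Fintype κ] [AddCommGroup β] (f : α → β) {x y : κ → α}
    (i : κ) (hi : f (x i) ≠ f (y i)) (h : ∀ k, k ≠ i → x k = y k) :
    ∑ k, f (x k) ≠ ∑ k, f (y k) := by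
  classical
  rw [← Finset.add_sum_erase _ _ (Finset.mem_univ i),
    ← Finset.add_sum_erase _ (fun k => f (y k)) (Finset.mem_univ i),
    Finset.sum_congr rfl (g := fun k => f (y k)) (s₁ := Finset.univ.erase i)
      fun k hk => by rw [h k (Finset.ne_of_mem_erase hk)]]
  exact fun h => hi (add_right_cancel h)

/-- Summing colours of the coordinates in Z_2^2 is a proper colouring with four colours, and its
largest class has at least a quarter of the vertices. -/
lemma exists_large_indepSet (m n : ℕ) : ∃ t : Finset (DoobVertex m n),
    (doobGraph m n).IsIndepSet (t : Set (DoobVertex m n)) ∧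
      Fintype.card (DoobVertex m n) ≤ 4 * t.card := by
  classical
  let col : DoobVertex m n → ZMod 2 × ZMod 2 := fun p =>
    ∑ i, shColor (p.1 i) + ∑ j, completeColor (p.2 j)
  have hcol : ∀ p q, (doobGraph m n).Adj p q → col p ≠ col q := by
    intro p q h
    rw [doobGraph, SimpleGraph.boxProd_adj] at h
    rcases h with ⟨⟨i, hi, hk⟩, h2⟩ | ⟨⟨j, hj, hk⟩, h1⟩
    · simp only [col, h2]
      exact fun h => sum_ne_sum shColor i (shColor_ne hi) hk (add_right_cancel h)
    · simp only [col, h1]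
      exact fun h => sum_ne_sum completeColor j (completeColor_ne hj) hk (add_left_cancel h)
  by_contra hcon
  push Not at hcon
  have hlt : ∀ y, 4 * (Finset.univ.filter fun p => col p = y).card <
      Fintype.card (DoobVertex m n) := by
    intro y
    refine hcon _ ?_
    intro p hp q hq _ hadj
    simp only [Finset.coe_filter, Finset.mem_univ, true_and, Set.mem_ofPred_eq] at hp hq
    exact hcol p q hadj (hp.trans hq.symm)
  have hsum := Finset.card_eq_sum_card_fiberwise (s := (Finset.univ : Finset (DoobVertex m n)))
    (f := col) (t := Finset.univ) (by simp [Set.MapsTo])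
  have h1 := Finset.sum_lt_sum_of_nonempty (s := (Finset.univ : Finset (ZMod 2 × ZMod 2)))
    Finset.univ_nonempty fun y _ => hlt y
  rw [← Finset.mul_sum, ← hsum, Finset.sum_const, Finset.card_univ, Finset.card_univ, smul_eq_mul] at h1
  have h4 : Fintype.card (ZMod 2 × ZMod 2) = 4 := by decide
  rw [h4] at h1
  exact lt_irrefl _ h1

/-- Maximum independent sets meet all fibres in the maximum possible number of points. -/
lemma isDoobCode_of_mem_MDS {M : Finset (DoobVertex m n)} (hM : M ∈ MDS m n) :
    IsDoobCode fun p => decide (p ∈ M) := by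
  classical
  have hM : (doobGraph m n).IsMaximumIndepSet M := hM
  obtain ⟨t, ht, htcard⟩ := exists_large_indepSet m n
  have hcard : Fintype.card (DoobVertex m n) ≤ 4 * ∑ p, (decide (p ∈ M)).toNat := by
    have h1 : ∑ p, (decide (p ∈ M)).toNat = M.card := by
      have : ∀ p, (decide (p ∈ M)).toNat = if p ∈ M then 1 else 0 := by
        intro p
        by_cases h : p ∈ M <;> simp [h]
      simp [this]
    rw [h1]
    exact htcard.trans (Nat.mul_le_mul_left _ (hM.maximum t ht))
  have hind : ∀ p q, (doobGraph m n).Adj p q → p ∈ M → q ∉ M := fun p q hadj hp hq =>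
    hM.isIndepSet hp hq hadj.ne hadj
  constructor
  · intro p i
    have hindep : ∀ (p : DoobVertex m n) v w, shrikhande.Adj v w →
        decide ((update p.1 i v, p.2) ∈ M) = true → decide ((update p.1 i w, p.2) ∈ M) = false := by
      intro p v w hvw hv
      rw [decide_eq_true_eq] at hv
      rw [decide_eq_false_iff_not]
      exact hind _ _ (doobGraph_adj_left p i hvw) hv
    refine ⟨hindep p, ?_⟩
    -- Translations in coordinate `i` run through the fibre of each point, so `fibre_sum_eq`
    -- applies.
    let σ : ShVertex → Equiv.Perm (DoobVertex m n) := fun g => Equiv.addRight (Pi.single i g, 0)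
    have hσ : ∀ (p : DoobVertex m n), ∑ g, (decide (σ g p ∈ M)).toNat =
        ∑ v, (decide ((update p.1 i v, p.2) ∈ M)).toNat := by
      intro p
      rw [← Equiv.sum_comp (Equiv.addLeft (p.1 i)) fun v => (decide ((update p.1 i v, p.2) ∈ M)).toNat]
      refine Finset.sum_congr rfl fun g _ => ?_
      have : σ g p = (update p.1 i (p.1 i + g), p.2) := by
        refine Prod.ext ?_ ?_
        · funext k
          by_cases hk : k = i
          · subst hk; simp [σ]
          · simp [σ, hk]
        · simp [σ]
      rw [this]
      rfl
    have h16 : Fintype.card ShVertex = 16 := by decide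
    have := fibre_sum_eq σ (fun p => decide (p ∈ M)) 4
      (fun p => by rw [hσ p]; exact shrikhande_indep_sum_le (hindep p))
      (by rw [h16]; omega) p
    rwa [hσ p] at this
  · intro p j
    let σ : Fin 4 → Equiv.Perm (DoobVertex m n) := fun g => Equiv.addRight (0, Pi.single j g)
    have hσ : ∀ (p : DoobVertex m n), ∑ g, (decide (σ g p ∈ M)).toNat =
        ∑ c, (decide ((p.1, update p.2 j c) ∈ M)).toNat := by
      intro p
      rw [← Equiv.sum_comp (Equiv.addLeft (p.2 j)) fun c => (decide ((p.1, update p.2 j c) ∈ M)).toNat]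
      refine Finset.sum_congr rfl fun g _ => ?_
      have : σ g p = (p.1, update p.2 j (p.2 j + g)) := by
        refine Prod.ext ?_ ?_
        · simp [σ]
        · funext k
          by_cases hk : k = j
          · subst hk; simp [σ]
          · simp [σ, hk]
      rw [this]
      rfl
    have hone : ∀ κ : Fin 4 → Bool, (∀ c e, c ≠ e → κ c = true → κ e = false) →
        ∑ c, (κ c).toNat ≤ 1 := by decide
    have hex : ∀ κ : Fin 4 → Bool, ∑ c, (κ c).toNat = 1 → ∃ c, ∀ e, κ e = true ↔ e = c := by decide
    have := fibre_sum_eq σ (fun p => decide (p ∈ M)) 1 (fun p => by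
        rw [hσ p]
        refine hone _ fun c e hce hc => ?_
        rw [decide_eq_true_eq] at hc
        rw [decide_eq_false_iff_not]
        exact hind _ _ (doobGraph_adj_right p j hce) hc)
      (by rw [Fintype.card_fin]; omega) p
    rw [hσ p] at this
    exact hex _ this

end DoobCode

/-! ### Propagation across a Shrikhande coordinate. -/

section ShPropagation

open Function

variable {X X' : Type*} {adj : X → X → Prop} {adj' : X' → X' → Prop}

lemma LinkClosed.mem_of_eq {φ : X → Unit → Bool} {K : Set X} (hK : LinkClosed adj φ K) {x y : X}
    (hx : x ∈ K) (hxy : adj x y) (h : φ y () = φ x ()) : y ∈ K := by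
  refine hK x hx y hxy fun hne => ?_
  have := congrFun hne ()
  rw [h] at this
  simp at this

lemma linkClosed_of_eq {φ : X → Unit → Bool} {K : Set X}
    (h : ∀ x ∈ K, ∀ y, adj x y → φ y () = φ x () → y ∈ K) : LinkClosed adj φ K := by
  intro x hx y hxy hne
  refine h x hx y hxy ?_
  by_contra hcon
  refine hne (funext fun _ => ?_)
  revert hcon
  cases φ y () <;> cases φ x () <;> simp

/-- Components of level sets take over the role of pairs of points on a line. If the link-closed set
looks the same over a whole component, both functions are constant on that component in every fibre.
Otherwise a second, overlapping component appears, and agreement on both components determines a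
balanced set. -/
lemma Propagates.shrikhande {𝒞 : Set (X → Unit → Bool)} {𝒞' : Set (X' → Unit → Bool)}
    (h : Propagates adj 𝒞) (ι : ShVertex → X → X') (hι : ∀ z, ∃ v x, ι v x = z)
    (hadj : ∀ v x y, adj x y → adj' (ι v x) (ι v y))
    (hline : ∀ v w x, shrikhande.Adj v w → adj' (ι v x) (ι w x))
    (h𝒞 : ∀ φ ∈ 𝒞', ∀ v, (fun x => φ (ι v x)) ∈ 𝒞)
    (hbal : ∀ φ ∈ 𝒞', ∀ x, IsShBalanced fun v => φ (ι v x) ()) : Propagates adj' 𝒞' := by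
  intro φ hφ φ' hφ' K hne heq hcl hcl'
  obtain ⟨z, hz⟩ := hne
  obtain ⟨v₀, x₀, rfl⟩ := hι z
  set u := φ (ι v₀ x₀) () with hu
  -- For one-bit functions link-closed means closed under edges that preserve the value, so the
  -- points of `K` at level `u` still form a link-closed set.
  let L : Set X' := {z | z ∈ K ∧ φ z () = u}
  have hLφ' : ∀ z ∈ L, φ' z () = u := fun z hz => by rw [← heq z hz.1]; exact hz.2
  have hL : LinkClosed adj' φ L := linkClosed_of_eq fun x hx y hxy hyx =>
    ⟨hcl.mem_of_eq hx.1 hxy hyx, by rw [hyx]; exact hx.2⟩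
  have hL' : LinkClosed adj' φ' L := linkClosed_of_eq fun x hx y hxy hyx => by
    have hy := hcl'.mem_of_eq hx.1 hxy hyx
    exact ⟨hy, by rw [heq y hy, hyx]; exact hLφ' x hx⟩
  have hcomp : ∀ v x, ι v x ∈ L → ∃ c ∈ componentMasks, maskFun c v = true ∧
      ∀ w, maskFun c w = true → ι w x ∈ L := by
    intro v x hvx
    refine (hbal φ hφ x).exists_component (u := u) (S := {w | ι w x ∈ L}) ?_ hvx hvx.2
    intro w hw w' hadj' hw'
    exact hL.mem_of_eq hw (hline w w' x hadj') (hw'.trans hw.2.symm)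
  have hz₀ : ι v₀ x₀ ∈ L := ⟨hz, rfl⟩
  obtain ⟨c, hc, hcv₀, hcL⟩ := hcomp v₀ x₀ hz₀
  suffices hfib : ∀ x, (fun v => φ (ι v x) ()) = fun v => φ' (ι v x) () by
    funext z
    obtain ⟨v, x, rfl⟩ := hι z
    funext t
    exact congrFun (hfib x) v
  by_cases hcase : ∀ x v w, maskFun c v = true → maskFun c w = true → ι v x ∈ L → ι w x ∈ L
  -- The slices of `L` over the vertices of `c` coincide, so propagation identifies the
  -- corresponding slices of both functions. The common value on `c` may vary from fibre to fibre.
  · have hsame : ∀ ψ ∈ 𝒞', ∀ ψ' ∈ 𝒞', LinkClosed adj' ψ L → LinkClosed adj' ψ' L →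
        (∀ z ∈ L, ψ z () = u) → (∀ z ∈ L, ψ' z () = u) → ∀ v w, maskFun c v = true →
        maskFun c w = true → ∀ x, ψ (ι v x) () = ψ' (ι w x) () := by
      intro ψ hψ ψ' hψ' hc1 hc2 h1 h2 v w hv hw x
      have hset : ι v ⁻¹' L = ι w ⁻¹' L := by
        ext x
        exact ⟨hcase x v w hv hw, hcase x w v hw hv⟩
      have := h _ (h𝒞 ψ hψ v) _ (h𝒞 ψ' hψ' w) (ι v ⁻¹' L) ⟨x₀, hcL v hv⟩ ?_
        (hc1.slice (ι v) (hadj v)) (by rw [hset]; exact hc2.slice (ι w) (hadj w))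
      · exact congrFun (congrFun this x) ()
      · intro x hx
        funext t
        exact (h1 _ hx).trans (h2 _ (hset ▸ hx : x ∈ ι w ⁻¹' L)).symm
    intro x
    have hφL : ∀ z ∈ L, φ z () = u := fun z hz => hz.2
    refine (hbal φ hφ x).eq_of_const (hbal φ' hφ' x) hc (u := φ (ι v₀ x) ()) ?_ ?_
    · intro v hv
      exact hsame φ hφ φ hφ hL hL hφL hφL v v₀ hv hcv₀ x
    · intro v hv
      exact hsame φ' hφ' φ hφ hL' hL hLφ' hφL v v₀ hv hcv₀ x
  -- A component `c'` through `v` misses a vertex `w` of `c`, so it meets `c` but differs from it;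
  -- slices over both components are determined by propagation.
  · push Not at hcase
    obtain ⟨x₁, v, w, hv, hw, hvL, hwL⟩ := hcase
    obtain ⟨c', hc', hc'v, hc'L⟩ := hcomp v x₁ hvL
    have hc'w : maskFun c' w = false := by
      by_contra hcon
      exact hwL (hc'L w (by simpa using hcon))
    have hslice : ∀ v, (ι v ⁻¹' L).Nonempty → ∀ x, φ (ι v x) = φ' (ι v x) := by
      intro v hv
      refine congrFun (h _ (h𝒞 φ hφ v) _ (h𝒞 φ' hφ' v) (ι v ⁻¹' L) hv (fun x hx => heq _ hx.1)
        (hL.slice (ι v) (hadj v)) (hL'.slice (ι v) (hadj v)))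
    intro x
    refine (hbal φ hφ x).eq_of_union (hbal φ' hφ' x) hc hc' hv hc'v hw hc'w ?_
    rintro t (ht | ht)
    · rw [hslice t ⟨x₀, hcL t ht⟩ x]
    · rw [hslice t ⟨x₁, hc'L t ht⟩ x]

end ShPropagation

/-! ### Propagation in Doob graphs. -/

section DoobPropagation

open Function

variable {m n : ℕ}

/-- Vertices differing in at most one coordinate, by an edge if it is a Shrikhande coordinate. -/
def DoobAdj (p q : DoobVertex m n) : Prop :=
  (∃ i v, shrikhande.Adj (p.1 i) v ∧ q = (update p.1 i v, p.2)) ∨ ∃ j c, q = (p.1, update p.2 j c)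

/-- Functions that are balanced on all fibres. -/
def balancedFunctions (m n : ℕ) : Set (DoobVertex m n → Unit → Bool) :=
  {φ | (∀ (p : DoobVertex m n) i, IsShBalanced fun v => φ (update p.1 i v, p.2) ()) ∧
    ∀ (p : DoobVertex m n) j, IsBalancedLine fun c => φ (p.1, update p.2 j c) ()}

lemma propagates_balancedFunctions (m n : ℕ) :
    Propagates (DoobAdj (m := m) (n := n)) (balancedFunctions m n) := by
  induction m with
  | zero =>
    induction n with
    | zero =>
      rintro φ - φ' - K ⟨x, hx⟩ h - -
      funext y
      rw [Subsingleton.elim y x]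
      exact h x hx
    | succ n ih =>
      refine ih.line (fun c p => (p.1, Fin.cons c p.2)) ?_ ?_ ?_ ?_ ?_
      · intro z
        exact ⟨z.2 0, (z.1, Fin.tail z.2), by simp [Fin.cons_self_tail]⟩
      · rintro c p q (⟨i, -⟩ | ⟨j, e, rfl⟩)
        · exact i.elim0
        · exact Or.inr ⟨j.succ, e, by simp [Fin.cons_update]⟩
      · intro c e p _
        exact Or.inr ⟨0, e, by simp [Fin.update_cons_zero]⟩
      · intro φ hφ c
        refine ⟨fun p i => i.elim0, fun p j => ?_⟩
        have := hφ.2 (p.1, Fin.cons c p.2) j.succ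
        simpa only [Fin.cons_update] using this
      · intro φ hφ p _
        have := hφ.2 (p.1, Fin.cons 0 p.2) 0
        simpa only [Fin.update_cons_zero] using this
  | succ m ih =>
    refine ih.shrikhande (fun v p => (Fin.cons v p.1, p.2)) ?_ ?_ ?_ ?_ ?_
    · intro z
      exact ⟨z.1 0, (Fin.tail z.1, z.2), by simp [Fin.cons_self_tail]⟩
    · rintro c p q (⟨i, v, hv, rfl⟩ | ⟨j, e, rfl⟩)
      · exact Or.inl ⟨i.succ, v, by simpa using hv, by simp [Fin.cons_update]⟩
      · exact Or.inr ⟨j, e, rfl⟩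
    · intro v w p hvw
      exact Or.inl ⟨0, w, by simpa using hvw, by simp [Fin.update_cons_zero]⟩
    · intro φ hφ v
      refine ⟨fun p i => ?_, fun p j => hφ.2 (Fin.cons v p.1, p.2) j⟩
      have := hφ.1 (Fin.cons v p.1, p.2) i.succ
      simpa only [Fin.cons_update] using this
    · intro φ hφ p
      have := hφ.1 (Fin.cons 0 p.1, p.2) 0
      simpa only [Fin.update_cons_zero] using this

end DoobPropagation

/-! ### A skew fibre forces the type of all fibres in its coordinate. -/

section Types

open Function

variable {m n : ℕ}

/-- Insertion of a Shrikhande coordinate. -/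
def insertVertex (i : Fin (m + 1)) (v : ShVertex) (p : DoobVertex m n) : DoobVertex (m + 1) n :=
  (i.insertNth (α := fun _ => ShVertex) v p.1, p.2)

lemma insertVertex_update_left (i : Fin (m + 1)) (v w : ShVertex) (p : DoobVertex m n) (k : Fin m) :
    insertVertex i v (update p.1 k w, p.2) =
      (update (insertVertex i v p).1 (i.succAbove k) w, (insertVertex i v p).2) := by
  simp [insertVertex]

lemma IsDoobCode.insertVertex_fibre {M : DoobVertex (m + 1) n → Bool} (hM : IsDoobCode M)
    (i : Fin (m + 1)) (p : DoobVertex m n) : IsShCode fun v => M (insertVertex i v p) := by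
  have := hM.1 (insertVertex i 0 p) i
  simpa only [insertVertex, Fin.update_insertNth] using this

lemma IsDoobCode.eq_false_of_doobAdj {M : DoobVertex m n → Bool} (hM : IsDoobCode M)
    {p q : DoobVertex m n} (hpq : DoobAdj p q) (hne : q ≠ p) (hp : M p = true) : M q = false := by
  rcases hpq with ⟨i, v, hv, rfl⟩ | ⟨j, c, rfl⟩
  · refine (hM.1 p i).1 (p.1 i) v hv ?_
    simpa using hp
  · obtain ⟨e, he⟩ := hM.2 p j
    have h1 : p.2 j = e := (he _).1 (by simpa using hp)
    by_contra hcon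
    have h2 : c = e := (he c).1 (by simpa using hcon)
    apply hne
    rw [h2, ← h1]
    simp

lemma DoobAdj.insertVertex {p q : DoobVertex m n} (h : DoobAdj p q) (i : Fin (m + 1))
    (v : ShVertex) : DoobAdj (insertVertex i v p) (insertVertex i v q) := by
  rcases h with ⟨k, w, hw, rfl⟩ | ⟨j, c, rfl⟩
  · exact Or.inl ⟨i.succAbove k, w, by simpa [_root_.insertVertex] using hw,
      insertVertex_update_left i v w p k⟩
  · exact Or.inr ⟨j, c, rfl⟩

lemma isBalancedLine_of_two {κ κ' : Fin 4 → Bool} {c c' : Fin 4} (h : ∀ e, κ e = true ↔ e = c)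
    (h' : ∀ e, κ' e = true ↔ e = c') (hdis : ∀ e, κ e = true → κ' e = false) :
    IsBalancedLine fun e => κ e || κ' e := by
  have hne : c ≠ c' := by
    rintro rfl
    have := hdis c ((h c).2 rfl)
    rw [(h' c).2 rfl] at this
    simp at this
  have : (Finset.univ.filter fun e => (κ e || κ' e) = true) = {c, c'} := by
    ext e
    simp [h, h']
  rw [IsBalancedLine, this, Finset.card_pair hne]

/-- The slices of a code over adjacent vertices are disjoint codes, so their union is balanced on
all fibres. -/
lemma IsDoobCode.pair_mem {M : DoobVertex (m + 1) n → Bool} (hM : IsDoobCode M)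
    (i : Fin (m + 1)) {v w : ShVertex} (hvw : shrikhande.Adj v w) :
    (fun p (_ : Unit) => M (insertVertex i v p) || M (insertVertex i w p)) ∈
      balancedFunctions m n := by
  have hdis : ∀ p, M (insertVertex i v p) = true → M (insertVertex i w p) = false :=
    fun p => (hM.insertVertex_fibre i p).1 v w hvw
  constructor
  · intro p k
    refine ⟨fun x => M (insertVertex i v (update p.1 k x, p.2)),
      fun x => M (insertVertex i w (update p.1 k x, p.2)), ?_, ?_, fun x => hdis _, fun x => rfl⟩
    · simp only [insertVertex_update_left]
      exact hM.1 _ _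
    · simp only [insertVertex_update_left]
      exact hM.1 _ _
  · intro p j
    obtain ⟨c, hc⟩ := hM.2 (insertVertex i v p) j
    obtain ⟨c', hc'⟩ := hM.2 (insertVertex i w p) j
    exact isBalancedLine_of_two hc hc' fun e => hdis (p.1, update p.2 j e)

/-- If one fibre is a skew set, then all the fibres in this coordinate are of row type. -/
lemma IsDoobCode.isRowType_of_skew {M : DoobVertex (m + 1) n → Bool} (hM : IsDoobCode M)
    (i : Fin (m + 1)) {α β : ZMod 4} {p₀ : DoobVertex m n}
    (h₀ : ∀ v, M (insertVertex i v p₀) = skewSet α β v) (p : DoobVertex m n) :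
    IsRowType fun v => M (insertVertex i v p) := by
  have h01 : ∀ α : ZMod 4, shrikhande.Adj (α, 0) (α, 1) := by decide
  have h23 : ∀ α : ZMod 4, shrikhande.Adj (α, 2) (α, 3) := by decide
  -- A skew fibre meets both halves of row α, so the unions over the two halves agree on `K`. A
  -- neighbouring fibre is disjoint from it, and once it meets row α it must be skew again. Hence
  -- `K` is link-closed for both unions, which then agree everywhere.
  let K : Set (DoobVertex m n) := {p | ∃ β, ∀ v, M (insertVertex i v p) = skewSet α β v}
  have hstep : ∀ p ∈ K, ∀ q, DoobAdj p q → ∀ γ, M (insertVertex i (α, γ) q) = true → q ∈ K := by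
    rintro p ⟨β, hβ⟩ q hpq γ hγ
    by_cases hqp : q = p
    · rw [hqp]; exact ⟨β, hβ⟩
    refine ⟨β + 1, (hM.insertVertex_fibre i q).eq_skewSet (fun v hv => ?_) hγ⟩
    refine hM.eq_false_of_doobAdj (hpq.insertVertex i v) (fun h => hqp ?_) (by rw [hβ, hv])
    have h1 := congrArg Prod.fst h
    have h2 := congrArg Prod.snd h
    exact Prod.ext (Fin.insertNth_right_injective (α := fun _ => ShVertex) v h1) h2
  have hprop := propagates_balancedFunctions m n _ (hM.pair_mem i (h01 α)) _
    (hM.pair_mem i (h23 α)) K ⟨p₀, β, h₀⟩ ?_ (linkClosed_of_eq ?_) (linkClosed_of_eq ?_)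
  · exact (hM.insertVertex_fibre i p).isRowType α (congrFun (congrFun hprop p) ())
  · rintro p ⟨β, hβ⟩
    funext _
    simp only [hβ]
    rw [(skewSet_row α β).1, (skewSet_row α β).2]
  · rintro p hp q hpq h
    obtain ⟨β, hβ⟩ := id hp
    simp only [hβ, (skewSet_row α β).1, Bool.or_eq_true] at h
    rcases h with h | h
    · exact hstep p hp q hpq _ h
    · exact hstep p hp q hpq _ h
  · rintro p hp q hpq h
    obtain ⟨β, hβ⟩ := id hp
    simp only [hβ, (skewSet_row α β).2, Bool.or_eq_true] at h
    rcases h with h | h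
    · exact hstep p hp q hpq _ h
    · exact hstep p hp q hpq _ h

end Types

/-! ### From Doob codes to Latin functions. -/

section CodeCount

open Function

variable {m n : ℕ}

/-- Automorphisms of the Shrikhande graph carrying the row type to each of the three types. -/
def shTurn (k : Fin 3) : ShVertex ≃ ShVertex :=
  ![Equiv.refl _, shRotation, shRotation.trans shRotation] k

lemma IsShCode.turn {J : ShVertex → Bool} (hJ : IsShCode J) (k : Fin 3) :
    IsShCode fun v => J (shTurn k v) := by
  fin_cases k
  · exact hJ
  · exact hJ.rotate
  · exact hJ.rotate.rotate

/-- The automorphism of a Doob graph acting by `shTurn (τ i)` on the `i`-th coordinate. -/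
def turnAll (n : ℕ) (τ : Fin m → Fin 3) : DoobVertex m n ≃ DoobVertex m n :=
  (Equiv.piCongrRight fun i => shTurn (τ i)).prodCongr (Equiv.refl _)

lemma turnAll_apply (τ : Fin m → Fin 3) (p : DoobVertex m n) :
    turnAll n τ p = (fun i => shTurn (τ i) (p.1 i), p.2) := rfl

lemma turnAll_update (τ : Fin m → Fin 3) (p : DoobVertex m n) (i : Fin m) (v : ShVertex) :
    turnAll n τ (update p.1 i v, p.2) =
      (update (turnAll n τ p).1 i (shTurn (τ i) v), (turnAll n τ p).2) := by
  rw [turnAll_apply, turnAll_apply]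
  refine Prod.ext ?_ rfl
  funext k
  by_cases hk : k = i
  · subst hk; simp
  · simp [hk]

lemma IsDoobCode.turn {M : DoobVertex m n → Bool} (hM : IsDoobCode M) (τ : Fin m → Fin 3) :
    IsDoobCode fun p => M (turnAll n τ p) := by
  refine ⟨fun p i => ?_, fun p j => hM.2 (turnAll n τ p) j⟩
  simp only [turnAll_update]
  exact (hM.1 (turnAll n τ p) i).turn (τ i)

lemma turnAll_insertVertex (k : Fin 3) (i : Fin (m + 1)) (v : ShVertex) (p : DoobVertex m n) :
    turnAll n (fun _ => k) (insertVertex i v p) =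
      insertVertex i (shTurn k v) (turnAll n (fun _ => k) p) := by
  refine Prod.ext ?_ rfl
  rw [turnAll_apply, turnAll_apply]
  simp only [insertVertex]
  rw [Fin.eq_insertNth_iff]
  refine ⟨by simp, ?_⟩
  funext l
  simp [Fin.removeNth]

/-- In each coordinate all the fibres of a code are of the same type. -/
lemma IsDoobCode.exists_type {M : DoobVertex m n → Bool} (hM : IsDoobCode M) (i : Fin m) :
    ∃ k, ∀ p : DoobVertex m n, IsRowType fun v => M (update p.1 i (shTurn k v), p.2) := by
  obtain _ | m := m
  · exact i.elim0
  have hins : ∀ (p : DoobVertex (m + 1) n) v,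
      (update p.1 i v, p.2) = insertVertex i v (i.removeNth p.1, p.2) := by
    intro p v
    simp [insertVertex]
  -- If no fibre is skew for any of the three types, every fibre in coordinate `i` is of row type;
  -- otherwise one skew fibre decides.
  by_cases hsk : ∃ (p : DoobVertex m n) (k : Fin 3) (α β : ZMod 4),
      ∀ v, M (insertVertex i (shTurn k v) p) = skewSet α β v
  · obtain ⟨p₀, k, α, β, h⟩ := hsk
    refine ⟨k, fun p => ?_⟩
    have := (hM.turn fun _ => k).isRowType_of_skew i (α := α) (β := β)
      (p₀ := (turnAll n fun _ => k).symm p₀)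
      (fun v => by rw [turnAll_insertVertex, Equiv.apply_symm_apply, h])
      ((turnAll n fun _ => k).symm (i.removeNth p.1, p.2))
    simp only [turnAll_insertVertex, Equiv.apply_symm_apply] at this
    simpa only [hins] using this
  · refine ⟨0, fun p => ?_⟩
    rcases (hM.1 p i).types with h | ⟨α, β, h⟩
    · exact h
    · refine (hsk ?_).elim
      simp only [hins] at h
      rcases h with h | h | h
      · exact ⟨_, 0, α, β, h⟩
      · exact ⟨_, 1, α, β, h⟩
      · exact ⟨_, 2, α, β, h⟩

/-- The codes in a Doob graph. -/
def doobCodes (m n : ℕ) : Set (DoobVertex m n → Bool) := {M | IsDoobCode M}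

/-- The codes all of whose Shrikhande fibres are of row type. -/
def rowCodes (m n : ℕ) : Set (DoobVertex m n → Bool) :=
  {M | IsDoobCode M ∧ ∀ (p : DoobVertex m n) i, IsRowType fun v => M (update p.1 i v, p.2)}

lemma ncard_MDS_le_doobCodes (m n : ℕ) : (MDS m n).ncard ≤ (doobCodes m n).ncard := by
  refine Set.ncard_le_ncard_of_injOn (fun M p => decide (p ∈ M))
    (fun M hM => isDoobCode_of_mem_MDS hM) ?_ (Set.toFinite _)
  intro M _ M' _ h
  ext p
  simpa using congrFun h p

lemma ncard_doobCodes_le (m n : ℕ) : (doobCodes m n).ncard ≤ 3 ^ m * (rowCodes m n).ncard := by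
  have hsub : doobCodes m n ⊆ ⋃ τ : Fin m → Fin 3,
      {M | (fun p => M (turnAll n τ p)) ∈ rowCodes m n} := by
    intro M hM
    choose τ hτ using fun i => IsDoobCode.exists_type hM i
    refine Set.mem_iUnion.2 ⟨τ, IsDoobCode.turn hM τ, fun p i => ?_⟩
    simp only [turnAll_update]
    exact hτ i _
  refine (Set.ncard_le_ncard hsub (Set.toFinite _)).trans ?_
  refine (Set.ncard_iUnion_le_of_fintype _).trans ?_
  calc _ ≤ ∑ τ : Fin m → Fin 3, (rowCodes m n).ncard := by
        refine Finset.sum_le_sum fun τ _ => ?_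
        refine Set.ncard_le_ncard_of_injOn (fun M p => M (turnAll n τ p)) (fun M hM => hM) ?_
          (Set.toFinite _)
        intro M _ M' _ h
        funext p
        have := congrFun h ((turnAll n τ).symm p)
        simpa using this
    _ = _ := by simp

/-- Sets of words meeting each line in exactly one point. -/
def lineCodes (κ : Type*) [DecidableEq κ] : Set ((κ → Fin 4) → Bool) :=
  {h | ∀ y i, ∃ c, ∀ e, h (update y i e) = true ↔ e = c}

/-- The part of a code with prescribed residues of the Shrikhande coordinates. -/
def quarterCode (M : DoobVertex m n → Bool) (ε : Fin m → Bool) (y : Fin m ⊕ Fin n → Fin 4) : Bool :=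
  M (fun i => quarterPoint (ε i) (y (Sum.inl i)), fun j => y (Sum.inr j))

lemma quarterCode_mem {M : DoobVertex m n → Bool} (hM : M ∈ rowCodes m n) (ε : Fin m → Bool) :
    quarterCode M ε ∈ lineCodes (Fin m ⊕ Fin n) := by
  intro y i
  rcases i with i | j
  · obtain ⟨c, hc⟩ := (hM.1.1 (fun i => quarterPoint (ε i) (y (Sum.inl i)),
      fun j => y (Sum.inr j)) i).existsUnique_quarterPoint (hM.2 _ i) (ε i)
    refine ⟨c, fun e => ?_⟩
    rw [← hc e]
    have : (fun k => quarterPoint (ε k) (update y (Sum.inl i) e (Sum.inl k))) =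
        update (fun k => quarterPoint (ε k) (y (Sum.inl k))) i (quarterPoint (ε i) e) := by
      funext k
      by_cases hk : k = i
      · subst hk; simp
      · simp [hk]
    rw [quarterCode, this]
    simp
  · obtain ⟨c, hc⟩ := hM.1.2 (fun i => quarterPoint (ε i) (y (Sum.inl i)),
      fun j => y (Sum.inr j)) j
    refine ⟨c, fun e => ?_⟩
    rw [← hc e]
    have : (fun k => update y (Sum.inr j) e (Sum.inr k)) = update (fun k => y (Sum.inr k)) j e := by
      funext k
      by_cases hk : k = j
      · subst hk; simp
      · simp [hk]
    rw [quarterCode, this]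
    simp

/-- Coordinates are shifted by (0, 2) one at a time; each set of row type is invariant under this
shift. -/
lemma rowCodes_congr {M : DoobVertex m n → Bool} (hM : M ∈ rowCodes m n) (p : DoobVertex m n)
    (x : Fin m → ShVertex) (hx : ∀ i, x i = p.1 i ∨ x i = ((p.1 i).1, (p.1 i).2 + 2)) :
    M (x, p.2) = M p := by
  have key : ∀ S : Finset (Fin m), M (S.piecewise x p.1, p.2) = M p := by
    intro S
    induction S using Finset.induction_on with
    | empty => simp
    | insert i S hi ih =>
      rw [← ih, Finset.piecewise_insert]
      have hq : S.piecewise x p.1 i = p.1 i := Finset.piecewise_eq_of_notMem _ _ _ hi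
      rcases hx i with h | h
      · rw [h, ← hq, update_eq_self]
      · have := (hM.1.1 (S.piecewise x p.1, p.2) i).add_two (hM.2 _ i) (p.1 i)
        rw [h]
        simp only at this
        rw [this, ← hq, update_eq_self]
  have := key Finset.univ
  rwa [Finset.piecewise_univ] at this

/-- Up to shifts by (0, 2), every vertex is a point of some quarter, so the 2^m quarter codes
determine the code. -/
lemma ncard_rowCodes_le (m n : ℕ) :
    (rowCodes m n).ncard ≤ (lineCodes (Fin m ⊕ Fin n)).ncard ^ 2 ^ m := by
  have hinj : Injective fun (M : rowCodes m n) (ε : Fin m → Bool) =>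
      (⟨quarterCode M.1 ε, quarterCode_mem M.2 ε⟩ : lineCodes (Fin m ⊕ Fin n)) := by
    rintro ⟨M, hM⟩ ⟨M', hM'⟩ h
    refine Subtype.ext (funext fun p => ?_)
    choose ε c hεc using fun i => exists_quarterPoint (p.1 i)
    have h1 : quarterCode M ε (Sum.elim c p.2) = quarterCode M' ε (Sum.elim c p.2) :=
      congrFun (congrArg Subtype.val (congrFun h ε)) _
    have h2 : ∀ M ∈ rowCodes m n, quarterCode M ε (Sum.elim c p.2) = M p := by
      intro M hM
      simp only [quarterCode, Sum.elim_inl, Sum.elim_inr]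
      exact rowCodes_congr hM p _ hεc
    exact (h2 M hM).symm.trans (h1.trans (h2 M' hM'))
  have := Nat.card_le_card_of_injective _ hinj
  rw [Nat.card_fun] at this
  simpa [Nat.card_coe_set_eq] using this

lemma ncard_lineCodes_le_of_equiv {κ ν : Type*} [DecidableEq κ] [DecidableEq ν] [Finite κ]
    [Finite ν] (e : κ ≃ ν) : (lineCodes κ).ncard ≤ (lineCodes ν).ncard := by
  refine Set.ncard_le_ncard_of_injOn (fun h y => h fun i => y (e i)) ?_ ?_ (Set.toFinite _)
  · intro h hh y i
    obtain ⟨c, hc⟩ := hh (fun k => y (e k)) (e.symm i)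
    refine ⟨c, fun a => ?_⟩
    rw [← hc a]
    have : (fun k => update y i a (e k)) = update (fun k => y (e k)) (e.symm i) a := by
      funext k
      by_cases hk : k = e.symm i
      · subst hk; simp
      · have : e k ≠ i := fun h => hk (by rw [← h]; simp)
        simp [hk, this]
    rw [← this]
  · intro h _ h' _ hh
    funext y
    have := congrFun hh fun i => y (e.symm i)
    simpa using this

/-- The first letter of a codeword is a Latin function of the remaining ones. -/
lemma ncard_lineCodes_succ_le (r : ℕ) : (lineCodes (Fin (r + 1))).ncard ≤ (latinSet r).ncard := by
  have hex : ∀ h ∈ lineCodes (Fin (r + 1)), ∀ y : Fin r → Fin 4,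
      ∃ c, ∀ e, h (Fin.cons e y) = true ↔ e = c := by
    intro h hh y
    obtain ⟨c, hc⟩ := hh (Fin.cons 0 y) 0
    exact ⟨c, fun e => by rw [← hc e, Fin.update_cons_zero]⟩
  choose! f hf using hex
  refine Set.ncard_le_ncard_of_injOn f ?_ ?_ (Set.toFinite _)
  · intro h hh x i c hc heq
    obtain ⟨a, ha⟩ := hh (Fin.cons (f h x) x) i.succ
    have h1 : x i = a := (ha _).1 (by
      have := (hf h hh x (f h x)).2 rfl
      rwa [← Fin.cons_update, update_eq_self])
    have h2 : c = a := (ha _).1 (by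
      have := (hf h hh (update x i c) (f h x)).2 heq.symm
      rwa [← Fin.cons_update])
    exact hc (h2.trans h1.symm)
  · intro h hh h' hh' heq
    funext z
    obtain ⟨c, y, rfl⟩ := exists_cons_eq z
    rw [Bool.eq_iff_iff, hf h hh, hf h' hh', heq]

/-- The number of maximum independent sets is bounded in terms of the number of Latin
functions. -/
theorem ncard_MDS_le {m n r : ℕ} (hr : m + n = r + 1) :
    (MDS m n).ncard ≤ 3 ^ m * (latinSet r).ncard ^ 2 ^ m := by
  refine (ncard_MDS_le_doobCodes m n).trans ((ncard_doobCodes_le m n).trans ?_)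
  refine Nat.mul_le_mul_left _ ((ncard_rowCodes_le m n).trans ?_)
  refine Nat.pow_le_pow_left ((ncard_lineCodes_le_of_equiv ?_).trans
    (ncard_lineCodes_succ_le r)) _
  exact finSumFinEquiv.trans (finCongr hr)

end CodeCount

/-! ### Conclusion: a bound uniform over all (m,n) with 2m+n = N. -/

lemma eventually_ncard_MDS_le {η : ℝ} (hη : 0 < η) : ∀ᶠ N : ℕ in atTop, ∀ m n : ℕ, 2 * m + n = N →
    ((MDS m n).ncard : ℝ) ≤ (2 : ℝ) ^ ((2 : ℝ) ^ ((N : ℝ) - 1) * (1 + η)) := by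
  obtain ⟨d₀, hd₀⟩ := eventually_atTop.1 (doubleExpBound_latin (C := 1 + η / 2) (by linarith))
  -- Since m+n ≥ N/2, this threshold gives r = m+n-1 ≥ d₀.
  filter_upwards [eventually_ge_atTop (2 * d₀ + 2),
    eventually_poly_le 0 1 0 (show 0 < η / 4 by positivity)] with N hN hpoly m n hmn
  obtain ⟨r, hr⟩ : ∃ r, m + n = r + 1 := ⟨m + n - 1, by omega⟩
  have hlat := hd₀ r (by omega)
  have hNr : (N : ℝ) - 1 = r + m := by
    have : (2 * m + n : ℝ) = N := by exact_mod_cast hmn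
    have : (m + n : ℝ) = r + 1 := by exact_mod_cast hr
    linarith
  have hpow : (2 : ℝ) ^ ((N : ℝ) - 1) = 2 ^ r * 2 ^ m := by
    rw [hNr, Real.rpow_add (by norm_num), Real.rpow_natCast, Real.rpow_natCast]
  have h2 : (2 : ℝ) ^ N = 2 * (2 ^ r * 2 ^ m) := by
    rw [← hpow, Real.rpow_sub_one (by norm_num), Real.rpow_natCast]
    ring
  have h1 : ((MDS m n).ncard : ℝ) ≤ 3 ^ m * ((latinSet r).ncard : ℝ) ^ 2 ^ m := by
    exact_mod_cast ncard_MDS_le hr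
  -- The factor for the types is only 2^N, absorbed by the remaining η/2 in the doubly exponential
  -- bound.
  have h3 : (3 : ℝ) ^ m ≤ (2 : ℝ) ^ (N : ℝ) := by
    rw [Real.rpow_natCast]
    calc (3 : ℝ) ^ m ≤ 4 ^ m := pow_le_pow_left₀ (by norm_num) (by norm_num) _
      _ = 2 ^ (2 * m) := by rw [pow_mul]; norm_num
      _ ≤ 2 ^ N := pow_le_pow_right₀ (by norm_num) (by omega)
  have h4 : ((latinSet r).ncard : ℝ) ^ 2 ^ m ≤ (2 : ℝ) ^ ((1 + η / 2) * 2 ^ r * 2 ^ m) := by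
    have : ((2 : ℝ) ^ m) = ((2 ^ m : ℕ) : ℝ) := by push_cast; rfl
    rw [Real.rpow_mul (by norm_num) ((1 + η / 2) * 2 ^ r), this, Real.rpow_natCast]
    exact pow_le_pow_left₀ (by positivity) hlat _
  calc ((MDS m n).ncard : ℝ) ≤ (2 : ℝ) ^ (N : ℝ) * (2 : ℝ) ^ ((1 + η / 2) * 2 ^ r * 2 ^ m) :=
        h1.trans (mul_le_mul h3 h4 (by positivity) (by positivity))
    _ = (2 : ℝ) ^ ((N : ℝ) + (1 + η / 2) * 2 ^ r * 2 ^ m) := by rw [Real.rpow_add (by norm_num)]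
    _ ≤ _ := by
        refine Real.rpow_le_rpow_of_exponent_le (by norm_num) ?_
        rw [hpow]
        rw [h2] at hpoly
        linarith

lemma ncard_MDS_pos (m n : ℕ) : 0 < (MDS m n).ncard := by
  rw [Set.ncard_pos (Set.toFinite _)]
  exact SimpleGraph.maximumIndepSet_exists

/-- The relative excess of the logarithm of the number of codes. -/
noncomputable def codeExcess (m n : ℕ) : ℝ :=
  max 0 (Real.logb 2 (MDS m n).ncard / (2 : ℝ) ^ (((2 * m + n : ℕ) : ℝ) - 1) - 1)

lemma codeExcess_le_iff {m n : ℕ} {η : ℝ} (hη : 0 ≤ η) : codeExcess m n ≤ η ↔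
    ((MDS m n).ncard : ℝ) ≤ (2 : ℝ) ^ ((2 : ℝ) ^ (((2 * m + n : ℕ) : ℝ) - 1) * (1 + η)) := by
  have hpos : (0 : ℝ) < (MDS m n).ncard := by exact_mod_cast ncard_MDS_pos m n
  rw [← Real.logb_le_iff_le_rpow (by norm_num) hpos, codeExcess, max_le_iff, sub_le_iff_le_add,
    div_le_iff₀ (by positivity), mul_comm, add_comm η]
  exact and_iff_right hη

theorem corollary2 :
    ∃ ε : ℕ → ℝ, Tendsto ε atTop (𝓝 0) ∧
      ∀ m n : ℕ, ((MDS m n).ncard : ℝ) ≤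
        (2 : ℝ) ^ ((2 : ℝ) ^ (((2 * m + n : ℕ) : ℝ) - 1) * (1 + ε (2 * m + n))) := by
  -- The largest excess over the finitely many (m,n) with 2m+n = N; the eventual bounds are uniform
  -- in (m,n), so it tends to 0.
  let ε : ℕ → ℝ := fun N => (Finset.range (N / 2 + 1)).sup' ⟨0, by simp⟩
    fun m => codeExcess m (N - 2 * m)
  have hε0 : ∀ N, 0 ≤ ε N := fun N =>
    (le_max_left _ _).trans (Finset.le_sup' (fun m => codeExcess m (N - 2 * m))
      (show 0 ∈ Finset.range (N / 2 + 1) by simp))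
  refine ⟨ε, ?_, fun m n => ?_⟩
  · rw [Metric.tendsto_atTop']
    intro η hη
    obtain ⟨N₀, hN₀⟩ := eventually_atTop.1 (eventually_ncard_MDS_le (half_pos hη))
    refine ⟨N₀, fun N hN => ?_⟩
    rw [Real.dist_eq, sub_zero, abs_of_nonneg (hε0 N)]
    refine lt_of_le_of_lt (Finset.sup'_le _ _ fun m hm => ?_) (half_lt_self hη)
    have hm' : 2 * m + (N - 2 * m) = N := by
      have := Finset.mem_range.1 hm
      omega
    rw [codeExcess_le_iff (by positivity), hm']
    exact hN₀ N hN.le m _ hm'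
  · rw [← codeExcess_le_iff (hε0 _)]
    have : codeExcess m (2 * m + n - 2 * m) ≤ ε (2 * m + n) :=
      Finset.le_sup' (fun k => codeExcess k (2 * m + n - 2 * k))
        (Finset.mem_range.2 (by omega))
    rwa [Nat.add_sub_cancel_left] at this
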